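/- **Setting.** Let $\boldsymbol q=R_1\bowtie\dots\bowtie R_m$ be a fixed acyclic join query over a finite set $\mathbf A$ of real-valued attributes, each of which occurs in some relation; $\mathbf A_j\subseteq\mathbf A$ is the attribute set of $R_j$, and acyclic means that there is a tree on the relations in which, for every attribute, the relations containing it are connected. Let $\emptyset\ne\mathbf A_u\subseteq\mathbf A$ and $d_u=|\mathbf A_u|$. For a database instance $\mathbf D$, where each relation is a finite set of tuples, let $\boldsymbol q(\mathbf D)=\{t\in\mathbb R^{\mathbf A}:\pi_{\mathbf A_j}(t)\in R_j\text{ for all }j\}$ and let $\boldsymbol q_u(\mathbf D)$ be the *multiset* of the projections $\pi_{\mathbf A_u}(t)\in\mathbb R^{d_u}$, $t\in\boldsymbol q(\mathbf D)$. For a weighted (multi)set $P\subset\mathbb R^{d_u}$ and a set $Y$ of centers put $\mathbf v_Y(P)=\sum_{p\in P}w(p)\min_{y\in Y}\|p-y\|_2$ (with $w\equiv1$ if $P$ is unweighted). Let $\mathrm{OPT}_k(P)$ be the minimum of $\mathbf v_Y(P)$ over all $Y\subset\mathbb R^{d_u}$ with $|Y|=k$, and $\mathrm{OPT}^{\mathrm{disc}}_k(P)$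 the minimum over all $Y\subseteq P$ with $|Y|=k$. A weighted set $\mathcal C$ is an $\varepsilon$-coreset of $P$ if $(1-\varepsilon)\mathbf v_Y(P)\le\mathbf v_Y(\mathcal C)\le(1+\varepsilon)\mathbf v_Y(P)$ for all $Y\subset\mathbb R^{d_u}$ with $|Y|=k$. Running times are numbers of steps on a deterministic real RAM (unit-cost arithmetic, comparisons and square roots on reals; unit-cost addition, subtraction and comparison of natural numbers used as counters and addresses). The algorithm may call a given black box, a $\gamma$-approximation algorithm ($\gamma\ge1$) for weighted geometric (respectively discrete) $k$-median on explicitly given weighted point sets, whose call on $p$ points takes $T_\gamma(p)$ time, with $T_\gamma$ nondecreasing. **Theorem.** There is an algorithm (one for $\boldsymbol q$ and $\mathbf A_u$) with the following property. Its input consists of an instance $\mathbf D$ in which each relation has at most $N$ tuples ($N\ge2$), an integer $k\ge1$, a nonempty finite set $X\subset\mathbb R^{d_u}$, a number $\varepsilon\in(0,1)$, a real number $\alpha$, and a real number $r$ with $$\mathbf v_X(\boldsymbol q_u(\mathbf D))\le r\le\alpha\,\mathrm{OPT}_k(\boldsymbol q_u(\mathbf D)).$$ Given the black box for geometric $k$-median,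 it computes 1. a weighted set $\mathcal C$ of points of $\boldsymbol q_u(\mathbf D)$, with positive weights and $|\mathcal C|=O(|X|\log N)$, that is an $\varepsilon$-coreset of $\boldsymbol q_u(\mathbf D)$, and 2. a set $\mathcal S\subset\mathbb R^{d_u}$ of exactly $k$ points and a number $r_u$ with $$\mathbf v_{\mathcal S}(\boldsymbol q_u(\mathbf D))\le r_u\le(1+\varepsilon)\,\gamma\,\mathrm{OPT}_k(\boldsymbol q_u(\mathbf D)),$$ in time at most $K\,|X|^{d_u+1}N\log_2^{d_u+2}N+T_\gamma\big(\lfloor K|X|\log_2 N\rfloor\big)$. Here $K$, like the constant in the bound on $|\mathcal C|$, depends only on $\boldsymbol q,\mathbf A_u,\varepsilon,\alpha$. In particular, if $T_\gamma(2x)\le B\,T_\gamma(x)$ for all $x$, the time is $O\big(|X|^{d_u+1}N\log^{d_u+2}N+T_\gamma(\lceil|X|\log_2 N\rceil)\big)$, where the constant may depend on $B$ as well. Likewise, there is an algorithm for the discrete version: under the same assumptions, if moreover $\boldsymbol q_u(\mathbf D)$ has at least $k$ distinct points, then, given the black box for discrete $k$-median, it computes within the same time bounds a set $\mathcal C$ as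 in 1., a set $\mathcal S\subseteq\boldsymbol q_u(\mathbf D)$ of exactly $k$ points and a number $r_u$ with $$\mathbf v_{\mathcal S}(\boldsymbol q_u(\mathbf D))\le r_u\le(2+\varepsilon)\,\gamma\,\mathrm{OPT}^{\mathrm{disc}}_k(\boldsymbol q_u(\mathbf D)).$$ -/

import Mathlib

namespace RelCluster

/-! ### Join queries and database instances -/

/-- A full join query `R₁ ⋈ ... ⋈ R_m` over `d` attributes (all with domain `ℝ`):
`attr j` is the set of attributes of the `j`-th relation. -/
structure JoinQuery where
  d : ℕ
  m : ℕ
  attr : Fin m → Finset (Fin d)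
  cover : ∀ a, ∃ j, a ∈ attr j

/-- Acyclicity: there is a join tree, i.e. a tree on the relations in which, for every attribute,
the relations that contain it form a connected part. -/
def JoinQuery.Acyclic (q : JoinQuery) : Prop :=
  ∃ T : SimpleGraph (Fin q.m), T.IsTree ∧ ∀ a, (T.induce {j | a ∈ q.attr j}).Connected

/-- A tuple of the `j`-th relation. -/
abbrev JoinQuery.Tuple (q : JoinQuery) (j : Fin q.m) : Type := {a // a ∈ q.attr j} → ℝ

/-- A database instance: every relation is a finite set of tuples, stored as a table, that is,
listed without repetition in an arbitrary order. -/
structure Instance (q : JoinQuery) where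
  rows : ∀ j, List (q.Tuple j)
  nodup : ∀ j, (rows j).Nodup

/-- The set `q(D)` of join results. -/
def joinSet {q : JoinQuery} (D : Instance q) : Set (Fin q.d → ℝ) :=
  {t | ∀ j, (fun a : {a // a ∈ q.attr j} => t a) ∈ D.rows j}

theorem joinSet_finite {q : JoinQuery} (D : Instance q) : (joinSet D).Finite := by
  have h : (Set.pi Set.univ fun j => {x : q.Tuple j | x ∈ D.rows j}).Finite :=
    Set.Finite.pi fun j => List.finite_toSet (D.rows j)
  refine (h.preimage (f := fun (t : Fin q.d → ℝ) j (a : {a // a ∈ q.attr j}) => t a) ?_).subset ?_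
  · intro s _ t _ hst
    funext a
    obtain ⟨j, hj⟩ := q.cover a
    exact congrFun (congrFun hst j) ⟨a, hj⟩
  · intro t ht j _
    exact ht j

/-- The Euclidean space with one coordinate for every attribute in `U`. -/
abbrev Pt {q : JoinQuery} (U : Finset (Fin q.d)) : Type := EuclideanSpace ℝ {a // a ∈ U}

/-- Projection of a tuple onto the attributes in `U`. -/
noncomputable def proj {q : JoinQuery} (U : Finset (Fin q.d)) (t : Fin q.d → ℝ) : Pt U :=
  WithLp.toLp 2 fun a => t a

/-- The multiset projection of `q(D)` onto the attributes in `U`. -/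
noncomputable def joinProj {q : JoinQuery} (D : Instance q) (U : Finset (Fin q.d)) :
    Multiset (Pt U) :=
  (joinSet_finite D).toFinset.val.map (proj U)

/-! ### k-median clustering -/

section Median
variable {E : Type*} [PseudoMetricSpace E]

/-- The k-median cost of the centers `Y` on a weighted multiset of points: the sum of
`w(p) * φ(p, Y)` over the points `p`, with `φ(p, Y)` the distance to the nearest center. -/
noncomputable def cost (P : Multiset (E × ℝ)) (Y : Set E) : ℝ :=
  (P.map fun p => p.2 * Metric.infDist p.1 Y).sum

/-- A multiset of points as a weighted multiset with all weights `1`. -/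
def unweighted (P : Multiset E) : Multiset (E × ℝ) := P.map fun p => (p, 1)

/-- The optimum cost over all sets of exactly `k` centers. -/
noncomputable def opt (k : ℕ) (P : Multiset (E × ℝ)) : ℝ :=
  ⨅ Y : {Y : Set E // Y.encard = k}, cost P Y

/-- The optimum cost over all sets of exactly `k` centers taken from the points themselves. -/
noncomputable def optDisc (k : ℕ) (P : Multiset (E × ℝ)) : ℝ :=
  ⨅ Y : {Y : Set E // Y.encard = k ∧ ∀ y ∈ Y, ∃ p ∈ P, p.1 = y}, cost P Y

/-- A weighted set, stored as a list: distinct points with positive weights. -/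
def IsWeightedSet (C : List (E × ℝ)) : Prop :=
  (C.map Prod.fst).Nodup ∧ ∀ p ∈ C, 0 < p.2

/-- `C` is an `ε`-coreset of `P` for k-median clustering. -/
def IsCoreset (k : ℕ) (ε : ℝ) (C : List (E × ℝ)) (P : Multiset (E × ℝ)) : Prop :=
  ∀ Y : Set E, Y.encard = k →
    (1 - ε) * cost P Y ≤ cost (C : Multiset (E × ℝ)) Y ∧
      cost (C : Multiset (E × ℝ)) Y ≤ (1 + ε) * cost P Y

/-- `f` is a `γ`-approximation algorithm for weighted geometric k-median: it returns `k` distinct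
centers. -/
def IsGeomApprox (k : ℕ) (γ : ℝ) (f : List (E × ℝ) → List E) : Prop :=
  ∀ C, IsWeightedSet C →
    (f C).Nodup ∧ (f C).length = k ∧
      cost (C : Multiset (E × ℝ)) {p | p ∈ f C} ≤ γ * opt k (C : Multiset (E × ℝ))

/-- `f` is a `γ`-approximation algorithm for weighted discrete k-median: on sets of at least `k`
points it returns `k` distinct centers among them. -/
def IsDiscApprox (k : ℕ) (γ : ℝ) (f : List (E × ℝ) → List E) : Prop :=
  ∀ C, IsWeightedSet C → k ≤ C.length →
    (f C).Nodup ∧ (f C).length = k ∧ (∀ y ∈ f C, y ∈ C.map Prod.fst) ∧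
      cost (C : Multiset (E × ℝ)) {p | p ∈ f C} ≤ γ * optDisc k (C : Multiset (E × ℝ))

end Median

/-! ### The machine model: a real RAM with a step count

Programs are finite texts of an imperative language. Their memory consists of variables and
arrays of two sorts: natural numbers (counters and addresses; addition, truncated subtraction,
comparison) and real numbers (field operations, square root, comparison; no rounding, and no
conversion to natural numbers). A program mentions finitely many names. Every evaluated node
of an expression and every executed instruction is one step. One further instruction hands a
weighted set of `p` points to the clustering algorithm for the standard setting; it takes
`T p` steps (plus one). -/

section Machine
variable {q : JoinQuery} (U : Finset (Fin q.d))

/-- Variables for natural numbers. Inputs: the table sizes, the number of given centers, `k`.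
Output: the size of the coreset. -/
inductive NVar (q : JoinQuery)
  | size (j : Fin q.m)
  | numX
  | k
  | numC
  | tmp (i : ℕ)

/-- Variables for real numbers. Inputs: `ε`, `α`, `r`. Output: `r_u`. -/
inductive RVar
  | eps
  | alpha
  | r
  | ru
  | tmp (i : ℕ)

/-- Arrays of real numbers. Inputs: the tables and the given centers, column by column. Outputs:
the coreset (coordinates and weights) and the coordinates of the solution. -/
inductive RArr {q : JoinQuery} (U : Finset (Fin q.d))
  | table (j : Fin q.m) (a : {a // a ∈ q.attr j})
  | center (a : {a // a ∈ U})
  | corePt (a : {a // a ∈ U})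
  | coreWt
  | sol (a : {a // a ∈ U})
  | tmp (i : ℕ)

/-- Expressions for natural numbers; `arr b e` is entry `e` of the `b`-th array of naturals. -/
inductive NExp (q : JoinQuery)
  | const (c : ℕ)
  | var (x : NVar q)
  | arr (b : ℕ) (e : NExp q)
  | plus (e₁ e₂ : NExp q)
  | minus (e₁ e₂ : NExp q)

/-- Expressions for real numbers, with rational constants. -/
inductive RExp {q : JoinQuery} (U : Finset (Fin q.d))
  | const (c : ℚ)
  | var (x : RVar)
  | arr (b : RArr U) (e : NExp q)
  | plus (e₁ e₂ : RExp U)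
  | minus (e₁ e₂ : RExp U)
  | times (e₁ e₂ : RExp U)
  | over (e₁ e₂ : RExp U)
  | root (e : RExp U)

/-- Tests. -/
inductive Test {q : JoinQuery} (U : Finset (Fin q.d))
  | nle (e₁ e₂ : NExp q)
  | rle (e₁ e₂ : RExp U)
  | neg (b : Test U)
  | conj (b₁ b₂ : Test U)

/-- Programs. -/
inductive Prog {q : JoinQuery} (U : Finset (Fin q.d))
  | skip
  | setN (x : NVar q) (e : NExp q)
  | setR (x : RVar) (e : RExp U)
  | putN (b : ℕ) (i : NExp q) (e : NExp q)
  | putR (b : RArr U) (i : NExp q) (e : RExp U)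
  | seq (p₁ p₂ : Prog U)
  | cond (b : Test U) (p₁ p₂ : Prog U)
  | loop (b : Test U) (p : Prog U)
  | cluster

/-- The contents of the memory. -/
structure Store {q : JoinQuery} (U : Finset (Fin q.d)) where
  nvar : NVar q → ℕ
  rvar : RVar → ℝ
  narr : ℕ → ℕ → ℕ
  rarr : RArr U → ℕ → ℝ

variable {U}

def NExp.eval (s : Store U) : NExp q → ℕ
  | .const c => c
  | .var x => s.nvar x
  | .arr b e => s.narr b (e.eval s)
  | .plus e₁ e₂ => e₁.eval s + e₂.eval s
  | .minus e₁ e₂ => e₁.eval s - e₂.eval s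

def NExp.steps : NExp q → ℕ
  | .const _ => 1
  | .var _ => 1
  | .arr _ e => e.steps + 1
  | .plus e₁ e₂ => e₁.steps + e₂.steps + 1
  | .minus e₁ e₂ => e₁.steps + e₂.steps + 1

noncomputable def RExp.eval (s : Store U) : RExp U → ℝ
  | .const c => c
  | .var x => s.rvar x
  | .arr b e => s.rarr b (e.eval s)
  | .plus e₁ e₂ => e₁.eval s + e₂.eval s
  | .minus e₁ e₂ => e₁.eval s - e₂.eval s
  | .times e₁ e₂ => e₁.eval s * e₂.eval s
  | .over e₁ e₂ => e₁.eval s / e₂.eval s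
  | .root e => Real.sqrt (e.eval s)

def RExp.steps : RExp U → ℕ
  | .const _ => 1
  | .var _ => 1
  | .arr _ e => e.steps + 1
  | .plus e₁ e₂ => e₁.steps + e₂.steps + 1
  | .minus e₁ e₂ => e₁.steps + e₂.steps + 1
  | .times e₁ e₂ => e₁.steps + e₂.steps + 1
  | .over e₁ e₂ => e₁.steps + e₂.steps + 1
  | .root e => e.steps + 1

def Test.holds (s : Store U) : Test U → Prop
  | .nle e₁ e₂ => e₁.eval s ≤ e₂.eval s
  | .rle e₁ e₂ => e₁.eval s ≤ e₂.eval s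
  | .neg b => ¬ b.holds s
  | .conj b₁ b₂ => b₁.holds s ∧ b₂.holds s

def Test.steps : Test U → ℕ
  | .nle e₁ e₂ => e₁.steps + e₂.steps + 1
  | .rle e₁ e₂ => e₁.steps + e₂.steps + 1
  | .neg b => b.steps + 1
  | .conj b₁ b₂ => b₁.steps + b₂.steps + 1

open scoped Classical in
noncomputable def Store.setN (s : Store U) (x : NVar q) (v : ℕ) : Store U :=
  { s with nvar := fun y => if y = x then v else s.nvar y }

open scoped Classical in
noncomputable def Store.setR (s : Store U) (x : RVar) (v : ℝ) : Store U :=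
  { s with rvar := fun y => if y = x then v else s.rvar y }

def Store.putN (s : Store U) (b i v : ℕ) : Store U :=
  { s with narr := fun c j => if c = b ∧ j = i then v else s.narr c j }

open scoped Classical in
noncomputable def Store.putR (s : Store U) (b : RArr U) (i : ℕ) (v : ℝ) : Store U :=
  { s with rarr := fun c j => if c = b ∧ j = i then v else s.rarr c j }

/-- The weighted points held in the first `numC` entries of the coreset arrays. -/
noncomputable def Store.coreset (s : Store U) : List (Pt U × ℝ) :=
  (List.range (s.nvar .numC)).map fun i =>
    (WithLp.toLp 2 fun a => s.rarr (.corePt a) i, s.rarr .coreWt i)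

/-- The set of points held in the first `k` entries of the solution arrays. -/
def Store.solution (s : Store U) (k : ℕ) : Set (Pt U) :=
  {y | ∃ i < k, y = WithLp.toLp 2 fun a => s.rarr (.sol a) i}

/-- Write a list of points into the solution arrays. -/
noncomputable def Store.putSolution (s : Store U) (S : List (Pt U)) : Store U :=
  { s with
    rarr := fun b i =>
      match b with
      | .sol a => if h : i < S.length then S[i] a else s.rarr (.sol a) i
      | b => s.rarr b i }

/-- `Exec f T p s s' t`: started with memory `s`, the program `p` halts with memory `s'` after `t`
steps, where the instruction `cluster` runs the algorithm `f` on the points in the coreset arrays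
and takes `T` of their number many steps. -/
inductive Exec (f : List (Pt U × ℝ) → List (Pt U)) (T : ℕ → ℕ) :
    Prog U → Store U → Store U → ℕ → Prop
  | skip (s) : Exec f T .skip s s 1
  | setN (x e s) : Exec f T (.setN x e) s (s.setN x (e.eval s)) (e.steps + 1)
  | setR (x e s) : Exec f T (.setR x e) s (s.setR x (e.eval s)) (e.steps + 1)
  | putN (b i e s) :
      Exec f T (.putN b i e) s (s.putN b (i.eval s) (e.eval s)) (i.steps + e.steps + 1)
  | putR (b i e s) :
      Exec f T (.putR b i e) s (s.putR b (i.eval s) (e.eval s)) (i.steps + e.steps + 1)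
  | seq {p₁ p₂ s₁ s₂ s₃ t₁ t₂} : Exec f T p₁ s₁ s₂ t₁ → Exec f T p₂ s₂ s₃ t₂ →
      Exec f T (.seq p₁ p₂) s₁ s₃ (t₁ + t₂)
  | condTrue {b p₁ p₂ s s' t} : b.holds s → Exec f T p₁ s s' t →
      Exec f T (.cond b p₁ p₂) s s' (b.steps + t + 1)
  | condFalse {b p₁ p₂ s s' t} : ¬ b.holds s → Exec f T p₂ s s' t →
      Exec f T (.cond b p₁ p₂) s s' (b.steps + t + 1)
  | loopDone {b p s} : ¬ b.holds s → Exec f T (.loop b p) s s (b.steps + 1)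
  | loopStep {b p s₁ s₂ s₃ t₁ t₂} : b.holds s₁ → Exec f T p s₁ s₂ t₁ →
      Exec f T (.loop b p) s₂ s₃ t₂ → Exec f T (.loop b p) s₁ s₃ (b.steps + t₁ + t₂ + 1)
  | cluster (s) :
      Exec f T .cluster s (s.putSolution (f s.coreset)) (T (s.nvar .numC) + 1)

/-- The initial memory: it holds the input and is zero elsewhere. -/
noncomputable def input (D : Instance q) (X : List (Pt U)) (k : ℕ) (ε α r : ℝ) : Store U where
  nvar x :=
    match x with
    | .size j => (D.rows j).length
    | .numX => X.length
    | .k => k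
    | .numC => 0
    | .tmp _ => 0
  rvar x :=
    match x with
    | .eps => ε
    | .alpha => α
    | .r => r
    | .ru => 0
    | .tmp _ => 0
  narr _ _ := 0
  rarr b i :=
    match b with
    | .table j a => if h : i < (D.rows j).length then (D.rows j)[i] a else 0
    | .center a => if h : i < X.length then X[i] a else 0
    | .corePt _ => 0
    | .coreWt => 0
    | .sol _ => 0
    | .tmp _ => 0

end Machine

end RelCluster

open RelCluster

/-! The join may have as many as N^m tuples, so it is never written down. It is replaced by O(|X|
log N) weighted representatives that are close enough to preserve the cost for every set of centers.

Error. Let n be the number of join results, ρ(p) the distance of p to X, and σ = r/n. The distance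
to a set of centers is 1-Lipschitz, so if every projected result p moves by at most (2d+1)δ(ρ(p)+σ),
every cost changes by at most (2d+1)δ(v_X + nσ) ≤ (2d+1)δ·2r, and r ≤ α·OPT. With δ of order
ε/(d(1+α²)) this is at most (ε/8)·OPT (`Represents.abs_cost_sub_le`, `Represents.isCoreset`). The
additive σ is what makes points near X affordable: its total contribution is r.

Cells. Every axis is cut at the coordinates of the centers shifted by ±y, where y is 0 or runs
through δσ, δσ(1+δ), ... up to r. Values in one cell differ by at most δ times (distance to the
center + σ), so the results in one box lie close together in the required sense
(`abs_sub_le_of_same_cuts`, `CutCells.dist_le`). As r = nσ and n ≤ N^m, the progression has O(log N)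
terms (`exists_levels`). This gives O(|X| log N) cells per axis.

Counting. For each box the number of join results in it and one of them are needed. Along a join
tree a leaf relation is eliminated by multiplying each row of its parent by the total weight of the
matching leaf rows; the sum of products over all join results is unchanged (`sum_families_insert`).
Going back down the tree recovers a result of positive weight (`query_runs`). Each query is linear
in N because matching rows are found by address: the values of every attribute are sorted once and
numbered, and sums of these numbers act as mixed-radix keys (`makeKeys_runs`).

Size. There may be about (|X| log N)^d nonempty boxes. A box is therefore charged to an existing
coreset point whenever one lies within δ(ρ+σ) of its representative; only otherwise the
representative is added (`Represents.extend`). The coreset is thus separated, and packing bounds its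
size: a point is determined by its nearest center, the dyadic size of ρ+σ and a grid cell of its
offset, which leaves O(|X| log N) possibilities (`Represents.le_packing`).

Conclusion. The black box runs on this ε/8-coreset, and its guarantee transfers to the join
(`costBound_spec`). In the discrete case the optimal centers need not be coreset points; moving them
to nearest coreset points costs the factor 2 (`optDisc_le_two_mul_cost`). The running time is
dominated by one linear query and one scan of X and of the coreset per box (`time_bound`).

Programs are verified by a Hoare calculus with step counts (`Runs`) and a frame rule (`Exec.agree`).
-/

namespace RelCluster

/-! ### Reasoning about programs -/

section Framework
variable {q : JoinQuery} {U : Finset (Fin q.d)}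

/-- Memory locations; arrays count as one location. -/
inductive Loc {q : JoinQuery} (U : Finset (Fin q.d))
  | nv (x : NVar q)
  | rv (x : RVar)
  | na (b : ℕ)
  | ra (b : RArr U)

/-- The code of a scratch name: a kind and two further indices. -/
def nm (k j a : ℕ) : ℕ := Nat.pair k (Nat.pair j a)

@[simp] theorem nm_inj {k j a k' j' a' : ℕ} :
    nm k j a = nm k' j' a' ↔ k = k' ∧ j = j' ∧ a = a' := by
  simp [nm, Nat.pair_eq_pair]

/-- The kind of a location: `0` for the inputs, `1` for the coreset, `2` for the solution and
its cost. -/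
def Loc.kind : Loc U → ℕ
  | .nv (.tmp b) => b.unpair.1
  | .nv .numC => 1
  | .nv _ => 0
  | .rv (.tmp b) => b.unpair.1
  | .rv .ru => 2
  | .rv _ => 0
  | .na b => b.unpair.1
  | .ra (.tmp b) => b.unpair.1
  | .ra (.corePt _) => 1
  | .ra .coreWt => 1
  | .ra (.sol _) => 2
  | .ra _ => 0

@[simp] theorem kind_nv_tmp (k j a : ℕ) : (Loc.nv (.tmp (nm k j a)) : Loc U).kind = k := by
  simp [Loc.kind, nm]
@[simp] theorem kind_rv_tmp (k j a : ℕ) : (Loc.rv (.tmp (nm k j a)) : Loc U).kind = k := by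
  simp [Loc.kind, nm]
@[simp] theorem kind_na (k j a : ℕ) : (Loc.na (nm k j a) : Loc U).kind = k := by
  simp [Loc.kind, nm]
@[simp] theorem kind_ra_tmp (k j a : ℕ) : (Loc.ra (.tmp (nm k j a)) : Loc U).kind = k := by
  simp [Loc.kind, nm]
@[simp] theorem kind_numC : (Loc.nv .numC : Loc U).kind = 1 := rfl
@[simp] theorem kind_size (j) : (Loc.nv (.size j) : Loc U).kind = 0 := rfl
@[simp] theorem kind_numX : (Loc.nv .numX : Loc U).kind = 0 := rfl
@[simp] theorem kind_k : (Loc.nv .k : Loc U).kind = 0 := rfl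
@[simp] theorem kind_eps : (Loc.rv .eps : Loc U).kind = 0 := rfl
@[simp] theorem kind_alpha : (Loc.rv .alpha : Loc U).kind = 0 := rfl
@[simp] theorem kind_r : (Loc.rv .r : Loc U).kind = 0 := rfl
@[simp] theorem kind_ru : (Loc.rv .ru : Loc U).kind = 2 := rfl
@[simp] theorem kind_table (j a) : (Loc.ra (.table j a) : Loc U).kind = 0 := rfl
@[simp] theorem kind_center (a) : (Loc.ra (.center a) : Loc U).kind = 0 := rfl
@[simp] theorem kind_corePt (a) : (Loc.ra (.corePt a) : Loc U).kind = 1 := rfl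
@[simp] theorem kind_coreWt : (Loc.ra .coreWt : Loc U).kind = 1 := rfl
@[simp] theorem kind_sol (a) : (Loc.ra (.sol a) : Loc U).kind = 2 := rfl

/-- The locations that a program may write. -/
@[simp] def Prog.writes : Prog U → Set (Loc U)
  | .skip => ∅
  | .setN x _ => {.nv x}
  | .setR x _ => {.rv x}
  | .putN b _ _ => {.na b}
  | .putR b _ _ => {.ra b}
  | .seq p₁ p₂ => p₁.writes ∪ p₂.writes
  | .cond _ p₁ p₂ => p₁.writes ∪ p₂.writes
  | .loop _ p => p.writes
  | .cluster => {l | ∃ a, l = .ra (.sol a)}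

/-- The memories agree outside of `W`. -/
structure Agree (W : Set (Loc U)) (s s' : Store U) : Prop where
  nv : ∀ x, .nv x ∉ W → s'.nvar x = s.nvar x
  rv : ∀ x, .rv x ∉ W → s'.rvar x = s.rvar x
  na : ∀ b, .na b ∉ W → s'.narr b = s.narr b
  ra : ∀ b, .ra b ∉ W → s'.rarr b = s.rarr b

theorem Agree.refl (W : Set (Loc U)) (s : Store U) : Agree W s s :=
  ⟨fun _ _ => rfl, fun _ _ => rfl, fun _ _ => rfl, fun _ _ => rfl⟩

theorem Agree.trans {W : Set (Loc U)} {s₁ s₂ s₃ : Store U} (h : Agree W s₁ s₂)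
    (h' : Agree W s₂ s₃) : Agree W s₁ s₃ :=
  ⟨fun x hx => (h'.nv x hx).trans (h.nv x hx), fun x hx => (h'.rv x hx).trans (h.rv x hx),
    fun x hx => (h'.na x hx).trans (h.na x hx), fun x hx => (h'.ra x hx).trans (h.ra x hx)⟩

theorem Agree.mono {W W' : Set (Loc U)} {s s' : Store U} (h : Agree W s s') (hW : W ⊆ W') :
    Agree W' s s' :=
  ⟨fun x hx => h.nv x fun hh => hx (hW hh), fun x hx => h.rv x fun hh => hx (hW hh),
    fun x hx => h.na x fun hh => hx (hW hh), fun x hx => h.ra x fun hh => hx (hW hh)⟩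

@[simp] theorem setN_nvar (s : Store U) (x v) : (s.setN x v).nvar x = v := by
  simp [Store.setN]
@[simp] theorem setN_nvar_ne (s : Store U) (x v y) (h : y ≠ x) :
    (s.setN x v).nvar y = s.nvar y := by
  simp [Store.setN, h]
@[simp] theorem setN_rvar (s : Store U) (x v) : (s.setN x v).rvar = s.rvar := rfl
@[simp] theorem setN_narr (s : Store U) (x v) : (s.setN x v).narr = s.narr := rfl
@[simp] theorem setN_rarr (s : Store U) (x v) : (s.setN x v).rarr = s.rarr := rfl
@[simp] theorem setR_rvar (s : Store U) (x v) : (s.setR x v).rvar x = v := by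
  simp [Store.setR]
@[simp] theorem setR_rvar_ne (s : Store U) (x v y) (h : y ≠ x) :
    (s.setR x v).rvar y = s.rvar y := by
  simp [Store.setR, h]
@[simp] theorem setR_nvar (s : Store U) (x v) : (s.setR x v).nvar = s.nvar := rfl
@[simp] theorem setR_narr (s : Store U) (x v) : (s.setR x v).narr = s.narr := rfl
@[simp] theorem setR_rarr (s : Store U) (x v) : (s.setR x v).rarr = s.rarr := rfl
@[simp] theorem putN_narr (s : Store U) (b i v) :
    (s.putN b i v).narr b = Function.update (s.narr b) i v := by
  funext j; simp [Store.putN, Function.update_apply]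
@[simp] theorem putN_narr_ne (s : Store U) (b i v c) (h : c ≠ b) :
    (s.putN b i v).narr c = s.narr c := by
  funext j; simp [Store.putN, h]
@[simp] theorem putN_rvar (s : Store U) (b i v) : (s.putN b i v).rvar = s.rvar := rfl
@[simp] theorem putN_nvar (s : Store U) (b i v) : (s.putN b i v).nvar = s.nvar := rfl
@[simp] theorem putN_rarr (s : Store U) (b i v) : (s.putN b i v).rarr = s.rarr := rfl
@[simp] theorem putR_rarr (s : Store U) (b i v) :
    (s.putR b i v).rarr b = Function.update (s.rarr b) i v := by
  funext j; simp [Store.putR, Function.update_apply]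
@[simp] theorem putR_rarr_ne (s : Store U) (b i v c) (h : c ≠ b) :
    (s.putR b i v).rarr c = s.rarr c := by
  funext j; simp [Store.putR, h]
@[simp] theorem putR_rvar (s : Store U) (b i v) : (s.putR b i v).rvar = s.rvar := rfl
@[simp] theorem putR_nvar (s : Store U) (b i v) : (s.putR b i v).nvar = s.nvar := rfl
@[simp] theorem putR_narr (s : Store U) (b i v) : (s.putR b i v).narr = s.narr := rfl

theorem agree_setN (s : Store U) (x v) : Agree {.nv x} s (s.setN x v) :=
  ⟨fun y hy => by simp at hy; simp [hy], fun _ _ => rfl, fun _ _ => rfl, fun _ _ => rfl⟩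
theorem agree_setR (s : Store U) (x v) : Agree {.rv x} s (s.setR x v) :=
  ⟨fun _ _ => rfl, fun y hy => by simp at hy; simp [hy], fun _ _ => rfl, fun _ _ => rfl⟩
theorem agree_putN (s : Store U) (b i v) : Agree {.na b} s (s.putN b i v) :=
  ⟨fun _ _ => rfl, fun _ _ => rfl, fun y hy => by simp at hy; simp [hy], fun _ _ => rfl⟩
theorem agree_putR (s : Store U) (b i v) : Agree {.ra b} s (s.putR b i v) :=
  ⟨fun _ _ => rfl, fun _ _ => rfl, fun _ _ => rfl, fun y hy => by simp at hy; simp [hy]⟩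

variable {f : List (Pt U × ℝ) → List (Pt U)} {T : ℕ → ℕ}

/-- This is the frame rule. Postconditions need to mention only what changes; everything else
follows by checking that a location is not written. The numeric kinds of locations turn that check
into arithmetic. -/
theorem Exec.agree {p : Prog U} {s s' : Store U} {t : ℕ} (h : Exec f T p s s' t) :
    Agree p.writes s s' := by
  induction h with
  | skip s => exact .refl _ _
  | setN x e s => exact agree_setN _ _ _
  | setR x e s => exact agree_setR _ _ _
  | putN b i e s => exact agree_putN _ _ _ _
  | putR b i e s => exact agree_putR _ _ _ _
  | seq _ _ h₁ h₂ => exact (h₁.mono (by simp)).trans (h₂.mono (by simp))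
  | condTrue _ _ h => exact h.mono (by simp)
  | condFalse _ _ h => exact h.mono (by simp)
  | loopDone _ => exact .refl _ _
  | loopStep _ _ _ h₁ h₂ => exact h₁.trans h₂
  | cluster s =>
    refine ⟨fun _ _ => rfl, fun _ _ => rfl, fun _ _ => rfl, fun b hb => ?_⟩
    funext i
    cases b <;> simp [Store.putSolution] at hb ⊢

/-- Started with memory `s`, the program halts within `t` steps with a memory satisfying `Q`. -/
def Runs (f : List (Pt U × ℝ) → List (Pt U)) (T : ℕ → ℕ) (p : Prog U) (s : Store U) (t : ℕ)
    (Q : Store U → Prop) : Prop :=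
  ∃ s' t', Exec f T p s s' t' ∧ t' ≤ t ∧ Q s'

theorem Runs.mono {p : Prog U} {s t t'} {Q Q' : Store U → Prop} (h : Runs f T p s t Q)
    (ht : t ≤ t') (hQ : ∀ s', Agree p.writes s s' → Q s' → Q' s') : Runs f T p s t' Q' := by
  obtain ⟨s', t₁, he, ht₁, hs⟩ := h
  exact ⟨s', t₁, he, ht₁.trans ht, hQ _ he.agree hs⟩

theorem Runs.seq {p p' : Prog U} {s t t'} {R Q : Store U → Prop} (h : Runs f T p s t R)
    (h' : ∀ s', Agree p.writes s s' → R s' → Runs f T p' s' t' Q) :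
    Runs f T (.seq p p') s (t + t') Q := by
  obtain ⟨s₁, t₁, he, ht, hR⟩ := h
  obtain ⟨s₂, t₂, he', ht', hQ⟩ := h' s₁ he.agree hR
  exact ⟨s₂, t₁ + t₂, .seq he he', by omega, hQ⟩

theorem Runs.cond {b : Test U} {p p' : Prog U} {s t} {Q : Store U → Prop}
    (h : b.holds s → Runs f T p s t Q) (h' : ¬ b.holds s → Runs f T p' s t Q) :
    Runs f T (.cond b p p') s (b.steps + t + 1) Q := by
  by_cases hb : b.holds s
  · obtain ⟨s', t', he, ht, hQ⟩ := h hb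
    exact ⟨s', _, .condTrue hb he, by omega, hQ⟩
  · obtain ⟨s', t', he, ht, hQ⟩ := h' hb
    exact ⟨s', _, .condFalse hb he, by omega, hQ⟩

/-- Programs without loops and calls. -/
@[simp] def Prog.Flat : Prog U → Prop
  | .skip => True
  | .setN _ _ => True
  | .setR _ _ => True
  | .putN _ _ _ => True
  | .putR _ _ _ => True
  | .seq p₁ p₂ => p₁.Flat ∧ p₂.Flat
  | .cond _ p₁ p₂ => p₁.Flat ∧ p₂.Flat
  | .loop _ _ => False
  | .cluster => False

open scoped Classical in
/-- The effect of a flat program. -/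
@[simp] noncomputable def Prog.run : Prog U → Store U → Store U
  | .skip, s => s
  | .setN x e, s => s.setN x (e.eval s)
  | .setR x e, s => s.setR x (e.eval s)
  | .putN b i e, s => s.putN b (i.eval s) (e.eval s)
  | .putR b i e, s => s.putR b (i.eval s) (e.eval s)
  | .seq p₁ p₂, s => p₂.run (p₁.run s)
  | .cond b p₁ p₂, s => if b.holds s then p₁.run s else p₂.run s
  | .loop _ _, s => s
  | .cluster, s => s

/-- A bound for the running time of a flat program. -/
def Prog.time : Prog U → ℕ
  | .skip => 1
  | .setN _ e => e.steps + 1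
  | .setR _ e => e.steps + 1
  | .putN _ i e => i.steps + e.steps + 1
  | .putR _ i e => i.steps + e.steps + 1
  | .seq p₁ p₂ => p₁.time + p₂.time
  | .cond b p₁ p₂ => b.steps + (p₁.time + p₂.time) + 1
  | .loop _ _ => 0
  | .cluster => 0

theorem Prog.Flat.exec {p : Prog U} (h : p.Flat) (s : Store U) :
    ∃ t ≤ p.time, Exec f T p s (p.run s) t := by
  induction p generalizing s with
  | skip => exact ⟨_, le_rfl, .skip s⟩
  | setN x e => exact ⟨_, le_rfl, .setN x e s⟩
  | setR x e => exact ⟨_, le_rfl, .setR x e s⟩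
  | putN b i e => exact ⟨_, le_rfl, .putN b i e s⟩
  | putR b i e => exact ⟨_, le_rfl, .putR b i e s⟩
  | seq p₁ p₂ h₁ h₂ =>
    obtain ⟨t₁, ht₁, e₁⟩ := h₁ h.1 s
    obtain ⟨t₂, ht₂, e₂⟩ := h₂ h.2 (p₁.run s)
    exact ⟨_, by simp only [Prog.time]; omega, .seq e₁ e₂⟩
  | cond b p₁ p₂ h₁ h₂ =>
    by_cases hb : b.holds s
    · obtain ⟨t₁, ht₁, e₁⟩ := h₁ h.1 s
      refine ⟨b.steps + t₁ + 1, by simp only [Prog.time]; omega, ?_⟩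
      simpa [hb] using Exec.condTrue (p₂ := p₂) hb e₁
    · obtain ⟨t₂, ht₂, e₂⟩ := h₂ h.2 s
      refine ⟨b.steps + t₂ + 1, by simp only [Prog.time]; omega, ?_⟩
      simpa [hb] using Exec.condFalse (p₁ := p₁) hb e₂
  | loop => exact h.elim
  | cluster => exact h.elim

theorem Prog.Flat.runs {p : Prog U} (h : p.Flat) {s : Store U} {Q : Store U → Prop}
    (hQ : Q (p.run s)) : Runs f T p s p.time Q := by
  obtain ⟨t, ht, he⟩ := h.exec (f := f) (T := T) s
  exact ⟨_, t, he, ht, hQ⟩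

theorem Prog.Flat.agree {p : Prog U} (h : p.Flat) (s : Store U) :
    Agree p.writes s (p.run s) := by
  obtain ⟨t, ht, he⟩ := h.exec (f := fun _ => []) (T := id) s
  exact he.agree

theorem Prog.Flat.runs_le {p : Prog U} (h : p.Flat) {s : Store U} {Q : Store U → Prop} {c : ℕ}
    (hc : p.time ≤ c) (hQ : Q (p.run s)) : Runs f T p s c Q :=
  (h.runs hQ).mono hc fun _ _ h => h

/-- The invariant carries a counter that every round lowers by one, so `n` bounds the rounds. The
summand outside the product pays for the last, failing test. -/
theorem runs_loop {b : Test U} {p : Prog U} {s : Store U} {c : ℕ} {Q : Store U → Prop}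
    (I : ℕ → Store U → Prop) (n : ℕ) (h₀ : I n s)
    (hstep : ∀ n s', Agree p.writes s s' → I n s' → b.holds s' →
      ∃ m, n = m + 1 ∧ Runs f T p s' c (I m))
    (hQ : ∀ n s', Agree p.writes s s' → I n s' → ¬ b.holds s' → Q s') :
    Runs f T (.loop b p) s (n * (c + b.steps + 1) + b.steps + 1) Q := by
  induction n generalizing s with
  | zero =>
    by_cases hb : b.holds s
    · obtain ⟨m, hm, _⟩ := hstep _ _ (.refl _ _) h₀ hb
      omega
    · exact ⟨s, _, .loopDone hb, by omega, hQ _ _ (.refl _ _) h₀ hb⟩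
  | succ n ih =>
    by_cases hb : b.holds s
    · obtain ⟨m, hm, s₁, t₁, he, ht, hs₁⟩ := hstep _ _ (.refl _ _) h₀ hb
      obtain rfl : n = m := by omega
      have hag := he.agree
      obtain ⟨s₂, t₂, he₂, ht₂, hs₂⟩ := ih hs₁ (fun n s' h => hstep n s' (hag.trans h))
        (fun n s' h => hQ n s' (hag.trans h))
      exact ⟨s₂, _, .loopStep hb he he₂, by rw [add_mul]; omega, hs₂⟩
    · exact ⟨s, _, .loopDone hb, by omega, hQ _ _ (.refl _ _) h₀ hb⟩

/-- `for x in 0, ..., y - 1 do p`. -/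
def forN (x y : NVar q) (p : Prog U) : Prog U :=
  .seq (.setN x (.const 0))
    (.loop (.neg (.nle (.var y) (.var x))) (.seq p (.setN x (.plus (.var x) (.const 1)))))

@[simp] theorem forN_writes (x y : NVar q) (p : Prog U) :
    (forN x y p).writes = insert (.nv x) p.writes := by
  ext l; simp [forN]

/-- The counter is incremented after the body, so the invariant must survive a change of `x`; this
is `hI`. The 9 steps per round are 4 for the test, 4 for the increment and 1 for the loop
instruction. -/
theorem runs_forN {x y : NVar q} {p : Prog U} {s : Store U} {c : ℕ} {Q : Store U → Prop}
    (I : ℕ → Store U → Prop) (n : ℕ) (hn : s.nvar y = n) (hxy : y ≠ x)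
    (hx : .nv x ∉ p.writes) (hy : .nv y ∉ p.writes) (h₀ : I 0 s)
    (hI : ∀ i s v, I i s → I i (s.setN x v))
    (hstep : ∀ i < n, ∀ s', Agree (insert (.nv x) p.writes) s s' → s'.nvar x = i → I i s' →
      Runs f T p s' c (I (i + 1)))
    (hQ : ∀ s', Agree (insert (.nv x) p.writes) s s' → I n s' → Q s') :
    Runs f T (forN x y p) s (n * (c + 9) + 7) Q := by
  have h1 : Runs f T (.setN x (.const 0)) s 2 fun s' => s' = s.setN x 0 :=
    ⟨_, _, .setN _ _ _, by simp [NExp.steps], by simp [NExp.eval]⟩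
  refine (h1.seq (t' := n * (c + 9) + 5) fun s' _ hs' => ?_).mono (by omega) fun _ _ h => h
  subst hs'
  have hw : (Prog.seq p (.setN x (.plus (.var x) (.const 1)))).writes = insert (.nv x) p.writes := by
    ext l; simp
  have hag : Agree (insert (.nv x) p.writes) s (s.setN x 0) := (agree_setN _ _ _).mono (by simp)
  have hyW : .nv y ∉ insert (.nv x) p.writes := by simp [hxy, hy]
  refine (runs_loop (c := c + 4) (fun m s' => s'.nvar x + m = n ∧ I (s'.nvar x) s') n
    ⟨by simp, by simpa using hI 0 s 0 h₀⟩ ?_ ?_).mono ?_ fun _ _ h => h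
  · rintro m s' ha ⟨hm, hi⟩ hb
    rw [hw] at ha
    replace ha := hag.trans ha
    have hyn : s'.nvar y = n := (ha.nv _ hyW).trans hn
    simp only [Test.holds, NExp.eval, hyn, not_le] at hb
    refine ⟨m - 1, by omega, ?_⟩
    refine (hstep _ hb s' ha rfl hi).seq fun s₁ ha₁ hs₁ => ?_
    have hx₁ : s₁.nvar x = s'.nvar x := ha₁.nv _ hx
    refine ⟨_, _, .setN _ _ _, by simp [NExp.steps], ?_, ?_⟩
    · simp [NExp.eval]; omega
    · simpa [NExp.eval, hx₁] using hI _ _ (s'.nvar x + 1) hs₁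
  · rintro m s' ha ⟨hm, hi⟩ hb
    rw [hw] at ha
    replace ha := hag.trans ha
    have hyn : s'.nvar y = n := (ha.nv _ hyW).trans hn
    simp only [Test.holds, NExp.eval, hyn, not_le, not_lt] at hb
    have : s'.nvar x = n := by omega
    exact hQ s' ha (this ▸ hi)
  · have h4 : (Test.neg (Test.nle (NExp.var y) (NExp.var x)) : Test U).steps = 4 := rfl
    rw [h4]

/-- One program for every entry of a list, one after the other. -/
def seqAll {β : Type*} (l : List β) (p : β → Prog U) : Prog U :=
  match l with
  | [] => .skip
  | b :: l => .seq (p b) (seqAll l p)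

theorem mem_seqAll_writes {β : Type*} {l : List β} {p : β → Prog U} {ℓ : Loc U} :
    ℓ ∈ (seqAll l p).writes ↔ ∃ b ∈ l, ℓ ∈ (p b).writes := by
  induction l with
  | nil => simp [seqAll]
  | cons b l ih => simp [seqAll, ih]

theorem runs_seqAll {β : Type*} {l : List β} {p : β → Prog U} {s : Store U} {c : ℕ}
    {Q : Store U → Prop} (I : List β → Store U → Prop) (h₀ : I [] s)
    (hstep : ∀ l₁ b l₂, l = l₁ ++ b :: l₂ → ∀ s', Agree (seqAll l p).writes s s' → I l₁ s' →
      Runs f T (p b) s' c (I (l₁ ++ [b])))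
    (hQ : ∀ s', Agree (seqAll l p).writes s s' → I l s' → Q s') :
    Runs f T (seqAll l p) s (l.length * c + 1) Q := by
  have key : ∀ l₂ l₁, l = l₁ ++ l₂ → ∀ s', Agree (seqAll l p).writes s s' → I l₁ s' →
      Runs f T (seqAll l₂ p) s' (l₂.length * c + 1) Q := by
    intro l₂
    induction l₂ with
    | nil =>
      intro l₁ hl s' ha hI
      simp at hl
      exact ⟨s', 1, .skip _, by simp, hQ s' ha (hl ▸ hI)⟩
    | cons b l₂ ih =>
      intro l₁ hl s' ha hI
      have hsub : (p b).writes ⊆ (seqAll l p).writes := fun ℓ hℓ =>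
        mem_seqAll_writes.2 ⟨b, by simp [hl], hℓ⟩
      refine ((hstep l₁ b l₂ hl s' ha hI).seq fun s₁ ha₁ hs₁ =>
        ih (l₁ ++ [b]) (by simp [hl]) s₁ (ha.trans (ha₁.mono hsub)) hs₁).mono ?_ fun _ _ h => h
      simp only [List.length_cons, add_mul]; omega
  exact key l [] rfl s (.refl _ _) h₀

/-- Sum of a list of expressions. -/
def NExp.sum : List (NExp q) → NExp q
  | [] => .const 0
  | e :: l => .plus e (NExp.sum l)

theorem NExp.eval_sum (s : Store U) (l : List (NExp q)) :
    (NExp.sum l).eval s = (l.map (NExp.eval s)).sum := by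
  induction l with
  | nil => simp [NExp.sum, NExp.eval]
  | cons e l ih => simp [NExp.sum, NExp.eval, ih]

/-- Sum of a list of expressions. -/
def RExp.sum : List (RExp U) → RExp U
  | [] => .const 0
  | e :: l => .plus e (RExp.sum l)

theorem RExp.eval_sum (s : Store U) (l : List (RExp U)) :
    (RExp.sum l).eval s = (l.map (RExp.eval s)).sum := by
  induction l with
  | nil => simp [RExp.sum, RExp.eval]
  | cons e l ih => simp [RExp.sum, RExp.eval, ih]

/-- Conjunction of a list of tests. -/
def Test.all : List (Test U) → Test U
  | [] => .nle (.const 0) (.const 0)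
  | b :: l => .conj b (Test.all l)

theorem Test.holds_all (s : Store U) (l : List (Test U)) :
    (Test.all l).holds s ↔ ∀ b ∈ l, b.holds s := by
  induction l with
  | nil => simp [Test.all, Test.holds]
  | cons b l ih => simp [Test.all, Test.holds, ih]

end Framework

/-! ### Merging -/

/-- Blocks of length `w` of the index array `P` are sorted by the keys `V`. -/
def BlockSorted (V : ℕ → ℝ) (P : ℕ → ℕ) (L w : ℕ) : Prop :=
  ∀ b x y, w ∣ b → b ≤ x → x ≤ y → y < b + w → y < L → V (P x) ≤ V (P y)

/-- State of merging the blocks of length `w` of `P` pairwise into `B`: `o` entries of `B` are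
written, the current pair of blocks begins at `lo`, and `i` and `j` are the next entries of its
blocks. -/
structure Merging (V : ℕ → ℝ) (P B : ℕ → ℕ) (L w lo i j o : ℕ) : Prop where
  dvd : 2 * w ∣ lo
  hi₁ : lo ≤ i
  hi₂ : i ≤ lo + w
  hj₁ : lo + w ≤ j
  hj₂ : j ≤ lo + 2 * w
  hij : i + j = o + lo + w
  hjL : j ≤ L ∨ j = lo + w
  cur : ∀ x y, lo ≤ x → x ≤ y → y < o → V (B x) ≤ V (B y)
  left : ∀ x y, lo ≤ x → x < o → i ≤ y → y < lo + w → y < L → V (B x) ≤ V (P y)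
  right : ∀ x y, lo ≤ x → x < o → j ≤ y → y < lo + 2 * w → y < L → V (B x) ≤ V (P y)
  done : ∀ b x y, 2 * w ∣ b → b < lo → b ≤ x → x ≤ y → y < b + 2 * w → V (B x) ≤ V (B y)
  surj : ∀ e < L, (e < i ∨ lo + w ≤ e ∧ e < j) → ∃ x < o, B x = P e
  range : ∀ x < o, ∃ e < L, B x = P e

namespace Merging
variable {V : ℕ → ℝ} {P B : ℕ → ℕ} {L w lo i j o : ℕ}

theorem zero (V : ℕ → ℝ) (P B : ℕ → ℕ) (L w : ℕ) : Merging V P B L w 0 0 w 0 where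
  dvd := dvd_zero _
  hi₁ := by omega
  hi₂ := by omega
  hj₁ := by omega
  hj₂ := by omega
  hij := by omega
  hjL := by omega
  cur := by omega
  left := by omega
  right := by omega
  done := by omega
  surj := by omega
  range := by omega

/-- Multiples of `2 * w` are `2 * w` apart, so aligned blocks that overlap coincide. -/
theorem block_eq {b lo w : ℕ} (hb : 2 * w ∣ b) (hlo : 2 * w ∣ lo) (h : lo < b + 2 * w)
    (hx : b < lo + 2 * w) : b = lo := by
  obtain ⟨c, rfl⟩ := hb
  obtain ⟨d, rfl⟩ := hlo
  have h1 : 2 * w * d < 2 * w * (c + 1) := by rw [mul_add]; omega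
  have h2 : 2 * w * c < 2 * w * (d + 1) := by rw [mul_add]; omega
  have h3 := lt_of_mul_lt_mul_left h1 (Nat.zero_le _)
  have h4 := lt_of_mul_lt_mul_left h2 (Nat.zero_le _)
  have : c = d := by omega
  rw [this]

theorem restart (h : Merging V P B L w lo i j o) (ho : o = lo + 2 * w) :
    Merging V P B L w o o (o + w) o := by
  have := h.hij; have := h.hi₂; have := h.hj₂
  have hd : 2 * w ∣ o := ho ▸ (Nat.dvd_add h.dvd dvd_rfl)
  refine ⟨hd, by omega, by omega, by omega, by omega, by omega, by omega, by omega, by omega,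
    by omega, ?_, ?_, h.range⟩
  · intro b x y hb hbo hbx hxy hy
    by_cases hlt : b < lo
    · exact h.done b x y hb hlt hbx hxy hy
    · have : b = lo := block_eq hb h.dvd (by omega) (by omega)
      exact h.cur x y (by omega) hxy (by omega)
  · intro e he h'
    exact h.surj e he (by omega)

/-- Everything written for this pair is at most everything unread in both blocks, and each block is
sorted. Appending the smaller of the two heads keeps both facts. Since `i ≤ o`, the left head is
inside the array. -/
theorem stepLeft (h : Merging V P B L w lo i j o) (hP : BlockSorted V P L w) (hoL : o < L)
    (hi : i < lo + w) (hc : j < lo + 2 * w → j < L → V (P i) ≤ V (P j)) :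
    Merging V P (Function.update B o (P i)) L w lo (i + 1) j (o + 1) := by
  have h1 := h.hij; have h2 := h.hi₁; have h3 := h.hj₁; have h4 := h.hjL; have h5 := h.hj₂
  have hiL : i < L := by omega
  have hwlo : w ∣ lo := (Dvd.intro_left 2 rfl).trans h.dvd
  have hlt : ∀ x, x < o → Function.update B o (P i) x = B x := fun x hx =>
    Function.update_of_ne (by omega) _ _
  have hoo : Function.update B o (P i) o = P i := Function.update_self _ _ _
  refine ⟨h.dvd, by omega, by omega, by omega, by omega, by omega, by omega, ?_, ?_, ?_, ?_, ?_, ?_⟩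
  · intro x y hx hxy hy
    rcases Nat.lt_succ_iff_lt_or_eq.1 hy with hy | rfl
    · rw [hlt x (by omega), hlt y hy]; exact h.cur x y hx hxy hy
    · rcases hxy.lt_or_eq with hxy | rfl
      · rw [hoo, hlt x hxy]; exact h.left x i hx hxy le_rfl hi hiL
      · exact le_rfl
  · intro x y hx hxo hy hyw hyL
    rcases Nat.lt_succ_iff_lt_or_eq.1 hxo with hxo | rfl
    · rw [hlt x hxo]; exact h.left x y hx hxo (by omega) hyw hyL
    · rw [hoo]; exact hP lo i y hwlo h2 (by omega) hyw hyL
  · intro x y hx hxo hy hyw hyL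
    rcases Nat.lt_succ_iff_lt_or_eq.1 hxo with hxo | rfl
    · rw [hlt x hxo]; exact h.right x y hx hxo hy hyw hyL
    · rw [hoo]
      exact (hc (by omega) (by omega)).trans
        (hP (lo + w) j y (Nat.dvd_add hwlo dvd_rfl) h3 hy (by omega) hyL)
  · intro b x y hb hblo hbx hxy hy
    have : b + 2 * w ≤ lo := by
      by_contra hcon
      have := block_eq hb h.dvd (by omega) (by omega)
      omega
    rw [hlt x (by omega), hlt y (by omega)]
    exact h.done b x y hb hblo hbx hxy hy
  · intro e he h'
    by_cases hei : e = i
    · exact ⟨o, by omega, by rw [hoo, hei]⟩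
    · obtain ⟨x, hx, hxe⟩ := h.surj e he (by omega)
      exact ⟨x, by omega, by rw [hlt x hx, hxe]⟩
  · intro x hx
    rcases Nat.lt_succ_iff_lt_or_eq.1 hx with hx | rfl
    · rw [hlt x hx]; exact h.range x hx
    · exact ⟨i, hiL, hoo⟩

theorem stepRight (h : Merging V P B L w lo i j o) (hP : BlockSorted V P L w) (hoL : o < L)
    (ho : o < lo + 2 * w)
    (hc : i < lo + w → j < lo + 2 * w ∧ j < L ∧ V (P j) ≤ V (P i)) :
    Merging V P (Function.update B o (P j)) L w lo i (j + 1) (o + 1) := by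
  have h1 := h.hij; have h2 := h.hi₁; have h3 := h.hj₁; have h4 := h.hjL; have h5 := h.hj₂
  have h6 := h.hi₂
  have hj : j < lo + 2 * w := by omega
  have hjL : j < L := by omega
  have hwlo : w ∣ lo := (Dvd.intro_left 2 rfl).trans h.dvd
  have hlt : ∀ x, x < o → Function.update B o (P j) x = B x := fun x hx =>
    Function.update_of_ne (by omega) _ _
  have hoo : Function.update B o (P j) o = P j := Function.update_self _ _ _
  refine ⟨h.dvd, by omega, by omega, by omega, by omega, by omega, by omega, ?_, ?_, ?_, ?_, ?_, ?_⟩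
  · intro x y hx hxy hy
    rcases Nat.lt_succ_iff_lt_or_eq.1 hy with hy | rfl
    · rw [hlt x (by omega), hlt y hy]; exact h.cur x y hx hxy hy
    · rcases hxy.lt_or_eq with hxy | rfl
      · rw [hoo, hlt x hxy]; exact h.right x j hx hxy le_rfl hj hjL
      · exact le_rfl
  · intro x y hx hxo hy hyw hyL
    rcases Nat.lt_succ_iff_lt_or_eq.1 hxo with hxo | rfl
    · rw [hlt x hxo]; exact h.left x y hx hxo hy hyw hyL
    · rw [hoo]
      exact (hc (by omega)).2.2.trans (hP lo i y hwlo h2 hy hyw hyL)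
  · intro x y hx hxo hy hyw hyL
    rcases Nat.lt_succ_iff_lt_or_eq.1 hxo with hxo | rfl
    · rw [hlt x hxo]; exact h.right x y hx hxo (by omega) hyw hyL
    · rw [hoo]
      exact hP (lo + w) j y (Nat.dvd_add hwlo dvd_rfl) h3 (by omega) (by omega) hyL
  · intro b x y hb hblo hbx hxy hy
    have : b + 2 * w ≤ lo := by
      by_contra hcon
      have := block_eq hb h.dvd (by omega) (by omega)
      omega
    rw [hlt x (by omega), hlt y (by omega)]
    exact h.done b x y hb hblo hbx hxy hy
  · intro e he h'
    by_cases hei : e = j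
    · exact ⟨o, by omega, by rw [hoo, hei]⟩
    · obtain ⟨x, hx, hxe⟩ := h.surj e he (by omega)
      exact ⟨x, by omega, by rw [hlt x hx, hxe]⟩
  · intro x hx
    rcases Nat.lt_succ_iff_lt_or_eq.1 hx with hx | rfl
    · rw [hlt x hx]; exact h.range x hx
    · exact ⟨j, hjL, hoo⟩

/-- Once `L` entries are written, the identity for `i + j` leaves nothing unread, also when the last
pair of blocks is cut off by the end of the array. -/
theorem finish (h : Merging V P B L w lo i j L) (ho : L ≤ lo + 2 * w) (hw : 0 < w) :
    BlockSorted V B L (2 * w) ∧ (∀ e < L, ∃ x < L, B x = P e) := by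
  have h1 := h.hij; have h2 := h.hi₁; have h3 := h.hj₁; have h4 := h.hjL; have h5 := h.hj₂
  have h6 := h.hi₂
  refine ⟨fun b x y hb hbx hxy hy hyL => ?_, fun e he => h.surj e he (by omega)⟩
  by_cases hlt : b < lo
  · exact h.done b x y hb hlt hbx hxy hy
  · have : b = lo := block_eq hb h.dvd (by omega) (by omega)
    exact h.cur x y (by omega) hxy hyL

end Merging

/-! ### Merge sort of an index array on the machine -/

section Sorting
variable {q : JoinQuery} {U : Finset (Fin q.d)}
variable {f : List (Pt U × ℝ) → List (Pt U)} {T : ℕ → ℕ}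

abbrev vL : NVar q := .tmp (nm 13 0 0)
abbrev vO : NVar q := .tmp (nm 14 0 0)
abbrev aP : ℕ := nm 15 0 0
abbrev aB : ℕ := nm 16 0 0
abbrev vW : NVar q := .tmp (nm 17 0 0)
abbrev vHi : NVar q := .tmp (nm 17 1 0)
abbrev vI : NVar q := .tmp (nm 17 2 0)
abbrev vJ : NVar q := .tmp (nm 17 3 0)
abbrev vMid : NVar q := .tmp (nm 17 4 0)

/-- At the end of a pair of blocks: pass on to the next one. -/
def nextBlocks : Prog U :=
  .cond (.nle (.var vHi) (.var vO))
    (.seq (.setN vI (.var vO)) <| .seq (.setN vMid (.plus (.var vO) (.var vW))) <|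
      .seq (.setN vJ (.var vMid)) (.setN vHi (.plus (.var vMid) (.var vW)))) .skip

/-- Move the smaller one of the next entries. -/
def moveSmaller (V : RArr U) : Prog U :=
  .cond (.conj (.neg (.nle (.var vMid) (.var vI)))
      (.neg (.conj (.neg (.nle (.var vHi) (.var vJ))) (.conj (.neg (.nle (.var vL) (.var vJ)))
        (.neg (.rle (.arr V (.arr aP (.var vI))) (.arr V (.arr aP (.var vJ)))))))))
    (.seq (.putN aB (.var vO) (.arr aP (.var vI))) (.setN vI (.plus (.var vI) (.const 1))))
    (.seq (.putN aB (.var vO) (.arr aP (.var vJ))) (.setN vJ (.plus (.var vJ) (.const 1))))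

def mergeStep (V : RArr U) : Prog U := .seq nextBlocks (moveSmaller V)

/-- Double the length of the sorted blocks. -/
def mergePass (V : RArr U) : Prog U :=
  .seq (.setN vHi (.const 0)) <| .seq (forN vO vL (mergeStep V)) <|
    .seq (forN vO vL (.putN aP (.var vO) (.arr aB (.var vO))))
      (.setN vW (.plus (.var vW) (.var vW)))

def mergeSort (V : RArr U) : Prog U :=
  .seq (forN vO vL (.putN aP (.var vO) (.var vO))) <| .seq (.setN vW (.const 1))
    (.loop (.neg (.nle (.var vL) (.var vW))) (mergePass V))

structure MergeState (V : ℕ → ℝ) (P : ℕ → ℕ) (L w o : ℕ) (s : Store U) : Prop where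
  intro ::
  state : (o = 0 ∧ s.nvar vHi = 0) ∨ ∃ lo, Merging V P (s.narr aB) L w lo (s.nvar vI) (s.nvar vJ) o ∧
    s.nvar vMid = lo + w ∧ s.nvar vHi = lo + 2 * w ∧ o ≤ lo + 2 * w

theorem mergeStep_run (V : RArr U) (s : Store U) {L w o : ℕ} (hL : s.nvar vL = L)
    (hw : s.nvar vW = w) (hw0 : 0 < w) (ho : s.nvar vO = o) (hoL : o < L)
    (hP : BlockSorted (s.rarr V) (s.narr aP) L w)
    (h : MergeState (s.rarr V) (s.narr aP) L w o s) :
    MergeState (s.rarr V) (s.narr aP) L w (o + 1) ((mergeStep V).run s) := by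
  obtain ⟨s₁, hs₁⟩ : ∃ s₁, s₁ = nextBlocks.run s := ⟨_, rfl⟩
  have key : ∃ lo, Merging (s.rarr V) (s.narr aP) (s₁.narr aB) L w lo (s₁.nvar vI) (s₁.nvar vJ) o ∧
      s₁.nvar vMid = lo + w ∧ s₁.nvar vHi = lo + 2 * w ∧ o < lo + 2 * w := by
    have hres : ∀ B, Merging (s.rarr V) (s.narr aP) B L w o o (o + w) o → s.narr aB = B →
        s.nvar vHi ≤ o →
        ∃ lo, Merging (s.rarr V) (s.narr aP) (s₁.narr aB) L w lo (s₁.nvar vI) (s₁.nvar vJ) o ∧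
      s₁.nvar vMid = lo + w ∧ s₁.nvar vHi = lo + 2 * w ∧ o < lo + 2 * w := by
      intro B hB hsB hhi
      refine ⟨o, ?_⟩
      subst hs₁
      simp [nextBlocks, Test.holds, NExp.eval, ho, hhi, hw, hsB, hB]
      omega
    -- At the start `vHi = 0` poses as the end of an empty pair of blocks, so the first pair is
    -- opened by the same code as the later ones.
    rcases h.state with ⟨rfl, hhi⟩ | ⟨lo, hm, hmid, hhi, hle⟩
    · exact hres _ (by simpa using Merging.zero _ _ _ _ _) rfl (by omega)
    · rcases hle.lt_or_eq with hlt | heq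
      · refine ⟨lo, ?_⟩
        have e : nextBlocks.run s = s := by
          simp only [nextBlocks, Prog.run, Test.holds, NExp.eval, ho]
          exact if_neg (by omega)
        rw [hs₁, e]
        exact ⟨hm, hmid, hhi, hlt⟩
      · exact hres _ (hm.restart heq) rfl (by omega)
  have hfr : Agree nextBlocks.writes s s₁ := by
    rw [hs₁]; exact Prog.Flat.agree (by simp [nextBlocks]) s
  have e1 : s₁.rarr V = s.rarr V := hfr.ra _ (by simp [nextBlocks])
  have e2 : s₁.narr aP = s.narr aP := hfr.na _ (by simp [nextBlocks])
  have e3 : s₁.nvar vL = L := (hfr.nv _ (by simp [nextBlocks])).trans hL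
  have e4 : s₁.nvar vO = o := (hfr.nv _ (by simp [nextBlocks])).trans ho
  obtain ⟨lo, hm, hmid, hhi, hlt⟩ := key
  have : (mergeStep V).run s = (moveSmaller V).run s₁ := by rw [hs₁]; rfl
  rw [this]
  constructor
  right
  refine ⟨lo, ?_⟩
  unfold moveSmaller
  simp only [Prog.run]
  split_ifs with hc
  · simp [Test.holds, NExp.eval, RExp.eval, hmid, hhi, e1, e2, e3] at hc
    simp [NExp.eval, hmid, hhi, e2, e4]
    exact ⟨hm.stepLeft hP hoL hc.1 hc.2, hlt⟩
  · simp [Test.holds, NExp.eval, RExp.eval, hmid, hhi, e1, e2, e3] at hc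
    simp [NExp.eval, hmid, hhi, e2, e4]
    refine ⟨hm.stepRight hP hoL hlt fun hi => ?_, hlt⟩
    obtain ⟨h1, h2, h3⟩ := hc hi
    exact ⟨h1, h2, h3.le⟩

theorem mergeStep_time (V : RArr U) : (mergeStep V).time = 58 := by
  simp [mergeStep, nextBlocks, moveSmaller, Prog.time, NExp.steps, RExp.steps, Test.steps]

theorem mergePass_runs (V : RArr U) (s : Store U)
    {w : ℕ} (hw : s.nvar vW = w) (hw0 : 0 < w)
    (hP : BlockSorted (s.rarr V) (s.narr aP) (s.nvar vL) w) :
    Runs f T (mergePass V) s (((mergeStep V).time + 40) * (s.nvar vL + 1)) fun s' =>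
      s'.nvar vW = 2 * w ∧ BlockSorted (s.rarr V) (s'.narr aP) (s.nvar vL) (2 * w) ∧
      ∀ e < s.nvar vL, ∃ x < s.nvar vL, s'.narr aP x = s.narr aP e := by
  have hb1 : Loc.nv vO ∉ (mergeStep V).writes := by simp [mergeStep, nextBlocks, moveSmaller]
  have hb2 : Loc.nv vL ∉ (mergeStep V).writes := by simp [mergeStep, nextBlocks, moveSmaller]
  have hb3 : Loc.na aP ∉ insert (Loc.nv vO) (mergeStep V).writes := by
    simp [mergeStep, nextBlocks, moveSmaller]
  have hb4 : Loc.ra V ∉ insert (Loc.nv vO) (mergeStep V).writes := by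
    simp [mergeStep, nextBlocks, moveSmaller]
  have hb5 : Loc.nv vW ∉ insert (Loc.nv vO) (mergeStep V).writes := by
    simp [mergeStep, nextBlocks, moveSmaller]
  have hb6 : Loc.nv vL ∉ insert (Loc.nv vO) (mergeStep V).writes := by
    simp [hb2]
  refine Runs.mono (t := 2 + ((s.nvar vL * ((mergeStep V).time + 9) + 7) +
      ((s.nvar vL * (4 + 9) + 7) + 4))) ?_ (by nlinarith) fun _ _ h => h
  refine Runs.seq (R := fun s' => s' = s.setN vHi 0) ⟨_, _, .setN _ _ _, by simp [NExp.steps], by simp [NExp.eval]⟩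
    fun s₁ _ hs₁ => ?_
  subst hs₁
  refine Runs.seq (R := fun s' => MergeState (s.rarr V) (s.narr aP) (s.nvar vL) w (s.nvar vL) s' ∧
      s'.nvar vL = s.nvar vL ∧ s'.nvar vW = w) ?_ fun s₂ ha₂ hs₂ => ?_
  · refine runs_forN (fun o s' => MergeState (s.rarr V) (s.narr aP) (s.nvar vL) w o s') _
      (by simp) (by simp) hb1 hb2 ⟨.inl (by simp)⟩ ?_ ?_ ?_
    · intro o s' v h
      exact ⟨by simpa using h.state⟩
    · intro o ho s' ha hs'o hI
      have e1 : s'.rarr V = s.rarr V := ha.ra _ hb4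
      have e2 : s'.narr aP = s.narr aP := ha.na _ hb3
      have e3 : s'.nvar vL = s.nvar vL := by simpa using ha.nv _ hb6
      have e4 : s'.nvar vW = w := by simpa [hw] using ha.nv _ hb5
      refine Prog.Flat.runs (by simp [mergeStep, nextBlocks, moveSmaller]) ?_
      rw [← e1, ← e2] at hI hP ⊢
      exact mergeStep_run V s' e3 e4 hw0 hs'o ho hP hI
    · intro s' ha hI
      refine ⟨hI, by simpa using ha.nv _ hb6, by simpa [hw] using ha.nv _ hb5⟩
  obtain ⟨hM, hL₂, hW₂⟩ := hs₂
  refine Runs.seq (R := fun s' => (∀ x < s.nvar vL, s'.narr aP x = s₂.narr aB x) ∧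
      s'.nvar vW = w) ?_ fun s₃ ha₃ hs₃ => ?_
  · refine runs_forN (c := 4) (fun o s' => ∀ x < o, s'.narr aP x = s₂.narr aB x) _ hL₂ (by simp) (by simp)
      (by simp) (by simp) (fun _ _ _ h => h) ?_ ?_
    · intro o ho s' ha hs'o hI
      refine Prog.Flat.runs (p := .putN aP (.var vO) (.arr aB (.var vO))) trivial ?_
      have e1 : s'.narr aB = s₂.narr aB := ha.na _ (by simp)
      intro x hx
      simp only [Prog.run, NExp.eval, hs'o, e1, putN_narr, Function.update_apply]
      split_ifs with h
      · rw [h]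
      · exact hI x (by omega)
    · intro s' ha hI
      exact ⟨hI, (ha.nv _ (by simp)).trans hW₂⟩
  obtain ⟨hcopy, hW₃⟩ := hs₃
  refine ⟨_, _, .setN _ _ _, by simp [NExp.steps], ?_⟩
  have hfin : BlockSorted (s.rarr V) (s₂.narr aB) (s.nvar vL) (2 * w) ∧
      (∀ e < s.nvar vL, ∃ x < s.nvar vL, s₂.narr aB x = s.narr aP e) := by
    rcases hM.state with ⟨h0, _⟩ | ⟨lo, hm, _, _, hle⟩
    · rw [h0]
      exact ⟨fun _ _ _ _ _ _ _ h => by omega, by omega⟩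
    · exact hm.finish hle hw0
  refine ⟨by simp [NExp.eval, hW₃]; omega, ?_, ?_⟩
  · intro b x y hb hbx hxy hy hyL
    simp only [setN_narr]
    rw [hcopy x (by omega), hcopy y hyL]
    exact hfin.1 b x y hb hbx hxy hy hyL
  · intro e he
    obtain ⟨x, hx, hxe⟩ := hfin.2 e he
    exact ⟨x, hx, by simp only [setN_narr]; rw [hcopy x hx, hxe]⟩

theorem mergePass_kind (V : RArr U) : ∀ l ∈ (mergePass V).writes, l.kind ∈ Set.Icc 13 17 := by
  simp [mergePass, mergeStep, nextBlocks, moveSmaller]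

theorem mergeSort_kind (V : RArr U) : ∀ l ∈ (mergeSort V).writes, l.kind ∈ Set.Icc 13 17 := by
  simp [mergeSort, mergePass, mergeStep, nextBlocks, moveSmaller]

/-- Block lengths double, so `h` passes sort an array of length at most `2 ^ h`. The conclusion only
records that every index occurs; that is all that is needed later. -/
theorem mergeSort_runs (V : RArr U) (hV : (Loc.ra V : Loc U).kind ∉ Set.Icc 13 17) (s : Store U)
    {h : ℕ} (hh : s.nvar vL ≤ 2 ^ h) :
    Runs f T (mergeSort V) s ((h + 1) * (((mergeStep V).time + 70) * (s.nvar vL + 1))) fun s' =>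
      (∀ x y, x ≤ y → y < s.nvar vL → s.rarr V (s'.narr aP x) ≤ s.rarr V (s'.narr aP y)) ∧
      ∀ e < s.nvar vL, ∃ x < s.nvar vL, s'.narr aP x = e := by
  set L := s.nvar vL with hL
  set c := ((mergeStep V).time + 40) * (L + 1) with hc
  refine Runs.mono (t := (L * (3 + 9) + 7) + (2 + (h * (c + 4 + 1) + 4 + 1))) ?_ ?_
    fun _ _ h => h
  rotate_left
  · nlinarith [Nat.zero_le (h * L), Nat.zero_le ((mergeStep V).time * L)]
  refine Runs.seq (R := fun s' => (∀ x < L, s'.narr aP x = x) ∧ s'.nvar vL = L ∧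
      s'.rarr V = s.rarr V) ?_ fun s₁ _ ⟨h1, h2, h3⟩ => ?_
  · refine runs_forN (fun o s' => ∀ x < o, s'.narr aP x = x) _ hL.symm (by simp) (by simp)
      (by simp) (by simp) (fun _ _ _ h => h) ?_ ?_
    · intro o ho s' ha hs'o hI
      refine Prog.Flat.runs (p := .putN aP (.var vO) (.var vO)) trivial ?_
      intro x hx
      simp only [Prog.run, NExp.eval, hs'o, putN_narr, Function.update_apply]
      split_ifs with h
      · rw [h]
      · exact hI x (by omega)
    · intro s' ha hI
      exact ⟨hI, ha.nv _ (by simp), ha.ra _ (by simp)⟩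
  refine Runs.seq (R := fun s' => s' = s₁.setN vW 1) ⟨_, _, .setN _ _ _, by simp [NExp.steps], by simp [NExp.eval]⟩
    fun s₂ _ hs₂ => ?_
  subst hs₂
  -- The loop counter `n` is the number of passes still allowed: `L ≤ w * 2 ^ n`.
  refine runs_loop (b := .neg (.nle (.var vL) (.var vW))) (c := c) (fun n s' => s'.nvar vL = L ∧ s'.rarr V = s.rarr V ∧ ∃ w, s'.nvar vW = w ∧ 0 < w ∧
    L ≤ w * 2 ^ n ∧ BlockSorted (s.rarr V) (s'.narr aP) L w ∧
      ∀ e < L, ∃ x < L, s'.narr aP x = e) h ?_ ?_ ?_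
  · refine ⟨by simpa using h2, by simpa using h3, 1, by simp, by simp, by simpa using hh, ?_, ?_⟩
    · intro b x y _ hbx hxy hy hyL
      obtain rfl : x = y := by omega
      exact le_rfl
    · intro e he
      exact ⟨e, he, h1 e he⟩
  · rintro n s' - ⟨e1, e2, w, hw, hw0, hn, hbs, hsurj⟩ hb
    simp only [Test.holds, NExp.eval, e1, hw, not_le] at hb
    cases n with
    | zero => omega
    | succ n =>
      refine ⟨n, rfl, ?_⟩
      rw [← e1, ← e2] at hbs
      refine (mergePass_runs V s' hw hw0 hbs).mono (by rw [e1]) fun s'' ha ⟨a1, a2, a3⟩ => ?_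
      have e1' : s''.nvar vL = s'.nvar vL := ha.nv _ (by
        simp [mergePass, mergeStep, nextBlocks, moveSmaller])
      have e2' : s''.rarr V = s'.rarr V := ha.ra _ fun h => hV (mergePass_kind V _ h)
      refine ⟨e1'.trans e1, e2'.trans e2, _, a1, by omega, ?_, ?_, ?_⟩
      · rw [pow_succ] at hn; nlinarith
      · rw [← e1, ← e2]; exact a2
      · intro e he
        obtain ⟨x, hx, hxe⟩ := hsurj e he
        obtain ⟨y, hy, hyx⟩ := a3 x (by rwa [e1])
        exact ⟨y, by rwa [e1] at hy, hyx.trans hxe⟩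
  · rintro n s' - ⟨e1, e2, w, hw, hw0, hn, hbs, hsurj⟩ hb
    simp only [Test.holds, NExp.eval, e1, hw, not_le, not_lt] at hb
    exact ⟨fun x y hxy hy => hbs 0 x y (dvd_zero _) (Nat.zero_le _) hxy (by omega) hy, hsurj⟩

end Sorting

/-! ### Natural-number keys for the values of attributes -/

section Keys
variable {q : JoinQuery} {U : Finset (Fin q.d)}
variable {f : List (Pt U × ℝ) → List (Pt U)} {T : ℕ → ℕ}

/-- The value of attribute `a` in the `i`-th row of the `j`-th table. -/
def Instance.val (D : Instance q) (j : Fin q.m) (i : ℕ) (a : Fin q.d) : ℝ :=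
  if h : i < (D.rows j).length then if ha : a ∈ q.attr j then (D.rows j)[i] ⟨a, ha⟩ else 0 else 0

structure HasTables (D : Instance q) (s : Store U) : Prop where
  size : ∀ j, s.nvar (.size j) = (D.rows j).length
  table : ∀ j a (h : a ∈ q.attr j), ∀ i < (D.rows j).length,
    s.rarr (.table j ⟨a, h⟩) i = D.val j i a

theorem HasTables.agree {D : Instance q} {s s' : Store U} {W : Set (Loc U)} (h : HasTables D s)
    (ha : Agree W s s') (hW : ∀ l ∈ W, l.kind ≠ 0) : HasTables D s' where
  size j := (ha.nv _ fun hh => hW _ hh rfl).trans (h.size j)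
  table j a hj i hi := by
    rw [ha.ra _ fun hh => hW _ hh rfl]; exact h.table j a hj i hi

abbrev aV (U : Finset (Fin q.d)) (a : Fin q.d) : RArr U := .tmp (nm 10 a 0)
abbrev aPos (j : Fin q.m) (a : Fin q.d) : ℕ := nm 11 j a
abbrev aId (a : Fin q.d) : ℕ := nm 12 a 0
abbrev vCur : NVar q := .tmp (nm 18 0 0)
abbrev vBase : NVar q := .tmp (nm 19 0 0)

/-- Append the column `a` of the table `j` to the list of the values of `a`. -/
def gatherTable (U : Finset (Fin q.d)) (a : Fin q.d) (j : Fin q.m) : Prog U :=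
  if h : a ∈ q.attr j then
    forN vO (.size j) (.seq (.putR (aV U a) (.var vL) (.arr (.table j ⟨a, h⟩) (.var vO)))
      (.seq (.putN (aPos j a) (.var vO) (.var vL)) (.setN vL (.plus (.var vL) (.const 1)))))
  else .skip

def gather (U : Finset (Fin q.d)) (a : Fin q.d) : Prog U :=
  .seq (.setN vL (.const 0)) (seqAll (List.finRange q.m) (gatherTable U a))

theorem gatherTable_writes (a : Fin q.d) (j : Fin q.m) : (gatherTable U a j).writes ⊆
    {.nv vO, .nv vL, .ra (aV U a), .na (aPos j a)} := by
  unfold gatherTable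
  split_ifs
  · intro l; simp; tauto
  · simp

theorem gather_runs (D : Instance q) (a : Fin q.d) {N : ℕ} (hN : ∀ j, (D.rows j).length ≤ N)
    (s : Store U) (hs : HasTables D s) :
    Runs f T (gather U a) s (q.m * (20 * N + 10) + 3) fun s' => s'.nvar vL ≤ q.m * N ∧
      ∀ j, a ∈ q.attr j → ∀ i < (D.rows j).length, s'.narr (aPos j a) i < s'.nvar vL ∧
        s'.rarr (aV U a) (s'.narr (aPos j a) i) = D.val j i a := by
  refine Runs.mono (t := 2 + ((List.finRange q.m).length * (20 * N + 10) + 1)) ?_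
    (by simp; omega) fun _ _ h => h
  refine Runs.seq (R := fun s' => s' = s.setN vL 0)
    ⟨_, _, .setN _ _ _, by simp [NExp.steps], by simp [NExp.eval]⟩ fun s₁ _ hs₁ => ?_
  have hT₁ : HasTables D s₁ := by
    rw [hs₁]; exact hs.agree (agree_setN _ _ _) (by simp)
  refine runs_seqAll (fun l s' => s'.nvar vL ≤ l.length * N ∧
    ∀ j ∈ l, a ∈ q.attr j → ∀ i < (D.rows j).length, s'.narr (aPos j a) i < s'.nvar vL ∧
        s'.rarr (aV U a) (s'.narr (aPos j a) i) = D.val j i a) (by simp [hs₁]) ?_ ?_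
  · rintro l₁ j l₂ hl s₂ ha₂ ⟨hL, hI⟩
    have hj : j ∉ l₁ := by
      have := List.nodup_finRange q.m
      rw [hl, List.nodup_append] at this
      intro h
      exact this.2.2 j h j (by simp) rfl
    have hT₂ : HasTables D s₂ := by
      refine hT₁.agree ha₂ fun l hl => ?_
      obtain ⟨j', -, hj'⟩ := mem_seqAll_writes.1 hl
      have := gatherTable_writes _ _ hj'
      simp at this
      rcases this with rfl | rfl | rfl | rfl <;> simp
    unfold gatherTable
    split_ifs with haj
    · refine Runs.mono (t := (D.rows j).length * (11 + 9) + 7) ?_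
        (by nlinarith [hN j]) fun _ _ h => h
      refine runs_forN (fun i s' => s'.nvar vL = s₂.nvar vL + i ∧
        (∀ e < s₂.nvar vL, s'.rarr (aV U a) e = s₂.rarr (aV U a) e) ∧
        ∀ i' < i, s'.narr (aPos j a) i' < s'.nvar vL ∧
          s'.rarr (aV U a) (s'.narr (aPos j a) i') = D.val j i' a) _ (hT₂.size j) (by simp)
        (by simp) (by simp) (by simp) ?_ ?_ ?_
      · intro i s' v h
        simpa using h
      · rintro i hi s' ha hsi ⟨h1, h2, h3⟩
        refine Prog.Flat.runs (p := .seq (.putR (aV U a) (.var vL) (.arr (.table j ⟨a, haj⟩) (.var vO)))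
          (.seq (.putN (aPos j a) (.var vO) (.var vL)) (.setN vL (.plus (.var vL) (.const 1)))))
          (by simp) ?_
        have e1 : s'.rarr (.table j ⟨a, haj⟩) i = D.val j i a := by
          rw [ha.ra _ (by simp)]
          exact hT₂.table j a haj i hi
        simp [NExp.eval, RExp.eval, hsi, h1, e1, Function.update_apply]
        refine ⟨by omega, fun e he => ?_, fun i' hi' => ?_⟩
        · rw [if_neg (by omega), h2 e he]
        · by_cases hii : i' = i
          · simp [hii]
          · have := h3 i' (by omega)
            simp only [if_neg hii, this.2]
            have h4 := this.1
            rw [if_neg (by omega)]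
            exact ⟨by omega, rfl⟩
      · rintro s' ha ⟨h1, h2, h3⟩
        refine ⟨?_, ?_⟩
        · rw [h1, List.length_append, add_mul]
          have := hN j
          simp; omega
        · intro j' hj' haj' i hi
          rcases List.mem_append.1 hj' with hj' | hj'
          · have hne : aPos j' a ≠ aPos j a := by
              simp only [ne_eq, nm_inj, not_and, true_and]
              intro h; exact absurd (Fin.ext h ▸ hj') hj
            have e : s'.narr (aPos j' a) = s₂.narr (aPos j' a) := ha.na _ (by simpa using hne)
            obtain ⟨h4, h5⟩ := hI j' hj' haj' i hi
            rw [e, h1, h2 _ h4]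
            exact ⟨by omega, h5⟩
          · obtain rfl : j' = j := by simpa using hj'
            exact h3 i hi
    · refine ⟨s₂, 1, .skip _, by omega, by simp [add_mul]; omega, ?_⟩
      intro j' hj' haj' i hi
      rcases List.mem_append.1 hj' with hj' | hj'
      · exact hI j' hj' haj' i hi
      · obtain rfl : j' = j := by simpa using hj'
        exact absurd haj' haj
  · rintro s' ha ⟨h1, h2⟩
    exact ⟨by simpa using h1, fun j => h2 j (List.mem_finRange j)⟩

/-- One identifier for every value of `a`, in sorted order; they are `vBase` apart. -/
def assignStep (U : Finset (Fin q.d)) (a : Fin q.d) : Prog U :=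
  .seq (.cond (.conj (.nle (.const 1) (.var vO))
      (.neg (.rle (.arr (aV U a) (.arr aP (.var vO)))
        (.arr (aV U a) (.arr aP (.minus (.var vO) (.const 1)))))))
      (.setN vCur (.plus (.var vCur) (.var vBase))) .skip)
    (.putN (aId a) (.arr aP (.var vO)) (.var vCur))

def assign (U : Finset (Fin q.d)) (a : Fin q.d) : Prog U :=
  .seq (.setN vCur (.const 0)) (.seq (forN vO vL (assignStep U a))
    (.setN vBase (.plus (.var vBase) (.var vCur))))

/-- Sorting makes equal values adjacent, so a comparison with the predecessor decides whether a new
identifier is due. The last identifier plus the old base is the old base times the number of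
distinct values, computed without multiplication of naturals, which the machine does not have. -/
theorem assign_runs (a : Fin q.d) (s : Store U) {L : ℕ} (hL : s.nvar vL = L) {V : ℕ → ℝ}
    (hV : s.rarr (aV U a) = V)
    (hsort : ∀ x y, x ≤ y → y < L → V (s.narr aP x) ≤ V (s.narr aP y))
    (hsurj : ∀ e < L, ∃ x < L, s.narr aP x = e) :
    Runs f T (assign U a) s (40 * (L + 1)) fun s' =>
      s.nvar vBase ≤ s'.nvar vBase ∧
      (∀ e < L, s'.narr (aId a) e + s.nvar vBase ≤ s'.nvar vBase) ∧
      ∀ e < L, ∀ e' < L, (V e = V e' → s'.narr (aId a) e = s'.narr (aId a) e') ∧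
        (V e < V e' → s'.narr (aId a) e + s.nvar vBase ≤ s'.narr (aId a) e') := by
  set P := s.narr aP with hP
  set b := s.nvar vBase with hb
  refine Runs.mono (t := 2 + ((L * (25 + 9) + 7) + 4)) ?_ (by omega) fun _ _ h => h
  refine Runs.seq (R := fun s' => s' = s.setN vCur 0)
    ⟨_, _, .setN _ _ _, by simp [NExp.steps], by simp [NExp.eval]⟩ fun s₁ _ hs₁ => ?_
  subst hs₁
  refine Runs.seq (R := fun s' => s'.nvar vBase = b ∧
    (∀ x < L, s'.narr (aId a) (P x) ≤ s'.nvar vCur) ∧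
    ∀ x y, x ≤ y → y < L →
      (V (P x) = V (P y) → s'.narr (aId a) (P x) = s'.narr (aId a) (P y)) ∧
      (V (P x) < V (P y) → s'.narr (aId a) (P x) + b ≤ s'.narr (aId a) (P y))) ?_ ?_
  · refine runs_forN (fun o s' => (∀ x < o, s'.narr (aId a) (P x) ≤ s'.nvar vCur) ∧
      (0 < o → s'.narr (aId a) (P (o - 1)) = s'.nvar vCur) ∧
      ∀ x y, x ≤ y → y < o →
      (V (P x) = V (P y) → s'.narr (aId a) (P x) = s'.narr (aId a) (P y)) ∧
      (V (P x) < V (P y) → s'.narr (aId a) (P x) + b ≤ s'.narr (aId a) (P y))) L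
      (by simpa using hL) (by simp) (by simp [assignStep]) (by simp [assignStep]) (by simp) ?_ ?_ ?_
    · intro i s' v h
      simpa using h
    · rintro o ho s' ha hso ⟨h1, h2, h3⟩
      refine Prog.Flat.runs_le (p := assignStep U a) (by simp [assignStep])
        (by simp [assignStep, Prog.time, Test.steps, NExp.steps, RExp.steps]) ?_
      have e1 : s'.rarr (aV U a) = V := by rw [ha.ra _ (by simp [assignStep])]; exact hV
      have e2 : s'.narr aP = P := ha.na _ (by simp [assignStep])
      have e3 : s'.nvar vBase = b := by rw [ha.nv _ (by simp [assignStep])]; simp [hb]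
      obtain ⟨c, hc⟩ : ∃ c, c = if 1 ≤ o ∧ V (P (o - 1)) < V (P o) then s'.nvar vCur + b
        else s'.nvar vCur := ⟨_, rfl⟩
      have hrun1 : ((assignStep U a).run s').nvar vCur = c := by
        simp [assignStep, Test.holds, NExp.eval, RExp.eval, hso, e1, e2, e3, hc]
        split_ifs <;> simp
      have hrun2 : ((assignStep U a).run s').narr (aId a) =
          Function.update (s'.narr (aId a)) (P o) c := by
        simp [assignStep, Test.holds, NExp.eval, RExp.eval, hso, e1, e2, e3, hc]
        split_ifs <;> simp [hso, e2]
      have hcc : s'.nvar vCur ≤ c := by rw [hc]; split_ifs <;> omega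
      -- Only surjectivity of the index array is known, so an entry might be visited twice.
      -- Sortedness then forces equal values in between, and the entry is overwritten by the
      -- identifier that it already has.
      have hold : ∀ x < o, ((assignStep U a).run s').narr (aId a) (P x) = s'.narr (aId a) (P x) := by
        intro x hx
        rw [hrun2, Function.update_apply]
        split_ifs with hxo
        · have k1 := hsort (o - 1) o (by omega) ho
          have k2 := hsort x (o - 1) (by omega) (by omega)
          rw [hxo] at k2
          rw [hc, if_neg (by rintro ⟨-, h⟩; exact absurd h (not_lt.2 k2)), ← h2 (by omega)]
          exact ((h3 x (o - 1) (by omega) (by omega)).1 (by rw [hxo]; exact le_antisymm k2 k1)).symm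
        · rfl
      have hnew : ((assignStep U a).run s').narr (aId a) (P o) = c := by rw [hrun2]; simp
      rw [hrun1]
      refine ⟨fun x hx => ?_, fun _ => by simpa using hnew, fun x y hxy hy => ?_⟩
      · rcases Nat.lt_succ_iff_lt_or_eq.1 hx with hx | rfl
        · rw [hold x hx]; exact (h1 x hx).trans hcc
        · rw [hnew]
      · rcases Nat.lt_succ_iff_lt_or_eq.1 hy with hy | rfl
        · rw [hold x (by omega), hold y hy]; exact h3 x y hxy hy
        · rcases hxy.lt_or_eq with hxy | rfl
          · rw [hold x hxy, hnew]
            have k1 := hsort (y - 1) y (by omega) ho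
            have k2 := hsort x (y - 1) (by omega) (by omega)
            by_cases hlt : V (P (y - 1)) < V (P y)
            · rw [hc, if_pos ⟨by omega, hlt⟩]
              have := h1 x hxy
              exact ⟨fun h => absurd (k2.trans_lt hlt) (by rw [h]; exact lt_irrefl _),
                fun _ => by omega⟩
            · rw [hc, if_neg (fun h => hlt h.2), ← h2 (by omega),
                le_antisymm (not_lt.1 hlt) k1]
              exact h3 x (y - 1) (by omega) (by omega)
          · exact ⟨fun _ => rfl, fun h => absurd h (lt_irrefl _)⟩
    · rintro s' ha ⟨h1, h2, h3⟩
      refine ⟨?_, h1, h3⟩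
      rw [ha.nv _ (by simp [assignStep])]; simp [hb]
  · rintro s₂ - ⟨e, h1, h3⟩
    refine ⟨_, _, .setN _ _ _, by simp [NExp.steps], ?_⟩
    simp only [NExp.eval, setN_nvar, setN_narr, e]
    refine ⟨by omega, fun e he => ?_, fun e he e' he' => ?_⟩
    · obtain ⟨x, hx, rfl⟩ := hsurj e he
      have := h1 x hx
      omega
    · obtain ⟨x, hx, rfl⟩ := hsurj e he
      obtain ⟨y, hy, rfl⟩ := hsurj e' he'
      rcases le_total x y with hxy | hxy
      · exact h3 x y hxy hy
      · exact ⟨fun h => ((h3 y x hxy hx).1 h.symm).symm,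
          fun h => absurd h (not_lt.2 (hsort y x hxy hx))⟩

/-- The key of a row for the attributes in `S`. -/
def keyv (s : Store U) (S : Finset (Fin q.d)) (j : Fin q.m) (i : ℕ) : ℕ :=
  ∑ a ∈ S, s.narr (aId a) (s.narr (aPos j a) i)

noncomputable def keyExp (S : Finset (Fin q.d)) (j : Fin q.m) (x : NVar q) : NExp q :=
  NExp.sum (S.toList.map fun a => .arr (aId a) (.arr (aPos j a) (.var x)))

theorem keyExp_eval (s : Store U) (S : Finset (Fin q.d)) (j : Fin q.m) (x : NVar q) :
    (keyExp S j x).eval s = keyv s S j (s.nvar x) := by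
  simp [keyExp, NExp.eval_sum, keyv, Function.comp_def, NExp.eval, Finset.sum_map_toList]

theorem keyv_agree {s s' : Store U} {W : Set (Loc U)} (ha : Agree W s s')
    (hW : ∀ l ∈ W, l.kind ≠ 11 ∧ l.kind ≠ 12) (S : Finset (Fin q.d)) (j : Fin q.m) (i : ℕ) :
    keyv s' S j i = keyv s S j i := by
  unfold keyv
  refine Finset.sum_congr rfl fun a _ => ?_
  rw [ha.na (aId a) fun h => by simpa using (hW _ h).2,
    ha.na (aPos j a) fun h => by simpa using (hW _ h).1]

/-- Keys for sets of attributes in `A` identify the values of these attributes. -/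
def Keyed (D : Instance q) (A : Finset (Fin q.d)) (s : Store U) : Prop :=
  ∀ S ⊆ A, ∀ j p i i', S ⊆ q.attr j → S ⊆ q.attr p → i < (D.rows j).length →
    i' < (D.rows p).length → keyv s S j i < s.nvar vBase ∧
      (keyv s S j i = keyv s S p i' ↔ ∀ a ∈ S, D.val j i a = D.val p i' a)

noncomputable def makeKeys (U : Finset (Fin q.d)) : Prog U :=
  .seq (.setN vBase (.const 1)) (seqAll (List.finRange q.d) fun a =>
    .seq (gather U a) (.seq (mergeSort (aV U a)) (assign U a)))

theorem gather_writes (a : Fin q.d) : ∀ l ∈ (gather U a).writes,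
    l = .nv vO ∨ l = .nv vL ∨ l = .ra (aV U a) ∨ ∃ j, l = .na (aPos j a) := by
  intro l hl
  simp only [gather, Prog.writes, Set.mem_union, mem_seqAll_writes] at hl
  rcases hl with hl | ⟨j, -, hj⟩
  · simp at hl; tauto
  · have := gatherTable_writes _ _ hj
    simp only [Set.mem_insert_iff, Set.mem_singleton_iff] at this
    rcases this with h | h | h | h
    · tauto
    · tauto
    · tauto
    · exact .inr (.inr (.inr ⟨j, h⟩))

theorem attrKeys_writes (a : Fin q.d) :
    ∀ l ∈ (Prog.seq (gather U a) (.seq (mergeSort (aV U a)) (assign U a))).writes,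
    l.kind ∈ Set.Icc 10 19 ∧ ∀ b ≠ a, l ≠ .na (aId b) ∧ ∀ j, l ≠ .na (aPos j b) := by
  intro l hl
  simp only [Prog.writes, Set.mem_union] at hl
  rcases hl with h | h | h
  · have hab : ∀ b : Fin q.d, b ≠ a → (a : ℕ) ≠ b := fun b hb h => hb (Fin.ext h.symm)
    rcases gather_writes _ _ h with rfl | rfl | rfl | ⟨j, rfl⟩ <;> simp
    intro b hb j' _
    exact hab b hb
  · have := mergeSort_kind _ _ h
    refine ⟨⟨by have := this.1; omega, by have := this.2; omega⟩, fun b _ => ⟨?_, fun j => ?_⟩⟩ <;>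
    · rintro rfl
      simp at this
  · have hab : ∀ b : Fin q.d, b ≠ a → (a : ℕ) ≠ b := fun b hb h => hb (Fin.ext h.symm)
    simp [assign, assignStep] at h
    rcases h with rfl | rfl | rfl | rfl <;> simp
    exact hab

theorem makeKeys_kind : ∀ l ∈ (makeKeys U).writes, l.kind ∈ Set.Icc 10 19 := by
  intro l hl
  simp only [makeKeys, Prog.writes, Set.mem_union, mem_seqAll_writes] at hl
  rcases hl with hl | ⟨a, -, ha⟩
  · simp at hl; simp [hl]
  · exact (attrKeys_writes a l ha).1

/-- Keys are numbers in mixed radix: the key for the attributes treated so far is below the base,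
and identifiers of the next attribute differ by at least the base, so the sum determines both.
Identifiers are shared by all tables, which makes keys of rows of different tables comparable. -/
theorem makeKeys_runs (D : Instance q) {N h : ℕ} (hN : ∀ j, (D.rows j).length ≤ N)
    (hh : q.m * N ≤ 2 ^ h) (s : Store U) (hs : HasTables D s) :
    Runs f T (makeKeys U) s (q.d * (300 * (h + 1) * ((q.m + 1) * (N + 1))) + 3)
      fun s' => Keyed D Finset.univ s' := by
  refine Runs.mono (t := 2 + ((List.finRange q.d).length * (300 * (h + 1) * ((q.m + 1) * (N + 1)))
    + 1)) ?_ (by simp; omega) fun _ _ h => h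
  refine Runs.seq (R := fun s' => s' = s.setN vBase 1)
    ⟨_, _, .setN _ _ _, by simp [NExp.steps], by simp [NExp.eval]⟩ fun s₁ _ hs₁ => ?_
  have hT₁ : HasTables D s₁ := by
    rw [hs₁]; exact hs.agree (agree_setN _ _ _) (by simp)
  refine runs_seqAll (fun l s' => Keyed D l.toFinset s') ?_ ?_ ?_
  · intro S hS j p i i' _ _ _ _
    have : S = ∅ := by simpa using hS
    subst this
    simp [keyv, hs₁]
  · rintro l₁ a l₂ hl s₂ ha₂ hK
    have hal : a ∉ l₁ := by
      have := List.nodup_finRange q.d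
      rw [hl, List.nodup_append] at this
      intro h
      exact this.2.2 a h a (by simp) rfl
    have hT₂ : HasTables D s₂ := by
      refine hT₁.agree ha₂ fun l hl => ?_
      obtain ⟨j', -, hj'⟩ := mem_seqAll_writes.1 hl
      have := (attrKeys_writes _ _ hj').1.1
      omega
    have hmain : Runs f T (Prog.seq (gather U a) (.seq (mergeSort (aV U a)) (assign U a))) s₂
        (300 * (h + 1) * ((q.m + 1) * (N + 1))) (fun s' => s₂.nvar vBase ≤ s'.nvar vBase ∧
          ∀ j, a ∈ q.attr j → ∀ i < (D.rows j).length,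
            s'.narr (aId a) (s'.narr (aPos j a) i) + s₂.nvar vBase ≤ s'.nvar vBase ∧
            ∀ p, a ∈ q.attr p → ∀ i' < (D.rows p).length,
              (D.val j i a = D.val p i' a → s'.narr (aId a) (s'.narr (aPos j a) i) =
                s'.narr (aId a) (s'.narr (aPos p a) i')) ∧
              (D.val j i a < D.val p i' a → s'.narr (aId a) (s'.narr (aPos j a) i) +
                s₂.nvar vBase ≤ s'.narr (aId a) (s'.narr (aPos p a) i'))) := by
      refine Runs.mono (t := (q.m * (20 * N + 10) + 3) +
        ((h + 1) * (128 * (q.m * N + 1)) + 40 * (q.m * N + 1))) ?_ ?_ fun _ _ h => h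
      rotate_left
      · nlinarith [Nat.zero_le (h * (q.m * N)), Nat.zero_le (h * q.m), Nat.zero_le (h * N),
          Nat.zero_le (q.m * N)]
      refine (gather_runs D a hN s₂ hT₂).seq fun s₃ ha₃ ⟨hL, hg⟩ => ?_
      have hms := mergeSort_runs (f := f) (T := T) (aV U a) (by simp) s₃ (hL.trans hh)
      rw [mergeStep_time] at hms
      refine (hms.mono (Nat.mul_le_mul le_rfl (Nat.mul_le_mul le_rfl (by omega)))
        fun _ _ h => h).seq fun s₄ ha₄ ⟨hsort, hsurj⟩ => ?_
      have hfr : ∀ l : Loc U, l.kind ∉ Set.Icc 13 17 → l ∉ (mergeSort (aV U a)).writes :=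
        fun l hl h => hl (mergeSort_kind _ _ h)
      have b1 : s₄.rarr (aV U a) = s₃.rarr (aV U a) := ha₄.ra _ (hfr _ (by simp))
      have b2 : s₄.nvar vL = s₃.nvar vL := ha₄.nv _ (by
        simp [mergeSort, mergePass, mergeStep, nextBlocks, moveSmaller])
      have b3 : s₄.nvar vBase = s₂.nvar vBase := (ha₄.nv _ (hfr _ (by simp))).trans
        (ha₃.nv _ fun h => by have := gather_writes _ _ h; simp at this)
      have b4 : ∀ j, s₄.narr (aPos j a) = s₃.narr (aPos j a) := fun j => ha₄.na _ (hfr _ (by simp))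
      refine (assign_runs a s₄ b2 b1 hsort hsurj).mono (by omega) fun s₅ ha₅ ⟨r1, r2, r3⟩ => ?_
      have b5 : ∀ j, s₅.narr (aPos j a) = s₃.narr (aPos j a) := fun j =>
        (ha₅.na _ (by simp [assign, assignStep])).trans (b4 j)
      rw [b3] at r1 r2 r3
      refine ⟨r1, fun j hj i hi => ⟨?_, fun p hp i' hi' => ?_⟩⟩
      · rw [b5]; exact r2 _ (hg j hj i hi).1
      · rw [b5, b5, ← (hg j hj i hi).2, ← (hg p hp i' hi').2]
        exact r3 _ (hg j hj i hi).1 _ (hg p hp i' hi').1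
    refine hmain.mono le_rfl fun s' ha ⟨hb, hid⟩ => ?_
    have hsame : ∀ S, a ∉ S → ∀ j i, keyv s' S j i = keyv s₂ S j i := by
      intro S hS j i
      refine Finset.sum_congr rfl fun b hbS => ?_
      have hba : b ≠ a := fun h => hS (h ▸ hbS)
      rw [ha.na (aId b) fun h => ((attrKeys_writes a _ h).2 b hba).1 rfl,
        ha.na (aPos j b) fun h => ((attrKeys_writes a _ h).2 b hba).2 j rfl]
    intro S hS j p i i' hSj hSp hi hi'
    have hS' : S.erase a ⊆ l₁.toFinset := by
      intro b hb
      have := hS (Finset.mem_of_mem_erase hb)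
      have hne := Finset.ne_of_mem_erase hb
      simpa [hne] using this
    have hnot : a ∉ S.erase a := Finset.notMem_erase a S
    obtain ⟨k1, k2⟩ := hK _ hS' j p i i' ((Finset.erase_subset _ _).trans hSj)
      ((Finset.erase_subset _ _).trans hSp) hi hi'
    obtain ⟨k1', -⟩ := hK _ hS' p p i' i' ((Finset.erase_subset _ _).trans hSp)
      ((Finset.erase_subset _ _).trans hSp) hi' hi'
    rw [← hsame _ hnot, ← hsame _ hnot p] at k2
    rw [← hsame _ hnot] at k1 k1'
    by_cases haS : a ∈ S
    · have hsplit : ∀ j i, keyv s' S j i =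
          s'.narr (aId a) (s'.narr (aPos j a) i) + keyv s' (S.erase a) j i := fun j i =>
        (Finset.add_sum_erase S _ haS).symm
      have d1 := hid j (hSj haS) i hi
      have d2 := hid p (hSp haS) i' hi'
      rw [hsplit, hsplit]
      refine ⟨by omega, fun h => ?_, fun h => ?_⟩
      -- Different values would give identifiers at least one old base apart, more than the
      -- remaining parts of the two keys can make up for.
      · have hv : D.val j i a = D.val p i' a := by
          rcases lt_trichotomy (D.val j i a) (D.val p i' a) with h' | h' | h'
          · have := (d1.2 p (hSp haS) i' hi').2 h'; omega
          · exact h'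
          · have := (d2.2 j (hSj haS) i hi).2 h'; omega
        have hx := (d1.2 p (hSp haS) i' hi').1 hv
        have hrest := k2.1 (by omega)
        intro b hb
        by_cases hba : b = a
        · rw [hba]; exact hv
        · exact hrest b (Finset.mem_erase.2 ⟨hba, hb⟩)
      · rw [(d1.2 p (hSp haS) i' hi').1 (h a haS),
          k2.2 fun b hb => h b (Finset.mem_of_mem_erase hb)]
    · rw [Finset.erase_eq_of_notMem haS] at k1 k2
      exact ⟨by omega, k2⟩
  · intro s' _ h
    simpa using h

end Keys

/-! ### Join trees and join results -/

section JoinTree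
variable {q : JoinQuery}

/-- An elimination order of the relations in `S` along a join tree: a list of pairs of a relation
and its parent, which comes later in the order, and the root. -/
inductive Elim (q : JoinQuery) : Finset (Fin q.m) → List (Fin q.m × Fin q.m) → Fin q.m → Prop
  | root (r) : Elim q {r} [] r
  | step {S L r j p} : j ∉ S → p ∈ S →
      (∀ l ∈ S, ∀ a ∈ q.attr j, a ∈ q.attr l → a ∈ q.attr p) → Elim q S L r →
      Elim q (insert j S) ((j, p) :: L) r

/-- A connected set of relations grows along edges of the join tree. An edge that leaves the set
adds a leaf, and its end in the set becomes the parent. -/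
theorem JoinQuery.Acyclic.exists_elim (hq : q.Acyclic) : ∃ L r, Elim q Finset.univ L r := by
  obtain ⟨T, hT, hconn⟩ := hq
  have key : ∀ n (S : Finset (Fin q.m)) L r, Sᶜ.card = n → S.Nonempty →
      (T.induce (S : Set (Fin q.m))).Preconnected → Elim q S L r →
      ∃ L r, Elim q Finset.univ L r := by
    intro n
    induction n with
    | zero =>
      intro S L r hc _ _ hE
      have : S = Finset.univ := by simpa using hc
      exact ⟨L, r, this ▸ hE⟩
    | succ n ih =>
      intro S L r hc hS hpre hE
      obtain ⟨u, hu⟩ := hS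
      obtain ⟨v, hv⟩ : (Sᶜ).Nonempty := by rw [← Finset.card_pos]; omega
      obtain ⟨w⟩ := hT.connected.preconnected u v
      obtain ⟨⟨⟨p, j⟩, hadj⟩, -, hp, hj⟩ :=
        w.exists_boundary_dart (S : Set (Fin q.m)) (by simpa using hu) (by simpa using hv)
      simp only [Finset.mem_coe] at hp hj
      change T.Adj p j at hadj
      refine ih (insert j S) ((j, p) :: L) r ?_ ⟨j, by simp⟩ ?_ (.step hj hp ?_ hE)
      · rw [Finset.compl_insert, Finset.card_erase_of_mem (by simpa using hj)]; omega
      · have hsub : (S : Set (Fin q.m)) ≤ ((insert j S : Finset (Fin q.m)) : Set (Fin q.m)) := by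
          simp
        have hto : ∀ x : ((insert j S : Finset (Fin q.m)) : Set (Fin q.m)),
            (T.induce ((insert j S : Finset (Fin q.m)) : Set (Fin q.m))).Reachable x
              ⟨p, by simp [hp]⟩ := by
          rintro ⟨x, hx⟩
          rcases Finset.mem_insert.1 (Finset.mem_coe.1 hx) with rfl | hxS
          · exact SimpleGraph.Adj.reachable (by simpa using hadj.symm)
          · exact (hpre ⟨x, hxS⟩ ⟨p, hp⟩).map (SimpleGraph.induceHomOfLE T hsub).toHom
        exact fun x y => (hto x).trans (hto y).symm
      -- If the parent `p` lacked the shared attribute `a`, one could walk from `p` to `l` inside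
      -- the set and from `l` to `j` among the relations containing `a`. Both walks avoid the edge
      -- between `p` and `j`, which is a bridge.
      · intro l hl a haj hal
        by_contra hap
        have hbr := SimpleGraph.isAcyclic_iff_forall_adj_isBridge.1 hT.isAcyclic hadj
        rw [SimpleGraph.isBridge_iff] at hbr
        apply hbr
        have h1 : (T.deleteEdges {s(p, j)}).Reachable p l := by
          let φ : T.induce (S : Set (Fin q.m)) →g T.deleteEdges {s(p, j)} :=
            { toFun := fun x => x.1
              map_rel' := by
                rintro ⟨x, hx⟩ ⟨y, hy⟩ hxy
                simp only [SimpleGraph.comap_adj, Function.Embedding.subtype_apply] at hxy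
                simp only [SimpleGraph.deleteEdges_adj, Set.mem_singleton_iff, Sym2.eq_iff]
                refine ⟨hxy, ?_⟩
                rintro (⟨-, rfl⟩ | ⟨rfl, -⟩)
                · exact hj hy
                · exact hj hx }
          exact (hpre ⟨p, hp⟩ ⟨l, hl⟩).map φ
        have h2 : (T.deleteEdges {s(p, j)}).Reachable l j := by
          let φ : T.induce {i | a ∈ q.attr i} →g T.deleteEdges {s(p, j)} :=
            { toFun := fun x => x.1
              map_rel' := by
                rintro ⟨x, hx⟩ ⟨y, hy⟩ hxy
                simp only [SimpleGraph.comap_adj, Function.Embedding.subtype_apply] at hxy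
                simp only [SimpleGraph.deleteEdges_adj, Set.mem_singleton_iff, Sym2.eq_iff]
                refine ⟨hxy, ?_⟩
                rintro (⟨rfl, -⟩ | ⟨-, rfl⟩)
                · exact hap hx
                · exact hap hy }
          exact ((hconn a).preconnected ⟨l, hal⟩ ⟨j, haj⟩).map φ
        exact h1.trans h2
  obtain ⟨r⟩ := hT.connected.nonempty
  refine key _ {r} [] r rfl ⟨r, by simp⟩ ?_ (.root r)
  rintro ⟨x, hx⟩ ⟨y, hy⟩
  obtain rfl : x = r := by simpa using hx
  obtain rfl : y = x := by simpa using hy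
  exact .refl _

end JoinTree

/-! ### Join results as consistent families of rows -/

section Families
variable {q : JoinQuery} (D : Instance q)

/-- Choices of a row (by its index) in every table of `S`. -/
def Consistent (S : Finset (Fin q.m)) (ρ : Fin q.m → ℕ) : Prop :=
  ∀ j ∈ S, ∀ l ∈ S, ∀ a ∈ q.attr j, a ∈ q.attr l → D.val j (ρ j) a = D.val l (ρ l) a

/-- Rows that agree on the common attributes. -/
def Matches (j p : Fin q.m) (i i' : ℕ) : Prop :=
  ∀ a ∈ q.attr j ∩ q.attr p, D.val j i a = D.val p i' a

open scoped Classical in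
/-- The join results of the tables in `S`, as families of row indices. -/
noncomputable def families (S : Finset (Fin q.m)) : Finset (Fin q.m → ℕ) :=
  (Fintype.piFinset fun j => if j ∈ S then Finset.range (D.rows j).length else {0}).filter
    (Consistent D S)

variable {D}

theorem mem_families {S : Finset (Fin q.m)} {ρ : Fin q.m → ℕ} : ρ ∈ families D S ↔
    (∀ j ∈ S, ρ j < (D.rows j).length) ∧ (∀ j ∉ S, ρ j = 0) ∧ Consistent D S ρ := by
  simp only [families, Finset.mem_filter, Fintype.mem_piFinset, ← and_assoc, and_congr_left_iff]
  intro _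
  constructor
  · intro h
    exact ⟨fun j hj => by simpa [hj] using h j, fun j hj => by simpa [hj] using h j⟩
  · rintro ⟨h1, h2⟩ j
    by_cases hj : j ∈ S
    · simpa [hj] using h1 j hj
    · simpa [hj] using h2 j hj

/-- Whatever a leaf shares with the rest it shares with its parent, so one comparison with the
parent's row replaces all others. -/
theorem consistent_insert {S : Finset (Fin q.m)} {j p : Fin q.m} (hj : j ∉ S) (hp : p ∈ S)
    (h : ∀ l ∈ S, ∀ a ∈ q.attr j, a ∈ q.attr l → a ∈ q.attr p) {ρ : Fin q.m → ℕ} :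
    Consistent D (insert j S) ρ ↔ Consistent D S ρ ∧ Matches D j p (ρ j) (ρ p) := by
  constructor
  · intro hc
    refine ⟨fun l hl l' hl' => hc l (by simp [hl]) l' (by simp [hl']), fun a ha => ?_⟩
    rw [Finset.mem_inter] at ha
    exact hc j (by simp) p (by simp [hp]) a ha.1 ha.2
  · rintro ⟨hc, hm⟩
    have key : ∀ l ∈ S, ∀ a ∈ q.attr j, a ∈ q.attr l → D.val j (ρ j) a = D.val l (ρ l) a := by
      intro l hl a haj hal
      have hap := h l hl a haj hal
      exact (hm a (by simp [haj, hap])).trans (hc p hp l hl a hap hal)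
    intro l hl l' hl' a ha ha'
    rcases Finset.mem_insert.1 hl with rfl | h₁ <;> rcases Finset.mem_insert.1 hl' with rfl | h₂
    · rfl
    · exact key l' h₂ a ha ha'
    · exact (key l h₁ a ha' ha).symm
    · exact hc l h₁ l' h₂ a ha ha'

open scoped Classical in
-- This is the distributive law: the families on the larger set are grouped by their restriction to
-- `S`, and within a group the row of `j` ranges over the rows matching that of `p`. It justifies
-- eliminating one leaf at a time.
theorem sum_families_insert {S : Finset (Fin q.m)} {j p : Fin q.m} (hj : j ∉ S) (hp : p ∈ S)
    (h : ∀ l ∈ S, ∀ a ∈ q.attr j, a ∈ q.attr l → a ∈ q.attr p) (W W' : Fin q.m → ℕ → ℝ)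
    (hW : ∀ l ∈ S, l ≠ p → ∀ i < (D.rows l).length, W' l i = W l i)
    (hWp : ∀ i < (D.rows p).length, W' p i = W p i *
      ∑ i' ∈ (Finset.range (D.rows j).length).filter (fun i' => Matches D j p i' i), W j i') :
    ∑ ρ ∈ families D (insert j S), ∏ l ∈ insert j S, W l (ρ l) =
      ∑ ρ ∈ families D S, ∏ l ∈ S, W' l (ρ l) := by
  have hprod : ∀ ρ ∈ families D S, ∏ l ∈ S, W' l (ρ l) =
      ∑ i' ∈ (Finset.range (D.rows j).length).filter (fun i' => Matches D j p i' (ρ p)),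
        W j i' * ∏ l ∈ S, W l (ρ l) := by
    intro ρ hρ
    rw [mem_families] at hρ
    rw [← Finset.sum_mul, ← Finset.mul_prod_erase S _ hp, ← Finset.mul_prod_erase S _ hp,
      hWp _ (hρ.1 p hp), ← mul_assoc, mul_comm (W p (ρ p))]
    congr 1
    refine Finset.prod_congr rfl fun l hl => ?_
    rw [Finset.mem_erase] at hl
    exact hW l hl.2 hl.1 _ (hρ.1 l hl.2)
  rw [Finset.sum_congr rfl hprod, Finset.sum_sigma']
  have hjp : ∀ l ∈ S, l ≠ j := fun l hl h => hj (h ▸ hl)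
  have hup : ∀ (ρ : Fin q.m → ℕ) i, Consistent D S (Function.update ρ j i) ↔ Consistent D S ρ := by
    intro ρ i
    unfold Consistent
    refine forall₂_congr fun l hl => forall₂_congr fun l' hl' => ?_
    rw [Function.update_of_ne (hjp l hl), Function.update_of_ne (hjp l' hl')]
  -- Families carry the default index 0 outside their set of tables, so restriction to `S` resets
  -- the entry at `j` to 0.
  refine Finset.sum_nbij' (fun ρ => ⟨Function.update ρ j 0, ρ j⟩)
    (fun x => Function.update x.1 j x.2) ?_ ?_ ?_ ?_ ?_
  · intro ρ hρ
    rw [mem_families, consistent_insert hj hp h] at hρ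
    obtain ⟨h1, h2, h3, h4⟩ := hρ
    simp only [Finset.mem_sigma, mem_families, Finset.mem_filter, Finset.mem_range, hup]
    refine ⟨⟨fun l hl => ?_, fun l hl => ?_, h3⟩, h1 j (by simp), ?_⟩
    · rw [Function.update_of_ne (hjp l hl)]; exact h1 l (by simp [hl])
    · by_cases hlj : l = j
      · rw [hlj, Function.update_self]
      · rw [Function.update_of_ne hlj]; exact h2 l (by simp [hl, hlj])
    · rwa [Function.update_of_ne (hjp p hp)]
  · rintro ⟨ρ, i⟩ hx
    simp only [Finset.mem_sigma, mem_families, Finset.mem_filter, Finset.mem_range] at hx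
    obtain ⟨⟨h1, h2, h3⟩, h4, h5⟩ := hx
    rw [mem_families, consistent_insert hj hp h]
    refine ⟨fun l hl => ?_, fun l hl => ?_, (hup _ _).2 h3, ?_⟩
    · rcases Finset.mem_insert.1 hl with rfl | hl
      · simpa using h4
      · simpa [Function.update_of_ne (hjp l hl)] using h1 l hl
    · rw [Finset.mem_insert, not_or] at hl
      simpa [Function.update_of_ne hl.1] using h2 l hl.2
    · simpa [Function.update_of_ne (hjp p hp)] using h5
  · intro ρ _
    simp
  · rintro ⟨ρ, i⟩ hx
    simp only [Finset.mem_sigma, mem_families] at hx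
    have : Function.update ρ j 0 = ρ := by
      rw [← hx.1.2.1 j hj, Function.update_eq_self]
    simp [this]
  · intro ρ _
    simp only [Finset.prod_insert hj]
    congr 1
    refine Finset.prod_congr rfl fun l hl => ?_
    rw [Function.update_of_ne (hjp l hl)]

/-- The tuple of a family of rows. -/
noncomputable def familyTuple (D : Instance q) (ρ : Fin q.m → ℕ) (a : Fin q.d) : ℝ :=
  D.val (q.cover a).choose (ρ (q.cover a).choose) a

theorem familyTuple_eq {ρ : Fin q.m → ℕ} (h : Consistent D Finset.univ ρ) {j : Fin q.m}
    {a : Fin q.d} (ha : a ∈ q.attr j) : familyTuple D ρ a = D.val j (ρ j) a :=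
  h _ (by simp) _ (by simp) a (q.cover a).choose_spec ha

theorem val_eq {j : Fin q.m} {i : ℕ} (hi : i < (D.rows j).length) (a : {a // a ∈ q.attr j}) :
    D.val j i a = (D.rows j)[i] a := by
  simp [Instance.val, hi]

theorem familyTuple_mem {ρ : Fin q.m → ℕ} (h : ρ ∈ families D Finset.univ) :
    familyTuple D ρ ∈ joinSet D := by
  rw [mem_families] at h
  intro j
  have hi := h.1 j (by simp)
  have : (fun a : {a // a ∈ q.attr j} => familyTuple D ρ a) = (D.rows j)[ρ j] := by
    funext a
    rw [familyTuple_eq h.2.2 a.2, val_eq hi]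
  rw [this]
  exact List.getElem_mem hi

open scoped Classical in
-- Consistent rows glue to one tuple because every attribute is covered, and a tuple determines its
-- rows because tables have no repetitions. The product of the tests of the single tables is the
-- test of the tuple.
theorem card_families (A : Finset (Fin q.d)) (φ : Fin q.d → ℝ → Prop) :
    ∑ ρ ∈ families D Finset.univ, ∏ j, (if ∀ a ∈ A, a ∈ q.attr j → φ a (D.val j (ρ j) a)
      then (1 : ℝ) else 0) =
      ((joinSet_finite D).toFinset.filter fun t => ∀ a ∈ A, φ a (t a)).card := by
  have h1 : ∀ ρ ∈ families D Finset.univ, ∏ j, (if ∀ a ∈ A, a ∈ q.attr j → φ a (D.val j (ρ j) a)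
      then (1 : ℝ) else 0) = if ∀ a ∈ A, φ a (familyTuple D ρ a) then 1 else 0 := by
    intro ρ hρ
    rw [mem_families] at hρ
    rw [Finset.prod_ite_zero]
    simp only [Finset.mem_univ, Finset.prod_const_one, true_implies]
    congr 1
    apply propext
    constructor
    · intro h a ha
      obtain ⟨j, hj⟩ := q.cover a
      rw [familyTuple_eq hρ.2.2 hj]
      exact h j a ha hj
    · intro h j a ha hj
      rw [← familyTuple_eq hρ.2.2 hj]
      exact h a ha
  rw [Finset.sum_congr rfl h1, Finset.sum_boole]
  congr 1
  refine Finset.card_bij (fun ρ _ => familyTuple D ρ) ?_ ?_ ?_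
  · intro ρ hρ
    rw [Finset.mem_filter] at hρ ⊢
    exact ⟨by simpa using familyTuple_mem hρ.1, hρ.2⟩
  · intro ρ hρ ρ' hρ' he
    rw [Finset.mem_filter, mem_families] at hρ hρ'
    funext j
    have hi := hρ.1.1 j (by simp)
    have hi' := hρ'.1.1 j (by simp)
    have : (D.rows j)[ρ j] = (D.rows j)[ρ' j] := by
      funext a
      rw [← val_eq hi, ← val_eq hi', ← familyTuple_eq hρ.1.2.2 a.2, ← familyTuple_eq hρ'.1.2.2 a.2,
        he]
    exact (D.nodup j).getElem_inj_iff.1 this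
  · intro t ht
    rw [Finset.mem_filter, Set.Finite.mem_toFinset] at ht
    choose ρ hρ hρt using fun j => List.mem_iff_getElem.1 (ht.1 j)
    have hval : ∀ j, ∀ a ∈ q.attr j, D.val j (ρ j) a = t a := by
      intro j a ha
      rw [val_eq (hρ j) ⟨a, ha⟩, hρt]
    have hc : Consistent D Finset.univ ρ := by
      intro j _ l _ a ha ha'
      rw [hval j a ha, hval l a ha']
    have hft : familyTuple D ρ = t := by
      funext a
      obtain ⟨j, hj⟩ := q.cover a
      rw [familyTuple_eq hc hj, hval j a hj]
    refine ⟨ρ, ?_, hft⟩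
    rw [Finset.mem_filter, mem_families]
    exact ⟨⟨fun j _ => hρ j, by simp, hc⟩, by rw [hft]; exact ht.2⟩

end Families

/-! ### Counting join results along the join tree -/

section Query
variable {q : JoinQuery} {U : Finset (Fin q.d)}
variable {f : List (Pt U × ℝ) → List (Pt U)} {T : ℕ → ℕ}

abbrev aWt (U : Finset (Fin q.d)) (j : Fin q.m) : RArr U := .tmp (nm 20 j 0)
abbrev aAcc (U : Finset (Fin q.d)) : RArr U := .tmp (nm 21 0 0)
abbrev aSel (j : Fin q.m) : ℕ := nm 22 j 0
abbrev vQ : NVar q := .tmp (nm 23 0 0)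
abbrev rCnt : RVar := .tmp (nm 24 0 0)
abbrev vRow (j : Fin q.m) : NVar q := .tmp (nm 25 j 0)

/-- The matching key of the current row of table `l` for the tree edge from `j` to `p`. -/
noncomputable abbrev edgeKey (j p l : Fin q.m) (x : NVar q) : NExp q :=
  keyExp (q.attr j ∩ q.attr p) l x

noncomputable def upClear (U : Finset (Fin q.d)) (j p : Fin q.m) : Prog U :=
  .putR (aAcc U) (edgeKey j p p vQ) (.const 0)

noncomputable def upAdd (U : Finset (Fin q.d)) (j p : Fin q.m) : Prog U :=
  .cond (.rle (.arr (aWt U j) (.var vQ)) (.const 0)) .skip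
    (.seq (.putR (aAcc U) (edgeKey j p j vQ)
      (.plus (.arr (aAcc U) (edgeKey j p j vQ)) (.arr (aWt U j) (.var vQ))))
      (.putN (aSel j) (edgeKey j p j vQ) (.var vQ)))

noncomputable def upMul (U : Finset (Fin q.d)) (j p : Fin q.m) : Prog U :=
  .putR (aWt U p) (.var vQ) (.times (.arr (aWt U p) (.var vQ)) (.arr (aAcc U) (edgeKey j p p vQ)))

/-- Multiply the weights of the rows of `p` with the total weights of the matching rows of `j`. -/
noncomputable def up (U : Finset (Fin q.d)) (j p : Fin q.m) : Prog U :=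
  .seq (forN vQ (.size p) (upClear U j p)) <| .seq (forN vQ (.size j) (upAdd U j p))
    (forN vQ (.size p) (upMul U j p))

theorem up_writes (j p : Fin q.m) : ∀ l ∈ (up U j p).writes,
    l = .nv vQ ∨ l = .ra (aAcc U) ∨ l = .na (aSel j) ∨ l = .ra (aWt U p) := by
  intro l hl
  simp [up, upClear, upAdd, upMul] at hl
  tauto

theorem Keyed.iff_matches {D : Instance q} {s : Store U} (hK : Keyed D Finset.univ s)
    {j p : Fin q.m} {i i' : ℕ} (hi : i < (D.rows j).length) (hi' : i' < (D.rows p).length) :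
    keyv s (q.attr j ∩ q.attr p) j i = keyv s (q.attr j ∩ q.attr p) p i' ↔ Matches D j p i i' :=
  (hK _ (Finset.subset_univ _) j p i i' Finset.inter_subset_left Finset.inter_subset_right hi
    hi').2

theorem Keyed.agree {D : Instance q} {A : Finset (Fin q.d)} {s s' : Store U} {W : Set (Loc U)}
    (h : Keyed D A s) (ha : Agree W s s') (hW : ∀ l ∈ W, l.kind ∉ Set.Icc 10 19) :
    Keyed D A s' := by
  have hW' : ∀ l ∈ W, l.kind ≠ 11 ∧ l.kind ≠ 12 := by
    intro l hl
    have := hW l hl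
    simp only [Set.mem_Icc, not_and, not_le] at this
    omega
  intro S hS j p i i' hj hp hi hi'
  rw [keyv_agree ha hW', keyv_agree ha hW', ha.nv vBase fun h => by simpa using hW _ h]
  exact h S hS j p i i' hj hp hi hi'

open scoped Classical in
-- Keys serve as addresses, so matching needs no search. Keys can be large, but only the addresses
-- of rows of `p` are cleared and read; other cells may contain old data without harm. Rows of
-- weight zero are skipped, so that a selected row always has positive weight.
theorem up_runs (U : Finset (Fin q.d)) (j p : Fin q.m) (hjp : j ≠ p) :
    ∃ c, ∀ (f : List (Pt U × ℝ) → List (Pt U)) (T : ℕ → ℕ) (D : Instance q) (N : ℕ),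
      (∀ j, (D.rows j).length ≤ N) → ∀ s : Store U, HasTables D s → Keyed D Finset.univ s →
      (∀ i < (D.rows j).length, 0 ≤ s.rarr (aWt U j) i) →
      Runs f T (up U j p) s (c * (N + 1)) fun s' =>
        (∀ i < (D.rows p).length, s'.rarr (aWt U p) i = s.rarr (aWt U p) i *
          ∑ i' ∈ (Finset.range (D.rows j).length).filter (fun i' => Matches D j p i' i),
            s.rarr (aWt U j) i') ∧
        (∀ i < (D.rows p).length,
          0 < ∑ i' ∈ (Finset.range (D.rows j).length).filter (fun i' => Matches D j p i' i),
            s.rarr (aWt U j) i' →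
          ∃ i' < (D.rows j).length, s'.narr (aSel j) (keyv s (q.attr j ∩ q.attr p) p i) = i' ∧
            Matches D j p i' i ∧ 0 < s.rarr (aWt U j) i') := by
  have hjp' : (j : ℕ) ≠ p := fun h => hjp (Fin.ext h)
  refine ⟨(upClear U j p).time + (upAdd U j p).time + (upMul U j p).time + 50, ?_⟩
  intro f T D N hN s hT hK hpos
  set S := q.attr j ∩ q.attr p with hS
  have hkind : ∀ (W : Set (Loc U)) (s' : Store U), Agree W s s' → (∀ l ∈ W, l.kind ∉ Set.Icc 10 19) →
      ∀ l i, keyv s' S l i = keyv s S l i := by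
    intro W s' ha hW l i
    refine keyv_agree ha (fun l hl => ?_) _ _ _
    have := hW l hl
    simp only [Set.mem_Icc, not_and, not_le] at this
    omega
  set c₁ := (upClear U j p).time
  set c₂ := (upAdd U j p).time
  set c₃ := (upMul U j p).time
  refine Runs.mono (t := ((D.rows p).length * (c₁ + 9) + 7) +
    (((D.rows j).length * (c₂ + 9) + 7) + ((D.rows p).length * (c₃ + 9) + 7))) ?_ ?_
    fun _ _ h => h
  rotate_left
  · nlinarith [Nat.mul_le_mul_right (c₁ + 9) (hN p), Nat.mul_le_mul_right (c₂ + 9) (hN j),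
      Nat.mul_le_mul_right (c₃ + 9) (hN p)]
  refine Runs.seq (R := fun s' => ∀ i < (D.rows p).length, s'.rarr (aAcc U) (keyv s S p i) = 0)
    ?_ fun s₁ ha₁ h₁ => ?_
  · refine runs_forN (fun o s' => ∀ i < o, s'.rarr (aAcc U) (keyv s S p i) = 0) _ (hT.size p)
      (by simp) (by simp [upClear]) (by simp [upClear]) (by simp) (fun _ _ _ h => h) ?_
      (fun _ _ h => h)
    intro o ho s' ha hso hI
    refine Prog.Flat.runs (by simp [upClear]) ?_
    intro i hi
    simp only [upClear, Prog.run, keyExp_eval, hso, RExp.eval, putR_rarr, Function.update_apply]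
    rw [hkind _ _ ha (by simp [upClear])]
    split_ifs with h
    · simp
    · refine hI i (lt_of_le_of_ne (by omega) fun hh => h (by rw [hh]))
  have hw₁ : (forN vQ (.size p) (upClear U j p)).writes = {.nv vQ, .ra (aAcc U)} := by
    simp [upClear]
  rw [hw₁] at ha₁
  have hwt₁ : ∀ l, s₁.rarr (aWt U l) = s.rarr (aWt U l) := fun l => ha₁.ra _ (by simp)
  refine Runs.seq (R := fun s' => ∀ i < (D.rows p).length,
    s'.rarr (aAcc U) (keyv s S p i) = ∑ i' ∈ (Finset.range (D.rows j).length).filter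
      (fun i' => Matches D j p i' i), s.rarr (aWt U j) i' ∧
      (0 < s'.rarr (aAcc U) (keyv s S p i) →
        ∃ i' < (D.rows j).length, s'.narr (aSel j) (keyv s S p i) = i' ∧ Matches D j p i' i ∧
          0 < s.rarr (aWt U j) i')) ?_ fun s₂ ha₂ h₂ => ?_
  · refine runs_forN (fun o s' => o ≤ (D.rows j).length ∧ ∀ i < (D.rows p).length,
      s'.rarr (aAcc U) (keyv s S p i) = ∑ i' ∈ (Finset.range o).filter
        (fun i' => Matches D j p i' i), s.rarr (aWt U j) i' ∧
        (0 < s'.rarr (aAcc U) (keyv s S p i) →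
          ∃ i' < (D.rows j).length, s'.narr (aSel j) (keyv s S p i) = i' ∧ Matches D j p i' i ∧
          0 < s.rarr (aWt U j) i')) _ ((ha₁.nv _ (by simp)).trans (hT.size j))
      (by simp) (by simp [upAdd]) (by simp [upAdd])
      ⟨by simp, fun i hi => ⟨by simpa using h₁ i hi, fun h => by simp [h₁ i hi] at h⟩⟩
      (fun _ _ _ h => h) ?_ (fun _ _ h => h.2)
    rintro o ho s' ha hso ⟨-, hI⟩
    refine Prog.Flat.runs (by simp [upAdd]) ⟨by omega, ?_⟩
    have hss : Agree ({.nv vQ, .ra (aAcc U), .na (aSel j)} : Set (Loc U)) s s' :=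
      (ha₁.mono (by intro; simp; tauto)).trans (ha.mono (by intro; simp [upAdd]; tauto))
    have hkey : ∀ l i, keyv s' S l i = keyv s S l i := hkind _ _ hss (by simp)
    have hwt : s'.rarr (aWt U j) = s.rarr (aWt U j) := hss.ra _ (by simp)
    intro i hi
    have hmatch := hK.iff_matches ho hi
    rw [← hS] at hmatch
    obtain ⟨hI1, hI2⟩ := hI i hi
    rw [Finset.range_add_one, Finset.filter_insert]
    by_cases hw : s.rarr (aWt U j) o ≤ 0
    · have hrun : (upAdd U j p).run s' = s' := by
        simp [upAdd, Test.holds, RExp.eval, NExp.eval, hso, hwt, hw]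
      rw [hrun]
      refine ⟨?_, hI2⟩
      have hw0 : s.rarr (aWt U j) o = 0 := le_antisymm hw (hpos o ho)
      split_ifs
      · rw [Finset.sum_insert (by simp), hw0, zero_add, hI1]
      · exact hI1
    · have hrun1 : ((upAdd U j p).run s').rarr (aAcc U) = Function.update (s'.rarr (aAcc U))
          (keyv s S j o) (s'.rarr (aAcc U) (keyv s S j o) + s.rarr (aWt U j) o) := by
        simp [upAdd, Test.holds, RExp.eval, NExp.eval, hso, hwt, hw, keyExp_eval, ← hS, hkey]
      have hrun2 : ((upAdd U j p).run s').narr (aSel j) = Function.update (s'.narr (aSel j))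
          (keyv s S j o) o := by
        have : keyv (s'.putR (aAcc U) (keyv s S j o)
          (s'.rarr (aAcc U) (keyv s S j o) + s.rarr (aWt U j) o)) S j o = keyv s S j o := by
          rw [keyv_agree (agree_putR _ _ _ _) (by simp), hkey]
        simp [upAdd, Test.holds, RExp.eval, NExp.eval, hso, hwt, hw, keyExp_eval, ← hS, hkey, this]
      rw [hrun1, hrun2, Function.update_apply, Function.update_apply]
      by_cases hm : Matches D j p o i
      · have hk := hmatch.2 hm
        rw [if_pos hk.symm, if_pos hk.symm, if_pos hm, Finset.sum_insert (by simp), hk, hI1]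
        exact ⟨add_comm _ _, fun _ => ⟨o, ho, rfl, hm, not_le.1 hw⟩⟩
      · have hk : ¬ keyv s S p i = keyv s S j o := fun h => hm (hmatch.1 h.symm)
        rw [if_neg hk, if_neg hk, if_neg hm]
        exact ⟨hI1, hI2⟩
  have hw₂ : (forN vQ (.size j) (upAdd U j p)).writes = {.nv vQ, .ra (aAcc U), .na (aSel j)} := by
    simp [upAdd, Set.pair_comm]
  rw [hw₂] at ha₂
  have hss : Agree ({.nv vQ, .ra (aAcc U), .na (aSel j)} : Set (Loc U)) s s₂ :=
    (ha₁.mono (by intro; simp; tauto)).trans ha₂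
  refine runs_forN (fun o s' => ∀ i < (D.rows p).length, s'.rarr (aWt U p) i =
    if i < o then s.rarr (aWt U p) i * s₂.rarr (aAcc U) (keyv s S p i) else s.rarr (aWt U p) i) _
    ((hss.nv _ (by simp)).trans (hT.size p)) (by simp) (by simp [upMul]) (by simp [upMul]) ?_
    (fun _ _ _ h => h) ?_ ?_
  · intro i hi
    rw [hss.ra _ (by simp)]
    simp
  · intro o ho s' ha hso hI
    refine Prog.Flat.runs (by simp [upMul]) ?_
    have hs' : Agree ({.nv vQ, .ra (aAcc U), .na (aSel j), .ra (aWt U p)} : Set (Loc U)) s s' :=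
      (hss.mono (by intro; simp; tauto)).trans (ha.mono (by intro; simp [upMul]; tauto))
    have hkey : ∀ l i, keyv s' S l i = keyv s S l i := hkind _ _ hs' (by simp)
    have hacc : s'.rarr (aAcc U) = s₂.rarr (aAcc U) := ha.ra _ (by simp [upMul])
    intro i hi
    simp only [upMul, Prog.run, NExp.eval, RExp.eval, hso, putR_rarr, Function.update_apply,
      keyExp_eval, ← hS, hkey, hacc]
    by_cases hio : i = o
    · subst hio
      rw [if_pos rfl, if_pos (by omega), hI i hi, if_neg (by omega)]
    · rw [if_neg hio, hI i hi]
      by_cases hlt : i < o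
      · rw [if_pos hlt, if_pos (by omega)]
      · rw [if_neg hlt, if_neg (by omega)]
  · intro s' ha hI
    have hsel : s'.narr (aSel j) = s₂.narr (aSel j) := ha.na _ (by simp [upMul])
    refine ⟨fun i hi => ?_, fun i hi hlt => ?_⟩
    · rw [hI i hi, if_pos hi, (h₂ i hi).1]
    · rw [hsel]
      exact (h₂ i hi).2 (by rw [(h₂ i hi).1]; exact hlt)

def rootStep (U : Finset (Fin q.d)) (r : Fin q.m) : Prog U :=
  .cond (.rle (.arr (aWt U r) (.var vQ)) (.const 0)) .skip
    (.seq (.setR rCnt (.plus (.var rCnt) (.arr (aWt U r) (.var vQ)))) (.setN (vRow r) (.var vQ)))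

/-- Sum up the weights of all join results; if the sum is positive, find a join result of positive
weight. -/
noncomputable def query (U : Finset (Fin q.d)) (r : Fin q.m) : List (Fin q.m × Fin q.m) → Prog U
  | [] => .seq (.setR rCnt (.const 0)) (forN vQ (.size r) (rootStep U r))
  | (j, p) :: L => .seq (up U j p) <| .seq (query U r L)
    (.setN (vRow j) (.arr (aSel j) (edgeKey j p p (vRow p))))

theorem query_writes (r : Fin q.m) (L : List (Fin q.m × Fin q.m)) :
    ∀ l ∈ (query U r L).writes, l.kind ∈ Set.Icc 20 25 ∧
      ∀ j, (l = .na (aSel j) ∨ l = .nv (vRow j)) → j ∈ r :: L.map Prod.fst := by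
  have hf : ∀ a b : Fin q.m, (a : ℕ) = b ↔ b = a := fun a b =>
    ⟨fun h => (Fin.ext h).symm, fun h => by rw [h]⟩
  induction L with
  | nil =>
    intro l hl
    simp [query, rootStep] at hl
    rcases hl with rfl | rfl | rfl | rfl <;> simp [hf]
  | cons jp L ih =>
    obtain ⟨j, p⟩ := jp
    intro l hl
    simp only [query, Prog.writes, Set.mem_union, Set.mem_singleton_iff] at hl
    rcases hl with hl | hl | hl
    · rcases up_writes _ _ l hl with rfl | rfl | rfl | rfl <;> simp [hf]
    · refine ⟨(ih l hl).1, fun j' h => ?_⟩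
      have := (ih l hl).2 j' h
      simp at this ⊢
      tauto
    · subst hl
      simp [hf]

theorem Elim.mem_iff {S : Finset (Fin q.m)} {L r} (h : Elim q S L r) (j : Fin q.m) :
    j ∈ r :: L.map Prod.fst ↔ j ∈ S := by
  induction h with
  | root r => simp
  | step hj hp h hE ih => simp at ih ⊢; rw [← ih]; tauto

/-- On the way up the tree, `sum_families_insert` keeps the total weight. On the way back the row of
the parent is already fixed when a leaf is reached, and the row selected at its key extends the
partial result. -/
theorem query_runs {S : Finset (Fin q.m)} {L r} (hE : Elim q S L r) :
    ∃ c, ∀ (f : List (Pt U × ℝ) → List (Pt U)) (T : ℕ → ℕ) (D : Instance q) (N : ℕ),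
      (∀ j, (D.rows j).length ≤ N) → ∀ s : Store U, HasTables D s → Keyed D Finset.univ s →
      (∀ j ∈ S, ∀ i < (D.rows j).length, 0 ≤ s.rarr (aWt U j) i) →
      Runs f T (query U r L) s (c * (N + 1)) fun s' =>
        s'.rvar rCnt = ∑ ρ ∈ families D S, ∏ j ∈ S, s.rarr (aWt U j) (ρ j) ∧
        (0 < s'.rvar rCnt → (∀ j ∈ S, s'.nvar (vRow j) < (D.rows j).length ∧
          0 < s.rarr (aWt U j) (s'.nvar (vRow j))) ∧
          Consistent D S fun j => s'.nvar (vRow j)) := by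
  induction hE with
  | root r =>
    refine ⟨2 + (rootStep U r).time + 20, fun f T D N hN s hT hK hpos => ?_⟩
    refine Runs.mono (t := 2 + ((D.rows r).length * ((rootStep U r).time + 9) + 7)) ?_
      (by nlinarith [Nat.mul_le_mul_right ((rootStep U r).time + 9) (hN r)]) fun _ _ h => h
    refine Runs.seq (R := fun s' => s' = s.setR rCnt 0)
      ⟨_, _, .setR _ _ _, by simp [RExp.steps], by simp [RExp.eval]⟩ fun s₁ _ hs₁ => ?_
    subst hs₁
    have hsum : ∀ W : Fin q.m → ℕ → ℝ, ∑ ρ ∈ families D {r}, ∏ j ∈ {r}, W j (ρ j) =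
        ∑ i ∈ Finset.range (D.rows r).length, W r i := by
      intro W
      simp only [Finset.prod_singleton]
      refine Finset.sum_nbij' (fun ρ => ρ r) (fun i => Function.update 0 r i) ?_ ?_ ?_ ?_ ?_
      · intro ρ hρ
        simpa using (mem_families.1 hρ).1 r
      · intro i hi
        rw [mem_families]
        refine ⟨by simpa using hi, fun j hj => ?_, ?_⟩
        · simp at hj; simp [Function.update_of_ne hj]
        · intro j hj l hl a _ _
          simp at hj hl
          rw [hj, hl]
      · intro ρ hρ
        funext j
        by_cases hj : j = r
        · rw [hj]; simp
        · rw [Function.update_of_ne hj]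
          exact ((mem_families.1 hρ).2.1 j (by simpa using hj)).symm
      · simp
      · simp
    rw [hsum]
    refine runs_forN (fun o s' => s'.rvar rCnt = ∑ i ∈ Finset.range o, s.rarr (aWt U r) i ∧
      (0 < s'.rvar rCnt → s'.nvar (vRow r) < (D.rows r).length ∧
        0 < s.rarr (aWt U r) (s'.nvar (vRow r)))) _ (by simpa using hT.size r) (by simp)
      (by simp [rootStep]) (by simp [rootStep]) (by simp) (fun i s v h => by simpa using h) ?_ ?_
    · rintro o ho s' ha hso ⟨hI1, hI2⟩
      refine Prog.Flat.runs (by simp [rootStep]) ?_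
      have hwt : s'.rarr (aWt U r) = s.rarr (aWt U r) := by
        rw [ha.ra _ (by simp [rootStep])]; simp
      rw [Finset.sum_range_succ]
      by_cases hw : s.rarr (aWt U r) o ≤ 0
      · have hrun : (rootStep U r).run s' = s' := by
          simp [rootStep, Test.holds, RExp.eval, NExp.eval, hso, hwt, hw]
        have hw0 : s.rarr (aWt U r) o = 0 := le_antisymm hw (hpos r (by simp) o ho)
        rw [hrun, hw0, add_zero]
        exact ⟨hI1, hI2⟩
      · simp [rootStep, Test.holds, RExp.eval, NExp.eval, hso, hwt, hw, hI1, ho]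
        intro _
        exact not_le.1 hw
    · rintro s' ha ⟨hI1, hI2⟩
      refine ⟨hI1, fun h => ⟨?_, ?_⟩⟩
      · simpa using hI2 h
      · intro j hj l hl a _ _
        simp at hj hl
        rw [hj, hl]
  | @step S L r j p hj hp hrip hE ih =>
    classical
    have hjp : j ≠ p := fun h => hj (h ▸ hp)
    obtain ⟨c₁, hup⟩ := up_runs U j p hjp
    obtain ⟨c₂, hq⟩ := ih
    refine ⟨c₁ + c₂ + ((edgeKey j p p (vRow p)).steps + 2), fun f T D N hN s hT hK hpos => ?_⟩
    refine Runs.mono (t := c₁ * (N + 1) + (c₂ * (N + 1) + ((edgeKey j p p (vRow p)).steps + 2))) ?_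
      (by nlinarith) fun _ _ h => h
    refine (hup f T D N hN s hT hK (hpos j (by simp))).seq fun s₁ ha₁ ⟨h1, h2⟩ => ?_
    have hk₁ : ∀ l ∈ (up U j p).writes, l.kind ∈ Set.Icc 20 25 := by
      intro l hl
      rcases up_writes _ _ l hl with rfl | rfl | rfl | rfl <;> simp
    have hT₁ : HasTables D s₁ := hT.agree ha₁ fun l hl => by have := (hk₁ l hl).1; omega
    have hK₁ : Keyed D Finset.univ s₁ := hK.agree ha₁ fun l hl => by
      have := hk₁ l hl; simp at this ⊢; omega
    have hother : ∀ l ∈ S, l ≠ p → ∀ i < (D.rows l).length,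
        s₁.rarr (aWt U l) i = s.rarr (aWt U l) i := by
      intro l hl hlp i _
      rw [ha₁.ra _ fun hh => ?_]
      rcases up_writes _ _ _ hh with h | h | h | h <;> simp at h
      exact hlp (Fin.ext h)
    have hpos' : ∀ i, 0 ≤ ∑ i' ∈ (Finset.range (D.rows j).length).filter
        (fun i' => Matches D j p i' i), s.rarr (aWt U j) i' := fun i =>
      Finset.sum_nonneg fun i' hi' => hpos j (by simp) i' (by
        simp only [Finset.mem_filter, Finset.mem_range] at hi'; exact hi'.1)
    have hpos₁ : ∀ l ∈ S, ∀ i < (D.rows l).length, 0 ≤ s₁.rarr (aWt U l) i := by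
      intro l hl i hi
      by_cases hlp : l = p
      · subst hlp
        rw [h1 i hi]
        exact mul_nonneg (hpos l (by simp [hp]) i hi) (hpos' i)
      · rw [hother l hl hlp i hi]
        exact hpos l (by simp [hl]) i hi
    refine (hq f T D N hN s₁ hT₁ hK₁ hpos₁).seq fun s₂ ha₂ ⟨h3, h4⟩ => ?_
    refine ⟨_, _, .setN _ _ _, by simp [NExp.steps], ?_⟩
    have hsum := sum_families_insert (D := D) hj hp hrip (fun l => s.rarr (aWt U l))
      (fun l => s₁.rarr (aWt U l)) hother h1
    rw [hsum]
    simp only [setN_rvar]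
    refine ⟨h3, fun hlt => ?_⟩
    obtain ⟨h5, h6⟩ := h4 hlt
    have hrow : ∀ l ∈ S, (s₂.setN (vRow j) ((NExp.arr (aSel j) (edgeKey j p p (vRow p))).eval s₂)).nvar
        (vRow l) = s₂.nvar (vRow l) := by
      intro l hl
      refine setN_nvar_ne _ _ _ _ ?_
      simp only [ne_eq, NVar.tmp.injEq, nm_inj, true_and, and_true]
      intro h
      exact hj (Fin.ext h ▸ hl)
    obtain ⟨h7, h8⟩ := h5 p hp
    rw [h1 _ h7] at h8
    have hp0 : 0 ≤ s.rarr (aWt U p) (s₂.nvar (vRow p)) := hpos p (by simp [hp]) _ h7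
    -- The updated weight of the parent's row is its old weight times the total weight of its
    -- partners. Positivity of the product gives the first for the parent and the second for the
    -- leaf.
    obtain ⟨h9, h10⟩ : 0 < s.rarr (aWt U p) (s₂.nvar (vRow p)) ∧
        0 < ∑ i' ∈ (Finset.range (D.rows j).length).filter
          (fun i' => Matches D j p i' (s₂.nvar (vRow p))), s.rarr (aWt U j) i' := by
      rcases hp0.lt_or_eq with h | h
      · exact ⟨h, pos_of_mul_pos_right h8 hp0⟩
      · rw [← h] at h8; simp at h8
    obtain ⟨i', hi', hsel, hm, hw⟩ := h2 _ h7 h10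
    have hval : (NExp.arr (aSel j) (edgeKey j p p (vRow p))).eval s₂ = i' := by
      simp only [NExp.eval, keyExp_eval]
      -- The recursive query treats only relations of `S`, hence leaves the selection of the
      -- eliminated leaf `j` intact.
      have e1 : s₂.narr (aSel j) = s₁.narr (aSel j) := ha₂.na _ fun hh => by
        have := (query_writes _ _ _ hh).2 j (.inl rfl)
        rw [hE.mem_iff] at this
        exact hj this
      rw [keyv_agree ha₂ (fun l hl => ?_), keyv_agree ha₁ (fun l hl => ?_), e1, hsel]
      · have := hk₁ l hl; simp at this; omega
      · have := (query_writes _ _ l hl).1; simp at this; omega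
    rw [hval] at hrow ⊢
    refine ⟨fun l hl => ?_, ?_⟩
    · rcases Finset.mem_insert.1 hl with rfl | hl
      · simpa using ⟨hi', hw⟩
      · rw [hrow l hl]
        refine ⟨(h5 l hl).1, ?_⟩
        by_cases hlp : l = p
        · rw [hlp]; exact h9
        · rw [← hother l hl hlp _ (h5 l hl).1]; exact (h5 l hl).2
    · rw [consistent_insert hj hp hrip]
      refine ⟨fun l hl l' hl' a ha ha' => ?_, ?_⟩
      · simp only [hrow l hl, hrow l' hl']
        exact h6 l hl l' hl' a ha ha'
      · simpa [hrow p hp] using hm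

/-- Set the weights of the rows of all tables to `1` or `0`, depending on a test of the row
`vQ`. -/
def initWeights (b : Fin q.m → Test U) : Prog U :=
  seqAll (List.finRange q.m) fun j => forN vQ (.size j)
    (.cond (b j) (.putR (aWt U j) (.var vQ) (.const 1)) (.putR (aWt U j) (.var vQ) (.const 0)))

theorem initWeights_kind (b : Fin q.m → Test U) :
    ∀ l ∈ (initWeights b).writes, l.kind ∈ Set.Icc 20 25 := by
  intro l hl
  obtain ⟨j, -, hj⟩ := mem_seqAll_writes.1 hl
  simp at hj
  rcases hj with rfl | rfl <;> simp

open scoped Classical in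
theorem initWeights_runs (b : Fin q.m → Test U) :
    ∃ c, ∀ (f : List (Pt U × ℝ) → List (Pt U)) (T : ℕ → ℕ) (D : Instance q) (N : ℕ),
      (∀ j, (D.rows j).length ≤ N) → ∀ s : Store U, HasTables D s →
      ∀ φ : Fin q.m → ℕ → Prop,
      (∀ j s', Agree {l | l.kind ∈ Set.Icc 20 25} s s' → s'.nvar vQ < (D.rows j).length →
        ((b j).holds s' ↔ φ j (s'.nvar vQ))) →
      Runs f T (initWeights b) s (c * (N + 1)) fun s' =>
        ∀ j, ∀ i < (D.rows j).length, s'.rarr (aWt U j) i = if φ j i then 1 else 0 := by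
  obtain ⟨c, hc⟩ : ∃ c, ∀ j, (b j).steps ≤ c :=
    ⟨∑ j, (b j).steps, fun j => Finset.single_le_sum (f := fun j => (b j).steps)
      (fun _ _ => Nat.zero_le _) (Finset.mem_univ j)⟩
  refine ⟨q.m * (c + 30) + 1, fun f T D N hN s hT φ hφ => ?_⟩
  refine Runs.mono (t := (List.finRange q.m).length * (N * ((c + 7) + 9) + 7) + 1) ?_
    (by simp; nlinarith [Nat.zero_le (q.m * N)]) fun _ _ h => h
  refine runs_seqAll (fun l s' => ∀ j ∈ l, ∀ i < (D.rows j).length, s'.rarr (aWt U j) i =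
    if φ j i then 1 else 0) (by simp) ?_ (fun s' _ h j => h j (List.mem_finRange j))
  intro l₁ j l₂ hl s₁ ha₁ hI
  replace ha₁ : Agree {l | l.kind ∈ Set.Icc 20 25} s s₁ := ha₁.mono (initWeights_kind b)
  have hj : j ∉ l₁ := by
    have := List.nodup_finRange q.m
    rw [hl, List.nodup_append] at this
    intro h
    exact this.2.2 j h j (by simp) rfl
  refine Runs.mono (t := (D.rows j).length * ((c + 7) + 9) + 7) ?_
    (by have := Nat.mul_le_mul_right (c + 7 + 9) (hN j); omega) fun _ _ h => h
  refine runs_forN (fun o s' => ∀ i < o, s'.rarr (aWt U j) i = if φ j i then 1 else 0) _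
    ((ha₁.nv _ (by simp)).trans (hT.size j)) (by simp) (by simp) (by simp) (by simp)
    (fun _ _ _ h => h) ?_ ?_
  · intro o ho s' ha hso hI'
    have ha' := ha₁.trans (ha.mono (W' := {l | l.kind ∈ Set.Icc 20 25}) (by
      intro l hl; simp at hl; rcases hl with rfl | rfl <;> simp))
    have hb := hφ j s' ha' (by rw [hso]; exact ho)
    refine Prog.Flat.runs_le (p := .cond (b j) (.putR (aWt U j) (.var vQ) (.const 1))
      (.putR (aWt U j) (.var vQ) (.const 0))) (by simp) ?_ ?_
    · have := hc j
      simp [Prog.time, NExp.steps, RExp.steps]; omega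
    · intro i hi
      simp only [Prog.run, hb, hso, NExp.eval, RExp.eval]
      by_cases hio : i = o
      · subst hio
        split_ifs <;> simp
      · have := hI' i (by omega)
        split_ifs at this ⊢ <;> simp [hio, this]
  · intro s' ha hI' j' hj' i hi
    rcases List.mem_append.1 hj' with hj' | hj'
    · rw [ha.ra _ ?_]
      · exact hI j' hj' i hi
      · simp
        intro h
        exact hj (Fin.ext h ▸ hj')
    · obtain rfl : j' = j := by simpa using hj'
      exact hI' i hi

end Query

/-! ### Counting queries and the geometric progression of levels -/

section Levels
variable {q : JoinQuery} {U : Finset (Fin q.d)}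
variable {f : List (Pt U × ℝ) → List (Pt U)} {T : ℕ → ℕ}

/-- Count the join results for which all tests hold. -/
noncomputable def countQuery (b : Fin q.m → Test U) (L : List (Fin q.m × Fin q.m)) (r : Fin q.m) :
    Prog U := .seq (initWeights b) (query U r L)

theorem countQuery_kind (b : Fin q.m → Test U) (L : List (Fin q.m × Fin q.m)) (r : Fin q.m) :
    ∀ l ∈ (countQuery b L r).writes, l.kind ∈ Set.Icc 20 25 := by
  intro l hl
  rcases hl with hl | hl
  · exact initWeights_kind b l hl
  · exact (query_writes r L l hl).1

open scoped Classical in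
/-- The join results whose attributes in `A` satisfy `ψ`. -/
noncomputable def resultsWith (D : Instance q) (A : Finset (Fin q.d)) (ψ : Fin q.d → ℝ → Prop) :
    Finset (Fin q.d → ℝ) :=
  (joinSet_finite D).toFinset.filter fun t => ∀ a ∈ A, ψ a (t a)

/-- Weights 0 and 1 turn the sum over join results into a count. Each table tests only its own
attributes; since these cover everything, a result of positive weight passes all tests. -/
theorem countQuery_runs {L r} (hE : Elim q Finset.univ L r) (b : Fin q.m → Test U) :
    ∃ c, ∀ (f : List (Pt U × ℝ) → List (Pt U)) (T : ℕ → ℕ) (D : Instance q) (N : ℕ),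
      (∀ j, (D.rows j).length ≤ N) → ∀ s : Store U, HasTables D s → Keyed D Finset.univ s →
      ∀ (A : Finset (Fin q.d)) (ψ : Fin q.d → ℝ → Prop),
      (∀ j s', Agree {l | l.kind ∈ Set.Icc 20 25} s s' → s'.nvar vQ < (D.rows j).length →
        ((b j).holds s' ↔ ∀ a ∈ A, a ∈ q.attr j → ψ a (D.val j (s'.nvar vQ) a))) →
      Runs f T (countQuery b L r) s (c * (N + 1)) fun s' =>
        s'.rvar rCnt = (resultsWith D A ψ).card ∧
        (0 < s'.rvar rCnt → ∃ t ∈ resultsWith D A ψ, ∀ j, ∀ a ∈ q.attr j,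
          s'.nvar (vRow j) < (D.rows j).length ∧ D.val j (s'.nvar (vRow j)) a = t a) := by
  classical
  obtain ⟨c₁, h₁⟩ := initWeights_runs b
  obtain ⟨c₂, h₂⟩ := query_runs (U := U) hE
  refine ⟨c₁ + c₂, fun f T D N hN s hT hK A ψ hb => ?_⟩
  rw [add_mul]
  refine (h₁ f T D N hN s hT (fun j i => ∀ a ∈ A, a ∈ q.attr j → ψ a (D.val j i a)) hb).seq fun s₁ ha₁ hs₁ => ?_
  have hk := initWeights_kind b
  have hT₁ : HasTables D s₁ := hT.agree ha₁ fun l hl => by have := (hk l hl).1; omega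
  have hK₁ : Keyed D Finset.univ s₁ := hK.agree ha₁ fun l hl => by
    have := hk l hl; simp at this ⊢; omega
  refine (h₂ f T D N hN s₁ hT₁ hK₁ fun j _ i hi => ?_).mono le_rfl fun s₂ _ ⟨h3, h4⟩ => ?_
  · rw [hs₁ j i hi]; split_ifs <;> simp
  constructor
  · rw [h3, resultsWith, ← card_families]
    refine Finset.sum_congr rfl fun ρ hρ => Finset.prod_congr rfl fun j _ => ?_
    rw [hs₁ j _ ((mem_families.1 hρ).1 j (by simp))]
    congr
  · intro hlt
    obtain ⟨h5, h6⟩ := h4 hlt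
    set ρ : Fin q.m → ℕ := fun j => if (D.rows j).length = 0 then 0 else s₂.nvar (vRow j) with hρ
    have hρe : ρ = fun j => s₂.nvar (vRow j) := by
      funext j
      have := (h5 j (by simp)).1
      simp only [hρ]; rw [if_neg (by omega)]
    have hmem : ρ ∈ families D Finset.univ := by
      rw [hρe, mem_families]
      exact ⟨fun j _ => (h5 j (by simp)).1, by simp, h6⟩
    refine ⟨familyTuple D ρ, ?_, ?_⟩
    · rw [resultsWith, Finset.mem_filter, Set.Finite.mem_toFinset]
      refine ⟨familyTuple_mem hmem, fun a ha => ?_⟩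
      obtain ⟨j, hj⟩ := q.cover a
      rw [familyTuple_eq (by rw [hρe]; exact h6) hj, hρe]
      obtain ⟨h7, h8⟩ := h5 j (by simp)
      rw [hs₁ j _ h7] at h8
      by_contra hcon
      rw [if_neg fun h => hcon (h a ha hj)] at h8
      exact lt_irrefl _ h8
    · intro j a ha
      refine ⟨(h5 j (by simp)).1, ?_⟩
      rw [familyTuple_eq (by rw [hρe]; exact h6) ha, hρe]

abbrev rDelta : RVar := .tmp (nm 30 0 0)
abbrev rScale : RVar := .tmp (nm 31 0 0)
abbrev aY (U : Finset (Fin q.d)) : RArr U := .tmp (nm 32 0 0)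
abbrev vJn : NVar q := .tmp (nm 32 1 0)
abbrev rY : RVar := .tmp (nm 32 2 0)

/-- The distances from the centers at which the space is cut: `0`, and a geometric progression
up to `r`. -/
def makeLevels (U : Finset (Fin q.d)) : Prog U :=
  .seq (.setR rDelta (.over (.var .eps) (.times (.const (32 * (U.card + 2)))
    (.plus (.const 1) (.times (.var .alpha) (.var .alpha)))))) <|
  .seq (.setR rScale (.over (.var .r) (.var rCnt))) <|
  .seq (.putR (aY U) (.const 0) (.const 0)) <| .seq (.setN vJn (.const 1)) <|
  .seq (.setR rY (.times (.var rDelta) (.var rScale))) <|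
  .seq (.loop (.neg (.rle (.var .r) (.var rY)))
    (.seq (.putR (aY U) (.var vJn) (.var rY)) <| .seq (.setN vJn (.plus (.var vJn) (.const 1)))
      (.setR rY (.times (.var rY) (.plus (.const 1) (.var rDelta)))))) <|
  .seq (.putR (aY U) (.var vJn) (.var rY)) (.setN vJn (.plus (.var vJn) (.const 1)))

theorem makeLevels_kind : ∀ l ∈ (makeLevels U).writes, l.kind ∈ Set.Icc 30 32 := by
  simp [makeLevels]

/-- The precision of the partition of the space. -/
noncomputable def precision (d : ℕ) (ε α : ℝ) : ℝ := ε / (32 * (d + 2) * (1 + α * α))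

/-- `B` is not known to the program, which just continues until a level reaches `r`; it enters the
analysis as a number of rounds that suffices by `hB`. For an empty join the scale is a division by
zero, hence 0. -/
theorem makeLevels_runs (s : Store U) {δ sc : ℝ}
    (hδ : δ = precision U.card (s.rvar .eps) (s.rvar .alpha))
    (hsc : sc = s.rvar .r / s.rvar rCnt) {B : ℕ} (hB : s.rvar .r ≤ δ * sc * (1 + δ) ^ B) :
    Runs f T (makeLevels U) s (40 * (B + 1)) fun s' =>
      s'.rvar rDelta = δ ∧ s'.rvar rScale = sc ∧ s'.nvar vJn ≤ B + 2 ∧ s'.rarr (aY U) 0 = 0 ∧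
      ∃ J, s'.nvar vJn = J + 2 ∧ s.rvar .r ≤ s'.rarr (aY U) (J + 1) ∧
        ∀ l ≤ J, s'.rarr (aY U) (l + 1) = δ * sc * (1 + δ) ^ l := by
  set p₀ : Prog U := .seq (.setR rDelta (.over (.var .eps) (.times (.const (32 * (U.card + 2)))
    (.plus (.const 1) (.times (.var .alpha) (.var .alpha)))))) <|
    .seq (.setR rScale (.over (.var .r) (.var rCnt))) <|
    .seq (.putR (aY U) (.const 0) (.const 0)) <| .seq (.setN vJn (.const 1))
    (.setR rY (.times (.var rDelta) (.var rScale))) with hp₀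
  have h₀ : Runs f T p₀ s 24 fun s' => s'.rvar rDelta = δ ∧ s'.rvar rScale = sc ∧
      s'.rvar rY = δ * sc ∧ s'.nvar vJn = 1 ∧ s'.rarr (aY U) 0 = 0 := by
    refine Prog.Flat.runs_le (by simp [hp₀])
      (by simp [hp₀, Prog.time, RExp.steps, NExp.steps]) ?_
    have e : s.rvar .eps / (32 * (↑U.card + 2) * (1 + s.rvar .alpha * s.rvar .alpha)) = δ := by
      rw [hδ, precision]
    simp [hp₀, RExp.eval, NExp.eval, e, ← hsc]
  -- Sequences associate to the right; regrouping makes the initialization one flat program.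
  have hshift : ∀ {p₁ p₂ p₃ p₄ p₅ p₆ : Prog U} {t : ℕ} {Q : Store U → Prop},
      Runs f T (.seq (.seq p₁ <| .seq p₂ <| .seq p₃ <| .seq p₄ p₅) p₆) s t Q →
      Runs f T (.seq p₁ <| .seq p₂ <| .seq p₃ <| .seq p₄ <| .seq p₅ p₆) s t Q := by
    rintro p₁ p₂ p₃ p₄ p₅ p₆ t Q ⟨s', t', he, ht, hQ⟩
    cases he with
    | seq ha hb => cases ha with
      | seq h1 ha => cases ha with
        | seq h2 ha => cases ha with
          | seq h3 ha => cases ha with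
            | seq h4 h5 => exact ⟨_, _, .seq h1 (.seq h2 (.seq h3 (.seq h4 (.seq h5 hb)))),
                by omega, hQ⟩
  refine hshift (Runs.mono (t := 24 + ((B * (14 + 4 + 1) + 4 + 1) + (3 + 4))) ?_ (by omega)
    fun _ _ h => h)
  refine h₀.seq fun s₁ ha₁ ⟨h1, h2, h3, h4, h5⟩ => ?_
  have hr₁ : s₁.rvar .r = s.rvar .r := ha₁.rv _ (by simp [hp₀])
  refine Runs.seq (R := fun s' => s'.rvar rDelta = δ ∧ s'.rvar rScale = sc ∧ s'.rarr (aY U) 0 = 0 ∧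
      ∃ l ≤ B, s'.nvar vJn = l + 1 ∧ s'.rvar rY = δ * sc * (1 + δ) ^ l ∧ s.rvar .r ≤ s'.rvar rY ∧
      ∀ i < l, s'.rarr (aY U) (i + 1) = δ * sc * (1 + δ) ^ i) ?_ ?_
  · refine runs_loop (b := .neg (.rle (.var .r) (.var rY))) (c := 14)
      (fun n s' => s'.rvar rDelta = δ ∧ s'.rarr (aY U) 0 = 0 ∧
      ∃ l, l + n = B ∧ s'.nvar vJn = l + 1 ∧ s'.rvar rY = δ * sc * (1 + δ) ^ l ∧
      ∀ i < l, s'.rarr (aY U) (i + 1) = δ * sc * (1 + δ) ^ i) B ?_ ?_ ?_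
    · exact ⟨h1, h5, 0, by simp, by simpa using h4, by simpa using h3, by simp⟩
    · rintro n s' ha ⟨e1, e3, l, hl, e4, e5, e6⟩ hb
      have hr : s'.rvar .r = s.rvar .r := (ha.rv _ (by simp)).trans hr₁
      simp only [Test.holds, RExp.eval, hr, not_le] at hb
      cases n with
      | zero =>
        rw [e5, show l = B by omega] at hb
        exact absurd hB (not_le.2 hb)
      | succ n =>
        refine ⟨n, rfl, Prog.Flat.runs_le (by simp)
          (by simp [Prog.time, RExp.steps, NExp.steps]) ?_⟩
        simp [RExp.eval, NExp.eval, e1, e4, e5, e3]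
        refine ⟨by omega, by ring, fun i hi => ?_⟩
        rw [Function.update_apply]
        split_ifs with h
        · rw [show i = l by omega]
        · exact e6 i (by omega)
    · rintro n s' ha ⟨e1, e3, l, hl, e4, e5, e6⟩ hb
      have hr : s'.rvar .r = s.rvar .r := (ha.rv _ (by simp)).trans hr₁
      simp only [Test.holds, RExp.eval, hr, not_le, not_lt] at hb
      exact ⟨e1, (ha.rv _ (by simp)).trans h2, e3, l, by omega, e4, e5, hb, e6⟩
  · rintro s₂ ha₂ ⟨e1, e2, e3, l, hl, e4, e5, e6, e7⟩
    refine Prog.Flat.runs_le (by simp) (by simp [Prog.time, RExp.steps, NExp.steps]) ?_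
    simp [RExp.eval, NExp.eval, e1, e2, e3, e4, hl]
    refine ⟨e6, fun i hi => ?_⟩
    rw [Function.update_apply]
    split_ifs with h
    · rw [e5, show i = l by omega]
    · exact e7 i (by omega)

end Levels

/-! ### Numbering the cells of every axis -/

section Cells
variable {q : JoinQuery} {U : Finset (Fin q.d)}
variable {f : List (Pt U × ℝ) → List (Pt U)} {T : ℕ → ℕ}

/-- The number of the cuts `c x - y l` and `c x + y l` below the value `v`. -/
noncomputable def cellIdx (c y : ℕ → ℝ) (n J : ℕ) (v : ℝ) : ℕ :=
  ∑ x ∈ Finset.range n, ∑ l ∈ Finset.range J,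
    ((if c x - y l ≤ v then 1 else 0) + if c x + y l < v then 1 else 0)

theorem cellIdx_le (c y : ℕ → ℝ) (n J : ℕ) (v : ℝ) : cellIdx c y n J v ≤ n * (J + J) := by
  have h : ∀ x ∈ Finset.range n, ∑ l ∈ Finset.range J,
      ((if c x - y l ≤ v then 1 else 0) + if c x + y l < v then 1 else 0) ≤ J + J := by
    intro x _
    refine (Finset.sum_le_card_nsmul _ _ 2 fun l _ => ?_).trans (by simp; omega)
    split_ifs <;> omega
  refine (Finset.sum_le_card_nsmul _ _ _ h).trans_eq ?_
  simp

/-- Every summand is monotone in the value, so equal sums force equal summands. Counting the cuts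
below a value therefore names its cell, with comparisons only and without rounding. -/
theorem cellIdx_eq {c y : ℕ → ℝ} {n J : ℕ} {v v' : ℝ} (h : cellIdx c y n J v = cellIdx c y n J v')
    {x l : ℕ} (hx : x < n) (hl : l < J) :
    (c x - y l ≤ v ↔ c x - y l ≤ v') ∧ (c x + y l < v ↔ c x + y l < v') := by
  wlog hv : v ≤ v' generalizing v v'
  · obtain ⟨h1, h2⟩ := this h.symm (not_le.1 hv).le
    exact ⟨h1.symm, h2.symm⟩
  have h1 : ∀ x l, (if c x - y l ≤ v then 1 else 0) ≤ if c x - y l ≤ v' then 1 else 0 := by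
    intro x l
    split_ifs with h1 h2
    · exact le_rfl
    · exact absurd (h1.trans hv) h2
    · omega
    · omega
  have h2 : ∀ x l, (if c x + y l < v then 1 else 0) ≤ if c x + y l < v' then 1 else 0 := by
    intro x l
    split_ifs with h1 h2
    · exact le_rfl
    · exact absurd (h1.trans_le hv) h2
    · omega
    · omega
  have e1 := (Finset.sum_eq_sum_iff_of_le fun x _ => Finset.sum_le_sum fun l _ =>
    add_le_add (h1 x l) (h2 x l)).1 h x (Finset.mem_range.2 hx)
  have e2 := (Finset.sum_eq_sum_iff_of_le fun l _ => add_le_add (h1 x l) (h2 x l)).1 e1 l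
    (Finset.mem_range.2 hl)
  have a1 := h1 x l
  have a2 := h2 x l
  refine ⟨⟨fun h => h.trans hv, fun h => ?_⟩, ⟨fun h => h.trans_le hv, fun h => ?_⟩⟩
  · by_contra hc
    rw [if_neg hc, if_pos h] at e2
    omega
  · by_contra hc
    rw [if_neg hc, if_pos h] at e2
    omega

abbrev aIdx (j : Fin q.m) (a : Fin q.d) : ℕ := nm 35 j a
abbrev vX : NVar q := .tmp (nm 36 0 0)
abbrev vLv : NVar q := .tmp (nm 36 1 0)
abbrev vC : NVar q := .tmp (nm 36 2 0)
abbrev vR : NVar q := .tmp (nm 36 3 0)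
abbrev vM : NVar q := .tmp (nm 37 0 0)

def cutStep (j : Fin q.m) (a : {a // a ∈ U}) (h : a.1 ∈ q.attr j) : Prog U :=
  .seq (.cond (.rle (.minus (.arr (.center a) (.var vX)) (.arr (aY U) (.var vLv)))
      (.arr (.table j ⟨a, h⟩) (.var vR))) (.setN vC (.plus (.var vC) (.const 1))) .skip)
    (.cond (.rle (.arr (.table j ⟨a, h⟩) (.var vR))
      (.plus (.arr (.center a) (.var vX)) (.arr (aY U) (.var vLv)))) .skip
      (.setN vC (.plus (.var vC) (.const 1))))

def cellTable (j : Fin q.m) (a : {a // a ∈ U}) (h : a.1 ∈ q.attr j) : Prog U :=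
  forN vR (.size j) <| .seq (.setN vC (.const 0)) <|
    .seq (forN vX .numX (forN vLv vJn (cutStep j a h))) (.putN (aIdx j a) (.var vR) (.var vC))

theorem cellTable_runs (j : Fin q.m) (a : {a // a ∈ U}) (h : a.1 ∈ q.attr j) (D : Instance q)
    (s : Store U) (hT : HasTables D s) :
    Runs f T (cellTable j a h) s
      (50 * ((D.rows j).length + 1) * (s.nvar .numX + 1) * (s.nvar vJn + 1)) fun s' =>
        ∀ i < (D.rows j).length, s'.narr (aIdx j a) i =
          cellIdx (s.rarr (.center a)) (s.rarr (aY U)) (s.nvar .numX) (s.nvar vJn)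
            (D.val j i a) := by
  set n := s.nvar .numX with hn
  set J := s.nvar vJn with hJ
  set W : Set (Loc U) := {.nv vR, .nv vC, .nv vX, .nv vLv, .na (aIdx j a)} with hW
  have hw : (cellTable j a h).writes = W := by
    ext l; simp [cellTable, cutStep, hW]; tauto
  refine Runs.mono (t := (D.rows j).length * ((2 + ((n * ((J * (28 + 9) + 7) + 9) + 7) + 3)) + 9) + 7)
    ?_ ?_ fun _ _ h => h
  rotate_left
  · nlinarith [Nat.zero_le ((D.rows j).length * n * J), Nat.zero_le ((D.rows j).length * n),
      Nat.zero_le ((D.rows j).length * J), Nat.zero_le (n * J)]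
  refine runs_forN (fun o s' => ∀ i < o, s'.narr (aIdx j a) i =
    cellIdx (s.rarr (.center a)) (s.rarr (aY U)) n J (D.val j i a)) _ (hT.size j) (by simp)
    (by simp [cutStep]) (by simp [cutStep]) (by simp) (fun _ _ _ h => h) ?_ (fun _ _ h => h)
  intro o ho s₁ ha₁ hso hI
  replace ha₁ : Agree W s s₁ := by
    rw [← hw, cellTable, forN_writes]; exact ha₁
  refine Runs.seq (R := fun s' => s' = s₁.setN vC 0) ⟨_, _, .setN _ _ _, by simp [NExp.steps],
    by simp [NExp.eval]⟩ fun s₂ _ hs₂ => ?_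
  have ha₂ : Agree W s s₂ := by
    rw [hs₂]; exact ha₁.trans ((agree_setN _ _ _).mono (by simp [hW]))
  have hv₂ : s₂.nvar vR = o := by rw [hs₂]; simpa using hso
  have hi₂ : s₂.narr = s₁.narr := by rw [hs₂]; rfl
  refine Runs.seq (R := fun s' => s'.nvar vR = o ∧ s'.narr = s₁.narr ∧
      s'.nvar vC = cellIdx (s.rarr (.center a)) (s.rarr (aY U)) n J (D.val j o a)) ?_ ?_
  · refine runs_forN (fun x s' => s'.nvar vC =
      cellIdx (s.rarr (.center a)) (s.rarr (aY U)) x J (D.val j o a)) n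
      (ha₂.nv _ (by simp [hW])) (by simp) (by simp [cutStep]) (by simp [cutStep])
      (by simp [hs₂, cellIdx]) (fun i s v h => by simpa using h) ?_ ?_
    · intro x hx s₃ ha₃ hsx hIx
      have ha₃' : Agree W s s₃ := ha₂.trans (ha₃.mono (by
        intro l; simp [cutStep, hW]; tauto))
      have hv₃ : s₃.nvar vR = o := (ha₃.nv _ (by simp [cutStep])).trans hv₂
      refine runs_forN (fun l s' => s'.nvar vC =
        cellIdx (s.rarr (.center a)) (s.rarr (aY U)) x J (D.val j o a) +
        ∑ l ∈ Finset.range l, ((if s.rarr (.center a) x - s.rarr (aY U) l ≤ D.val j o a then 1 else 0) +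
          if s.rarr (.center a) x + s.rarr (aY U) l < D.val j o a then 1 else 0)) J
        (ha₃'.nv _ (by simp [hW])) (by simp) (by simp [cutStep]) (by simp [cutStep])
        (by simpa using hIx) (fun i s v h => by simpa using h) ?_ ?_
      · intro l hl s₄ ha₄ hsl hIl
        have ha₄' : Agree W s s₄ := ha₃'.trans (ha₄.mono (by
          intro l; simp [cutStep, hW]; tauto))
        have hv₄ : s₄.nvar vR = o := (ha₄.nv _ (by simp [cutStep])).trans hv₃
        have hx₄ : s₄.nvar vX = x := (ha₄.nv _ (by simp [cutStep])).trans hsx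
        have e1 : s₄.rarr (.center a) = s.rarr (.center a) := ha₄'.ra _ (by simp [hW])
        have e2 : s₄.rarr (aY U) = s.rarr (aY U) := ha₄'.ra _ (by simp [hW])
        have e3 : s₄.rarr (.table j ⟨a, h⟩) o = D.val j o a := by
          rw [ha₄'.ra _ (by simp [hW]), hT.table j a h o ho]
        refine Prog.Flat.runs_le (by simp [cutStep])
          (by simp [cutStep, Prog.time, RExp.steps, NExp.steps, Test.steps]) ?_
        rw [Finset.sum_range_succ, ← add_assoc, ← hIl]
        by_cases c1 : s.rarr (.center a) x - s.rarr (aY U) l ≤ D.val j o a <;>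
        rcases lt_or_ge (s.rarr (.center a) x + s.rarr (aY U) l) (D.val j o a) with c2 | c2
        · simp [cutStep, Test.holds, RExp.eval, NExp.eval, hv₄, hx₄, hsl, e1, e2, e3, c1, c2,
            not_le.2 c2, -tsub_le_iff_right]
        · simp [cutStep, Test.holds, RExp.eval, NExp.eval, hv₄, hx₄, hsl, e1, e2, e3, c1, c2,
            not_lt.2 c2, -tsub_le_iff_right]
        · simp [cutStep, Test.holds, RExp.eval, NExp.eval, hv₄, hx₄, hsl, e1, e2, e3, c1, c2,
            not_le.2 c2, -tsub_le_iff_right]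
        · simp [cutStep, Test.holds, RExp.eval, NExp.eval, hv₄, hx₄, hsl, e1, e2, e3, c1, c2,
            not_lt.2 c2, -tsub_le_iff_right]
      · intro s' ha' hI'
        simp only [hI', cellIdx, Finset.sum_range_succ _ x]
    · intro s' ha' hI'
      refine ⟨(ha'.nv _ (by simp [cutStep])).trans hv₂, ?_, hI'⟩
      rw [← hi₂]
      funext b
      exact ha'.na _ (by simp [cutStep])
  · rintro s₃ - ⟨h1, h2, h3⟩
    refine ⟨_, _, .putN _ _ _ _, by simp [NExp.steps], ?_⟩
    intro i hi
    simp only [NExp.eval, h1, h2, h3, putN_narr, Function.update_apply]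
    split_ifs with hio
    · rw [hio]
    · exact hI i (by omega)

/-- Compute the cells of all values of the attributes in `U`, and a bound for their number. -/
noncomputable def makeCells (U : Finset (Fin q.d)) : Prog U :=
  .seq (seqAll (Finset.univ : Finset (Fin q.m × {a // a ∈ U})).toList fun p =>
      if h : p.2.1 ∈ q.attr p.1 then cellTable p.1 p.2 h else .skip) <|
    .seq (.setN vM (.const 1)) (forN vX .numX (.setN vM (.plus (.var vM) (.plus (.var vJn) (.var vJn)))))

theorem cellTable_writes (j : Fin q.m) (a : {a // a ∈ U}) (h : a.1 ∈ q.attr j) :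
    ∀ l ∈ (cellTable j a h).writes, l = .na (aIdx j a) ∨ l.kind = 36 := by
  intro l hl
  simp [cellTable, cutStep] at hl
  rcases hl with rfl | rfl | rfl | rfl | rfl <;> simp

theorem makeCells_kind : ∀ l ∈ (makeCells U).writes, l.kind ∈ Set.Icc 35 37 := by
  intro l hl
  simp only [makeCells, Prog.writes, forN_writes, Set.mem_union, mem_seqAll_writes] at hl
  rcases hl with ⟨p, -, hp⟩ | hl
  · split_ifs at hp with h
    · rcases cellTable_writes _ _ _ _ hp with rfl | h <;> simp [*]
    · simp at hp
  · simp at hl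
    rcases hl with rfl | rfl | rfl <;> simp

theorem makeCells_runs (D : Instance q) {N : ℕ} (hN : ∀ j, (D.rows j).length ≤ N) (s : Store U)
    (hT : HasTables D s) :
    Runs f T (makeCells U) s (60 * (q.m * U.card + 1) * ((N + 1) * (s.nvar .numX + 1) *
      (s.nvar vJn + 1))) fun s' =>
      s'.nvar vM = s.nvar .numX * (s.nvar vJn + s.nvar vJn) + 1 ∧
      ∀ j (a : {a // a ∈ U}), a.1 ∈ q.attr j → ∀ i < (D.rows j).length, s'.narr (aIdx j a) i =
          cellIdx (s.rarr (.center a)) (s.rarr (aY U)) (s.nvar .numX) (s.nvar vJn)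
            (D.val j i a) := by
  set n := s.nvar .numX with hn
  set J := s.nvar vJn with hJ
  set c := (N + 1) * (n + 1) * (J + 1) with hc
  refine Runs.mono (t := ((Finset.univ : Finset (Fin q.m × {a // a ∈ U})).toList.length *
    (50 * c) + 1) + (2 + (n * (6 + 9) + 7))) ?_ ?_ fun _ _ h => h
  rotate_left
  · have h1 : (Finset.univ : Finset (Fin q.m × {a // a ∈ U})).toList.length = q.m * U.card := by
      simp
    have h2 : n + 1 ≤ c := by
      rw [hc]; nlinarith [Nat.zero_le (N * n * J), Nat.zero_le (N * n), Nat.zero_le (N * J),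
        Nat.zero_le (n * J)]
    rw [h1]
    nlinarith [Nat.zero_le (q.m * U.card * c)]
  have hkind : ∀ (p : Fin q.m × {a // a ∈ U}), ∀ l ∈ (if h : p.2.1 ∈ q.attr p.1 then
      cellTable p.1 p.2 h else (.skip : Prog U)).writes, l = .na (aIdx p.1 p.2) ∨ l.kind = 36 := by
    intro p l hl
    split_ifs at hl with h
    · exact cellTable_writes _ _ _ _ hl
    · simp at hl
  have hkind' : ∀ l ∈ (seqAll (Finset.univ : Finset (Fin q.m × {a // a ∈ U})).toList fun p =>
      if h : p.2.1 ∈ q.attr p.1 then cellTable p.1 p.2 h else (.skip : Prog U)).writes,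
      l.kind = 35 ∨ l.kind = 36 := by
    intro l hl
    obtain ⟨p, -, hp⟩ := mem_seqAll_writes.1 hl
    rcases hkind p l hp with rfl | h
    · simp
    · exact .inr h
  refine Runs.seq (R := fun s' => s'.nvar .numX = n ∧ s'.nvar vJn = J ∧
    ∀ j (a : {a // a ∈ U}), a.1 ∈ q.attr j → ∀ i < (D.rows j).length, s'.narr (aIdx j a) i =
      cellIdx (s.rarr (.center a)) (s.rarr (aY U)) n J (D.val j i a)) ?_ ?_
  · refine runs_seqAll (fun l s' => ∀ p ∈ l, p.2.1 ∈ q.attr p.1 → ∀ i < (D.rows p.1).length,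
      s'.narr (aIdx p.1 p.2) i =
      cellIdx (s.rarr (.center p.2)) (s.rarr (aY U)) n J (D.val p.1 i p.2)) (by simp) ?_ ?_
    · intro l₁ p l₂ hl s₁ ha₁ hI
      have hp : p ∉ l₁ := by
        have := (Finset.univ : Finset (Fin q.m × {a // a ∈ U})).nodup_toList
        rw [hl, List.nodup_append] at this
        intro h
        exact this.2.2 p h p (by simp) rfl
      have hT₁ : HasTables D s₁ := hT.agree ha₁ fun l hl => by
        have := hkind' l hl; omega
      have hnot : ∀ l : Loc U, l.kind ≠ 35 → l.kind ≠ 36 → l ∉ (seqAll (Finset.univ : Finset (Fin q.m × {a // a ∈ U})).toList fun p =>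
          if h : p.2.1 ∈ q.attr p.1 then cellTable p.1 p.2 h else (.skip : Prog U)).writes :=
        fun l h1 h2 h => by have := hkind' l h; omega
      have e1 : s₁.nvar .numX = n := ha₁.nv _ (hnot _ (by simp) (by simp))
      have e2 : s₁.nvar vJn = J := ha₁.nv _ (hnot _ (by simp) (by simp))
      have e3 : s₁.rarr (.center p.2) = s.rarr (.center p.2) := ha₁.ra _ (hnot _ (by simp) (by simp))
      have e4 : s₁.rarr (aY U) = s.rarr (aY U) := ha₁.ra _ (hnot _ (by simp) (by simp))
      have hthis : Runs f T (if h : p.2.1 ∈ q.attr p.1 then cellTable p.1 p.2 h else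
          (.skip : Prog U)) s₁ (50 * c) fun s' => p.2.1 ∈ q.attr p.1 →
          ∀ i < (D.rows p.1).length, s'.narr (aIdx p.1 p.2) i =
          cellIdx (s.rarr (.center p.2)) (s.rarr (aY U)) n J (D.val p.1 i p.2) := by
        split_ifs with h
        · have := cellTable_runs (f := f) (T := T) p.1 p.2 h D s₁ hT₁
          rw [e1, e2, e3, e4] at this
          refine this.mono ?_ fun s' _ h _ => h
          rw [hc, mul_assoc, mul_assoc, mul_assoc]
          exact Nat.mul_le_mul le_rfl (Nat.mul_le_mul (by have := hN p.1; omega) le_rfl)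
        · refine ⟨s₁, 1, .skip _, ?_, fun h' => absurd h' h⟩
          have : 0 < c := by positivity
          omega
      refine hthis.mono le_rfl fun s' ha h => ?_
      intro p' hp' hpa i hi
      rcases List.mem_append.1 hp' with hp' | hp'
      · rw [ha.na _ fun hh => ?_]
        · exact hI p' hp' hpa i hi
        · rcases hkind p _ hh with h | h
          · simp at h
            have : p' = p := Prod.ext (Fin.ext h.1) (Subtype.ext (Fin.ext h.2))
            exact hp (this ▸ hp')
          · simp at h
      · obtain rfl : p' = p := by simpa using hp'
        exact h hpa i hi
    · intro s' ha h
      have hnot : ∀ l : Loc U, l.kind ≠ 35 → l.kind ≠ 36 → l ∉ (seqAll (Finset.univ : Finset (Fin q.m × {a // a ∈ U})).toList fun p =>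
          if h : p.2.1 ∈ q.attr p.1 then cellTable p.1 p.2 h else (.skip : Prog U)).writes :=
        fun l h1 h2 h => by have := hkind' l h; omega
      exact ⟨ha.nv _ (hnot _ (by simp) (by simp)), ha.nv _ (hnot _ (by simp) (by simp)),
        fun j a hj => h (j, a) (by simp) hj⟩
  · rintro s₁ ha₁ ⟨e1, e2, h1⟩
    refine Runs.seq (R := fun s' => s' = s₁.setN vM 1) ⟨_, _, .setN _ _ _, by simp [NExp.steps],
      by simp [NExp.eval]⟩ fun s₂ _ hs₂ => ?_
    subst hs₂
    refine runs_forN (fun x s' => s'.nvar vM = x * (J + J) + 1) n (by simpa using e1) (by simp)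
      (by simp) (by simp) (by simp) (fun i s v h => by simpa using h) ?_ ?_
    · intro x hx s' ha hsx hI
      refine ⟨_, _, .setN _ _ _, by simp [NExp.steps], ?_⟩
      have : s'.nvar vJn = J := by rw [ha.nv _ (by simp)]; simpa using e2
      simp [NExp.eval, hI, this]; ring
    · intro s' ha hI
      refine ⟨hI, fun j a hj i hi => ?_⟩
      rw [ha.na _ (by simp)]
      exact h1 j a hj i hi

end Cells

/-! ### Distances to point lists and updates of the coreset -/

section Points
variable {q : JoinQuery} {U : Finset (Fin q.d)}
variable {f : List (Pt U × ℝ) → List (Pt U)} {T : ℕ → ℕ}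

abbrev rPt (a : {a // a ∈ U}) : RVar := .tmp (nm 41 a 0)
abbrev rMin : RVar := .tmp (nm 42 0 0)
abbrev vZ : NVar q := .tmp (nm 43 0 0)

/-- The `i`-th point of a list of points stored column by column. -/
noncomputable def ptAt (s : Store U) (b : {a // a ∈ U} → RArr U) (i : ℕ) : Pt U :=
  WithLp.toLp 2 fun a => s.rarr (b a) i

/-- The point stored in the variables `rPt`. -/
noncomputable def curPt (s : Store U) : Pt U := WithLp.toLp 2 fun a => s.rvar (rPt a)

noncomputable def distExp (b : {a // a ∈ U} → RArr U) (i : NExp q) : RExp U :=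
  .root (RExp.sum ((Finset.univ : Finset {a // a ∈ U}).toList.map fun a =>
    .times (.minus (.var (rPt a)) (.arr (b a) i)) (.minus (.var (rPt a)) (.arr (b a) i))))

theorem distExp_eval (s : Store U) (b : {a // a ∈ U} → RArr U) (i : NExp q) :
    (distExp b i).eval s = dist (curPt s) (ptAt s b (i.eval s)) := by
  rw [EuclideanSpace.dist_eq]
  simp only [distExp, RExp.eval, RExp.eval_sum, List.map_map, Function.comp_def,
    Finset.sum_map_toList, curPt, ptAt, Real.dist_eq, sq_abs]
  simp only [pow_two]

theorem infDist_eq_of_forall_le {E : Type*} [PseudoMetricSpace E] {x : E} {S : Set E} {d : ℝ}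
    (h : ∀ y ∈ S, d ≤ dist x y) (h' : ∃ y ∈ S, d = dist x y) : d = Metric.infDist x S := by
  obtain ⟨y, hy, hd⟩ := h'
  exact le_antisymm ((Metric.le_infDist ⟨y, hy⟩).2 fun _ => h _)
    (hd ▸ Metric.infDist_le_dist_of_mem hy)

noncomputable def minStep (b : {a // a ∈ U} → RArr U) : Prog U :=
  .cond (.rle (.var rMin) (distExp b (.var vZ))) .skip (.setR rMin (distExp b (.var vZ)))

/-- The distance of the current point to the nearest one of a list of points. -/
noncomputable def minDist (b : {a // a ∈ U} → RArr U) (y : NVar q) : Prog U :=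
  .seq (.setR rMin (distExp b (.const 0))) (forN vZ y (minStep b))

theorem minDist_kind (b : {a // a ∈ U} → RArr U) (y : NVar q) :
    ∀ l ∈ (minDist b y).writes, l.kind ∈ Set.Icc 42 43 := by
  simp [minDist, minStep]

theorem minDist_runs (b : {a // a ∈ U} → RArr U) (y : NVar q) (hy : y ≠ vZ) :
    ∃ c, ∀ (f : List (Pt U × ℝ) → List (Pt U)) (T : ℕ → ℕ) (s : Store U), 0 < s.nvar y →
      Runs f T (minDist b y) s (c * (s.nvar y + 1)) fun s' =>
        s'.rvar rMin = Metric.infDist (curPt s) {x | ∃ i < s.nvar y, x = ptAt s b i} := by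
  refine ⟨(distExp b (.const 0)).steps + 1 + (minStep b).time + 9, fun f T s hpos => ?_⟩
  set n := s.nvar y with hn
  refine Runs.mono (t := (distExp b (.const 0)).steps + 1 + (n * ((minStep b).time + 9) + 7)) ?_
    (by nlinarith [Nat.zero_le (n * (distExp b (.const 0)).steps)]) fun _ _ h => h
  refine Runs.seq (R := fun s' => s' = s.setR rMin (dist (curPt s) (ptAt s b 0)))
    ⟨_, _, .setR _ _ _, le_rfl, by simp [distExp_eval, NExp.eval]⟩ fun s₁ _ hs₁ => ?_
  subst hs₁
  refine runs_forN (fun o s' => (∀ i < o, s'.rvar rMin ≤ dist (curPt s) (ptAt s b i)) ∧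
    ∃ i < n, s'.rvar rMin = dist (curPt s) (ptAt s b i)) n rfl hy (by simp [minStep])
    (by simp [minStep]) ⟨by simp, 0, hpos, by simp⟩ (fun _ _ _ h => h) ?_ ?_
  · rintro o ho s' ha hso ⟨h1, h2⟩
    have e1 : curPt s' = curPt s := by
      unfold curPt
      congr 1; funext a
      rw [ha.rv _ (by simp [minStep])]; simp
    have e2 : ∀ i, ptAt s' b i = ptAt s b i := by
      intro i
      unfold ptAt
      congr 1; funext a
      rw [ha.ra _ (by simp [minStep])]; simp
    refine Prog.Flat.runs (by simp [minStep]) ?_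
    by_cases hc : s'.rvar rMin ≤ dist (curPt s) (ptAt s b o)
    · have hrun : (minStep b).run s' = s' := by
        simp [minStep, Test.holds, RExp.eval, distExp_eval, NExp.eval, e1, e2, hso, hc]
      rw [hrun]
      refine ⟨fun i hi => ?_, h2⟩
      rcases Nat.lt_succ_iff_lt_or_eq.1 hi with hi | rfl
      · exact h1 i hi
      · exact hc
    · have hrun : ((minStep b).run s').rvar rMin = dist (curPt s) (ptAt s b o) := by
        simp [minStep, Test.holds, RExp.eval, distExp_eval, NExp.eval, e1, e2, hso, hc]
      rw [hrun]
      refine ⟨fun i hi => ?_, o, ho, rfl⟩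
      rcases Nat.lt_succ_iff_lt_or_eq.1 hi with hi | rfl
      · exact (not_le.1 hc).le.trans (h1 i hi)
      · exact le_rfl
  · rintro s' ha ⟨h1, i, hi, h2⟩
    refine infDist_eq_of_forall_le ?_ ⟨_, ⟨i, hi, rfl⟩, h2⟩
    rintro x ⟨i, hi, rfl⟩
    exact h1 i hi

abbrev vF : NVar q := .tmp (nm 44 0 0)
abbrev rThr : RVar := .tmp (nm 45 0 0)

noncomputable def findStep (U : Finset (Fin q.d)) : Prog U :=
  .cond (.rle (distExp .corePt (.var vZ)) (.var rThr)) (.setN vF (.var vZ)) .skip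

/-- Look for a coreset point near the current point. -/
noncomputable def findCore (U : Finset (Fin q.d)) : Prog U :=
  .seq (.setN vF (.var .numC)) <|
    .seq (.setR rThr (.times (.var rDelta) (.plus (.var rMin) (.var rScale))))
      (forN vZ .numC (findStep U))

theorem findCore_kind : ∀ l ∈ (findCore U).writes, l.kind ∈ Set.Icc 43 45 := by
  simp [findCore, findStep]

/-- The answer `vF = numC` means that no coreset point is near. It is also the index at which a new
point would be stored, so `addCore` can update the weight at `vF` in both cases. -/
theorem findCore_runs (U : Finset (Fin q.d)) :
    ∃ c, ∀ (f : List (Pt U × ℝ) → List (Pt U)) (T : ℕ → ℕ) (s : Store U),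
      Runs f T (findCore U) s (c * (s.nvar .numC + 1)) fun s' =>
        (s'.nvar vF = s.nvar .numC ∧ ∀ i < s.nvar .numC,
          s.rvar rDelta * (s.rvar rMin + s.rvar rScale) < dist (curPt s) (ptAt s .corePt i)) ∨
        (s'.nvar vF < s.nvar .numC ∧ dist (curPt s) (ptAt s .corePt (s'.nvar vF)) ≤
          s.rvar rDelta * (s.rvar rMin + s.rvar rScale)) := by
  refine ⟨2 + 6 + (findStep U).time + 9, fun f T s => ?_⟩
  set n := s.nvar .numC with hn
  set θ := s.rvar rDelta * (s.rvar rMin + s.rvar rScale) with hθ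
  refine Runs.mono (t := 2 + (6 + (n * ((findStep U).time + 9) + 7))) ?_ (by nlinarith) fun _ _ h => h
  refine Runs.seq (R := fun s' => s' = s.setN vF n)
    ⟨_, _, .setN _ _ _, by simp [NExp.steps], rfl⟩ fun s₁ _ hs₁ => ?_
  subst hs₁
  refine Runs.seq (R := fun s' => s' = (s.setN vF n).setR rThr θ)
    ⟨_, _, .setR _ _ _, by simp [RExp.steps], by simp [RExp.eval, hθ]⟩ fun s₂ _ hs₂ => ?_
  subst hs₂
  refine runs_forN (fun o s' => (s'.nvar vF = n ∧ ∀ i < o, θ < dist (curPt s) (ptAt s .corePt i)) ∨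
    (s'.nvar vF < n ∧ dist (curPt s) (ptAt s .corePt (s'.nvar vF)) ≤ θ)) n (by simp [hn]) (by simp)
    (by simp [findStep]) (by simp [findStep]) (.inl ⟨by simp, by simp⟩)
    (fun i s v h => by simpa using h) ?_ (fun _ _ h => h)
  rintro o ho s' ha hso hI
  have e1 : curPt s' = curPt s := by
    unfold curPt
    congr 1; funext a
    rw [ha.rv _ (by simp [findStep])]; simp
  have e2 : ∀ i, ptAt s' .corePt i = ptAt s .corePt i := by
    intro i
    unfold ptAt
    congr 1; funext a
    rw [ha.ra _ (by simp [findStep])]; simp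
  have e3 : s'.rvar rThr = θ := by rw [ha.rv _ (by simp [findStep])]; simp
  refine Prog.Flat.runs (by simp [findStep]) ?_
  by_cases hc : dist (curPt s) (ptAt s .corePt o) ≤ θ
  · have hrun : ((findStep U).run s').nvar vF = o := by
      simp [findStep, Test.holds, RExp.eval, distExp_eval, NExp.eval, e1, e2, e3, hso, hc]
    rw [hrun]
    exact .inr ⟨ho, hc⟩
  · have hrun : (findStep U).run s' = s' := by
      simp [findStep, Test.holds, RExp.eval, distExp_eval, NExp.eval, e1, e2, e3, hso, hc]
    rw [hrun]
    refine hI.imp (fun ⟨h1, h2⟩ => ⟨h1, fun i hi => ?_⟩) id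
    rcases Nat.lt_succ_iff_lt_or_eq.1 hi with hi | rfl
    · exact h2 i hi
    · exact not_le.1 hc

/-- Write the current point behind the coreset. -/
noncomputable def appendPt (U : Finset (Fin q.d)) : Prog U :=
  seqAll (Finset.univ : Finset {a // a ∈ U}).toList fun a =>
    .putR (.corePt a) (.var .numC) (.var (rPt a))

/-- Add the current count to the weight of the coreset point that was found, or of a new one. -/
noncomputable def addCore (U : Finset (Fin q.d)) : Prog U :=
  .seq (.cond (.nle (.var .numC) (.var vF)) (.seq (appendPt U)
      (.seq (.putR .coreWt (.var .numC) (.const 0)) (.setN .numC (.plus (.var .numC) (.const 1)))))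
      .skip)
    (.putR .coreWt (.var vF) (.plus (.arr .coreWt (.var vF)) (.var rCnt)))

theorem appendPt_writes : ∀ l ∈ (appendPt U).writes, ∃ a, l = .ra (.corePt a) := by
  intro l hl
  obtain ⟨a, -, ha⟩ := mem_seqAll_writes.1 hl
  exact ⟨a, ha⟩

theorem addCore_kind : ∀ l ∈ (addCore U).writes, l.kind = 1 := by
  intro l hl
  simp only [addCore, Prog.writes, Set.mem_union] at hl
  rcases hl with (((h | h | h) | h) | h)
  · obtain ⟨a, rfl⟩ := appendPt_writes l h
    rfl
  all_goals simp at h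
  all_goals simp [h]

theorem addCore_runs (U : Finset (Fin q.d)) :
    ∃ c, ∀ (f : List (Pt U × ℝ) → List (Pt U)) (T : ℕ → ℕ) (s : Store U),
      s.nvar vF ≤ s.nvar .numC →
      Runs f T (addCore U) s c fun s' =>
        s'.nvar .numC = max (s.nvar .numC) (s.nvar vF + 1) ∧
        (∀ i, ptAt s' .corePt i = if i = s.nvar .numC ∧ i = s.nvar vF then curPt s else ptAt s .corePt i) ∧
        (∀ i < s.nvar .numC, i ≠ s.nvar vF → s'.rarr .coreWt i = s.rarr .coreWt i) ∧
        s'.rarr .coreWt (s.nvar vF) =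
          (if s.nvar vF = s.nvar .numC then 0 else s.rarr .coreWt (s.nvar vF)) + s.rvar rCnt := by
  refine ⟨((Finset.univ : Finset {a // a ∈ U}).toList.length * 3 + 1 + (3 + 4)) + 10 + 10,
    fun f T s hle => ?_⟩
  set n := s.nvar .numC with hn
  set v := s.nvar vF with hv
  have hpt : Runs f T (appendPt U) s ((Finset.univ : Finset {a // a ∈ U}).toList.length * 3 + 1)
      fun s' => ∀ i, ptAt s' .corePt i = if i = n then curPt s else ptAt s .corePt i := by
    refine runs_seqAll (fun l s' => ∀ a, (a ∈ l → s'.rarr (.corePt a) =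
      Function.update (s.rarr (.corePt a)) n (s.rvar (rPt a))) ∧ (a ∉ l → s'.rarr (.corePt a) =
      s.rarr (.corePt a))) (by simp) ?_ ?_
    · intro l₁ a l₂ hl s₁ ha₁ hI
      refine ⟨_, _, .putR _ _ _ _, by simp [NExp.steps, RExp.steps], ?_⟩
      have hal : a ∉ l₁ := by
        have := (Finset.univ : Finset {a // a ∈ U}).nodup_toList
        rw [hl, List.nodup_append] at this
        intro h
        exact this.2.2 a h a (by simp) rfl
      have hnot : ∀ l : Loc U, (∀ a, l ≠ .ra (.corePt a)) → l ∉ (appendPt U).writes := by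
        intro l h hl
        obtain ⟨a, ha⟩ := appendPt_writes l hl
        exact h a ha
      have e1 : s₁.nvar .numC = n := ha₁.nv _ (hnot _ (by simp))
      have e2 : s₁.rvar (rPt a) = s.rvar (rPt a) := ha₁.rv _ (hnot _ (by simp))
      intro b
      by_cases hba : b = a
      · subst hba
        simp [NExp.eval, RExp.eval, e1, e2, (hI b).2 hal]
      · have hne : RArr.corePt b ≠ RArr.corePt a := by simpa using hba
        rw [putR_rarr_ne _ _ _ _ _ hne]
        simpa [hba] using hI b
    · intro s' _ hI i
      have : ∀ a, s'.rarr (.corePt a) = Function.update (s.rarr (.corePt a)) n (s.rvar (rPt a)) :=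
        fun a => (hI a).1 (by simp)
      split_ifs with h
      · subst h
        simp [ptAt, curPt, this]
      · simp [ptAt, this, h]
  refine Runs.mono (t := ((Test.nle (.var .numC) (.var vF) : Test U).steps +
    ((Finset.univ : Finset {a // a ∈ U}).toList.length * 3 + 1 + (3 + 4)) + 1) + 6) ?_ ?_ fun _ _ h => h
  rotate_left
  · simp [Test.steps, NExp.steps]
    omega
  refine Runs.seq (R := fun s' => s'.nvar .numC = max n (v + 1) ∧ s'.nvar vF = v ∧
      s'.rvar rCnt = s.rvar rCnt ∧
      (∀ i, ptAt s' .corePt i = if i = n ∧ i = v then curPt s else ptAt s .corePt i) ∧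
      (∀ i < n, s'.rarr .coreWt i = s.rarr .coreWt i) ∧
      s'.rarr .coreWt v = if v = n then 0 else s.rarr .coreWt v) ?_ ?_
  · refine Runs.cond (fun hc => ?_) (fun hc => ?_)
    · simp only [Test.holds, NExp.eval] at hc
      have hvn : v = n := by omega
      have hnot : ∀ l : Loc U, (∀ a, l ≠ .ra (.corePt a)) → l ∉ (appendPt U).writes := by
        intro l h hl
        obtain ⟨a, ha⟩ := appendPt_writes l hl
        exact h a ha
      refine hpt.seq fun s₁ ha₁ h₁ => ?_
      have e1 : s₁.nvar .numC = n := ha₁.nv _ (hnot _ (by simp))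
      have e2 : s₁.rvar rCnt = s.rvar rCnt := ha₁.rv _ (hnot _ (by simp))
      have e3 : s₁.nvar vF = v := ha₁.nv _ (hnot _ (by simp))
      have e4 : s₁.rarr .coreWt = s.rarr .coreWt := ha₁.ra _ (hnot _ (by simp))
      refine Prog.Flat.runs_le (by simp) (by simp [Prog.time, NExp.steps, RExp.steps]) ?_
      refine ⟨by simp [NExp.eval, e1, hvn], by simp [NExp.eval, e1, e3], by simpa using e2,
        fun i => ?_, fun i hi => ?_, ?_⟩
      · have : ptAt ((Prog.seq (.putR .coreWt (.var .numC) (.const 0))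
          (.setN .numC (.plus (.var .numC) (.const 1)))).run s₁) .corePt i = ptAt s₁ .corePt i := by
          simp [ptAt]
        rw [this, h₁, hvn]
        simp
      · have : i ≠ n := by omega
        simp [NExp.eval, RExp.eval, e1, e4, this]
      · simp [NExp.eval, RExp.eval, e1, hvn]
    · simp only [Test.holds, NExp.eval] at hc
      refine ⟨s, 1, .skip _, by omega, by omega, rfl, rfl, fun i => ?_, fun _ _ => rfl, ?_⟩
      · rw [if_neg (by omega)]
      · rw [if_neg (by omega)]
  · rintro s₁ - ⟨e1, e2, e3, e4, e5, e6⟩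
    refine Prog.Flat.runs_le (by simp) (by simp [Prog.time, NExp.steps, RExp.steps]) ?_
    refine ⟨by simpa using e1, fun i => ?_, fun i hi hiv => ?_, ?_⟩
    · rw [← e4 i]; simp [ptAt]
    · simp [NExp.eval, e2, hiv, e5 i hi]
    · simp [NExp.eval, RExp.eval, e2, e3, e6]

/-- Some relation that contains the attribute. -/
noncomputable def relOf (q : JoinQuery) (a : Fin q.d) : Fin q.m := (q.cover a).choose

theorem relOf_spec (q : JoinQuery) (a : Fin q.d) : a ∈ q.attr (relOf q a) := (q.cover a).choose_spec

/-- Load the join result found by a query. -/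
noncomputable def loadRep (U : Finset (Fin q.d)) : Prog U :=
  seqAll (Finset.univ : Finset {a // a ∈ U}).toList fun a =>
    .setR (rPt a) (.arr (.table (relOf q a) ⟨a, relOf_spec q a⟩) (.var (vRow (relOf q a))))

theorem loadRep_writes : ∀ l ∈ (loadRep U).writes, ∃ a : {a // a ∈ U}, l = .rv (rPt a) := by
  intro l hl
  obtain ⟨a, -, ha⟩ := mem_seqAll_writes.1 hl
  exact ⟨a, ha⟩

theorem loadRep_runs (D : Instance q) (s : Store U) (hT : HasTables D s) (t : Fin q.d → ℝ)
    (ht : ∀ j, ∀ a ∈ q.attr j, s.nvar (vRow j) < (D.rows j).length ∧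
      D.val j (s.nvar (vRow j)) a = t a) :
    Runs f T (loadRep U) s ((Finset.univ : Finset {a // a ∈ U}).toList.length * 3 + 1) fun s' =>
      curPt s' = proj U t := by
  refine runs_seqAll (fun l s' => ∀ a ∈ l, s'.rvar (rPt a) = t a) (by simp) ?_ ?_
  · intro l₁ a l₂ hl s₁ ha₁ hI
    refine ⟨_, _, .setR _ _ _, by simp [NExp.steps, RExp.steps], ?_⟩
    have hnot : ∀ l : Loc U, (∀ a : {a // a ∈ U}, l ≠ .rv (rPt a)) → l ∉ (loadRep U).writes := by
      intro l h hl
      obtain ⟨a, ha⟩ := loadRep_writes l hl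
      exact h a ha
    have e1 : s₁.nvar (vRow (relOf q a)) = s.nvar (vRow (relOf q a)) :=
      ha₁.nv _ (hnot _ (by simp))
    have e2 : s₁.rarr (.table (relOf q a) ⟨a, relOf_spec q a⟩) =
        s.rarr (.table (relOf q a) ⟨a, relOf_spec q a⟩) := ha₁.ra _ (hnot _ (by simp))
    obtain ⟨h1, h2⟩ := ht _ _ (relOf_spec q a)
    intro b hb
    by_cases hba : b = a
    · subst hba
      simp [RExp.eval, NExp.eval, e1, e2, hT.table _ _ (relOf_spec q b) _ h1, h2]
    · have hne : rPt b ≠ rPt a := by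
        simp only [ne_eq, RVar.tmp.injEq, nm_inj, true_and, and_true]
        intro h; exact hba (Subtype.ext (Fin.ext h))
      rw [setR_rvar_ne _ _ _ _ hne]
      exact hI b (by simpa [hba] using hb)
  · intro s' _ hI
    unfold curPt proj
    congr 1; funext a
    exact hI a (by simp)

end Points

/-! ### The growing coreset -/

section CoreState
variable {q : JoinQuery} {U : Finset (Fin q.d)}

/-- The `n` weighted points `pt`, `wt` represent the join results in `Z`: every one of them is
assigned to a point that is near to a join result of the same cell, and the points are
separated. -/
def Represents (D : Instance q) (X : Set (Pt U)) (δ σ : ℝ) (cell : Fin q.d → ℝ → ℕ)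
    (Z : Finset (Fin q.d → ℝ)) (n : ℕ) (pt : ℕ → Pt U) (wt : ℕ → ℝ) : Prop :=
  ∃ φ : (Fin q.d → ℝ) → ℕ,
    (∀ t ∈ Z, φ t < n ∧ ∃ t' ∈ joinSet D, (∀ a ∈ U, cell a (t' a) = cell a (t a)) ∧
      dist (proj U t') (pt (φ t)) ≤ δ * (Metric.infDist (proj U t') X + σ)) ∧
    (∀ i < n, wt i = (Z.filter fun t => φ t = i).card) ∧
    (∀ i < n, ∃ t ∈ Z, φ t = i) ∧
    (∀ i < n, ∃ t ∈ joinSet D, pt i = proj U t) ∧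
    ∀ i j, i < j → j < n → δ * (Metric.infDist (pt j) X + σ) < dist (pt j) (pt i)

open scoped Classical in
-- All results of a box go to one coreset point: an old one near the representative `t₀`, or `t₀`
-- itself. Weights remain sizes of fibers because the box is disjoint from what was processed. A
-- point is appended only if it is far from all earlier ones, so separation persists.
theorem Represents.extend {D : Instance q} {X : Set (Pt U)} {δ σ : ℝ} {cell : Fin q.d → ℝ → ℕ}
    {Z G : Finset (Fin q.d → ℝ)} {n v : ℕ} {pt pt' : ℕ → Pt U} {wt wt' : ℕ → ℝ}
    (h : Represents D X δ σ cell Z n pt wt) {t₀ : Fin q.d → ℝ} (ht₀ : t₀ ∈ G)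
    (hG : ∀ t ∈ G, t ∈ joinSet D ∧ ∀ a ∈ U, cell a (t a) = cell a (t₀ a)) (hZG : Disjoint Z G)
    (hδ : 0 ≤ δ) (hσ : 0 ≤ σ)
    (hv : (v = n ∧ ∀ i < n, δ * (Metric.infDist (proj U t₀) X + σ) < dist (proj U t₀) (pt i)) ∨
      (v < n ∧ dist (proj U t₀) (pt v) ≤ δ * (Metric.infDist (proj U t₀) X + σ)))
    (hpt : ∀ i, pt' i = if i = n ∧ i = v then proj U t₀ else pt i)
    (hwt : ∀ i < n, i ≠ v → wt' i = wt i)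
    (hwv : wt' v = (if v = n then 0 else wt v) + G.card) :
    Represents D X δ σ cell (Z ∪ G) (max n (v + 1)) pt' wt' := by
  obtain ⟨φ, h1, h2, h3, h4, h5⟩ := h
  have hvn : v ≤ n := by rcases hv with h | h <;> omega
  have hptlt : ∀ i < n, pt' i = pt i := fun i hi => by rw [hpt, if_neg (by omega)]
  have hptv : dist (proj U t₀) (pt' v) ≤ δ * (Metric.infDist (proj U t₀) X + σ) := by
    rcases hv with ⟨rfl, -⟩ | ⟨hlt, h⟩
    · rw [hpt, if_pos ⟨rfl, rfl⟩, dist_self]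
      exact mul_nonneg hδ (add_nonneg Metric.infDist_nonneg hσ)
    · rw [hptlt v hlt]; exact h
  have hZ : ∀ t ∈ Z, t ∉ G := fun t ht => Finset.disjoint_left.1 hZG ht
  refine ⟨fun t => if t ∈ G then v else φ t, ?_, ?_, ?_, ?_, ?_⟩
  · intro t ht
    by_cases htG : t ∈ G
    · simp only [htG, if_true]
      exact ⟨by omega, t₀, (hG t₀ ht₀).1, fun a ha => ((hG t htG).2 a ha).symm, hptv⟩
    · have htZ : t ∈ Z := by simpa [htG] using ht
      simp only [htG, if_false]
      obtain ⟨h6, h7⟩ := h1 t htZ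
      rw [hptlt _ h6]
      exact ⟨by omega, h7⟩
  · intro i hi
    have hsplit : ((Z ∪ G).filter fun t => (if t ∈ G then v else φ t) = i).card =
        (Z.filter fun t => φ t = i).card + if i = v then G.card else 0 := by
      rw [Finset.filter_union, Finset.card_union_of_disjoint
        (Finset.disjoint_filter_filter hZG)]
      congr 1
      · congr 1
        refine Finset.filter_congr fun t ht => ?_
        rw [if_neg (hZ t ht)]
      · split_ifs with hiv
        · rw [Finset.filter_true_of_mem]
          intro t _; simp [hiv]
        · rw [Finset.filter_false_of_mem, Finset.card_empty]
          intro t ht; simpa [ht] using fun h => hiv (Eq.symm h)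
    rw [hsplit]
    by_cases hiv : i = v
    · subst hiv
      rw [hwv, if_pos rfl]
      push_cast
      congr 1
      split_ifs with hn
      · rw [Finset.filter_false_of_mem]
        · simp
        · intro t ht
          have := (h1 t ht).1
          omega
      · exact h2 i (by omega)
    · rw [hwt i (by omega) hiv, if_neg hiv, add_zero]
      exact h2 i (by omega)
  · intro i hi
    by_cases hiv : i = v
    · exact ⟨t₀, by simp [ht₀], by simp [ht₀, hiv]⟩
    · obtain ⟨t, ht, hti⟩ := h3 i (by omega)
      exact ⟨t, by simp [ht], by simp [hZ t ht, hti]⟩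
  · intro i hi
    by_cases hin : i < n
    · rw [hptlt i hin]; exact h4 i hin
    · refine ⟨t₀, (hG t₀ ht₀).1, ?_⟩
      rw [hpt, if_pos (by omega)]
  · intro i j hij hj
    by_cases hjn : j < n
    · rw [hptlt i (by omega), hptlt j hjn]; exact h5 i j hij hjn
    · rcases hv with ⟨rfl, h⟩ | ⟨hlt, -⟩
      · have : j = v := by omega
        subst this
        rw [hpt j, if_pos ⟨rfl, rfl⟩, hptlt i hij]
        exact h i hij
      · omega

end CoreState

open scoped Classical in
theorem mem_resultsWith {q : JoinQuery} {D : Instance q} {A : Finset (Fin q.d)}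
    {ψ : Fin q.d → ℝ → Prop} {t : Fin q.d → ℝ} :
    t ∈ resultsWith D A ψ ↔ t ∈ joinSet D ∧ ∀ a ∈ A, ψ a (t a) := by
  rw [resultsWith, Finset.mem_filter, Set.Finite.mem_toFinset]

/-! ### Sweep over all boxes -/

section Boxes
variable {q : JoinQuery} {U : Finset (Fin q.d)}
variable {f : List (Pt U × ℝ) → List (Pt U)} {T : ℕ → ℕ}

abbrev vBox (a : Fin q.d) : NVar q := .tmp (nm 40 a 0)

/-- All data of the main phase except for the coreset. -/
structure Static (D : Instance q) (X : List (Pt U)) (δ σ : ℝ) (cell : Fin q.d → ℝ → ℕ)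
    (s : Store U) : Prop where
  tables : HasTables D s
  keyed : Keyed D Finset.univ s
  numX : s.nvar .numX = X.length
  center : ∀ i (h : i < X.length), ptAt s .center i = X[i]
  delta : s.rvar rDelta = δ
  scale : s.rvar rScale = σ
  idx : ∀ j, ∀ a ∈ U, a ∈ q.attr j → ∀ i < (D.rows j).length,
    s.narr (aIdx j a) i = cell a (D.val j i a)

theorem ptAt_agree {s s' : Store U} {W : Set (Loc U)} (ha : Agree W s s')
    {b : {a // a ∈ U} → RArr U} (hb : ∀ a, .ra (b a) ∉ W) : ptAt s' b = ptAt s b := by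
  funext i
  unfold ptAt
  congr 1; funext a
  rw [ha.ra _ (hb a)]

theorem Static.agree {D : Instance q} {X : List (Pt U)} {δ σ : ℝ} {cell : Fin q.d → ℝ → ℕ}
    {s s' : Store U} {W : Set (Loc U)} (h : Static D X δ σ cell s) (ha : Agree W s s')
    (hW : ∀ l ∈ W, l.kind = 1 ∨ l.kind ∈ Set.Icc 20 25 ∨ l.kind ∈ Set.Icc 40 45) :
    Static D X δ σ cell s' := by
  have hnot : ∀ l : Loc U, l.kind ∈ ({0, 30, 31, 35} : Set ℕ) → l ∉ W := by
    intro l hl hlW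
    have := hW l hlW
    simp at hl this
    omega
  refine ⟨h.tables.agree ha fun l hl => ?_, h.keyed.agree ha fun l hl => ?_, ?_, ?_, ?_, ?_, ?_⟩
  · have := hW l hl; simp at this; omega
  · have := hW l hl; simp at this ⊢; omega
  · rw [ha.nv _ (hnot _ (by simp))]; exact h.numX
  · rw [ptAt_agree ha fun a => hnot _ (by simp)]; exact h.center
  · rw [ha.rv _ (hnot _ (by simp))]; exact h.delta
  · rw [ha.rv _ (hnot _ (by simp))]; exact h.scale
  · intro j a haU haj i hi
    rw [ha.na _ (hnot _ (by simp))]; exact h.idx j a haU haj i hi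

/-- The row `vQ` of table `j` belongs to the current box. -/
noncomputable def boxTest (U : Finset (Fin q.d)) (j : Fin q.m) : Test U :=
  .all ((U ∩ q.attr j).toList.map fun a =>
    .conj (.nle (.arr (aIdx j a) (.var vQ)) (.var (vBox a)))
      (.nle (.var (vBox a)) (.arr (aIdx j a) (.var vQ))))

theorem boxTest_holds (s : Store U) (j : Fin q.m) : (boxTest U j).holds s ↔
    ∀ a ∈ U, a ∈ q.attr j → s.narr (aIdx j a) (s.nvar vQ) = s.nvar (vBox a) := by
  simp only [boxTest, Test.holds_all, List.mem_map, Finset.mem_toList, Finset.mem_inter]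
  constructor
  · intro h a haU haj
    have := h _ ⟨a, ⟨haU, haj⟩, rfl⟩
    exact le_antisymm this.1 this.2
  · rintro h _ ⟨a, ⟨haU, haj⟩, rfl⟩
    exact ⟨(h a haU haj).le, (h a haU haj).ge⟩

noncomputable def boxBody (U : Finset (Fin q.d)) (L : List (Fin q.m × Fin q.m)) (r : Fin q.m) :
    Prog U :=
  .seq (countQuery (boxTest U) L r) <| .cond (.rle (.var rCnt) (.const 0)) .skip <|
    .seq (loadRep U) <| .seq (minDist .center .numX) <| .seq (findCore U) (addCore U)

theorem boxBody_kind (L : List (Fin q.m × Fin q.m)) (r : Fin q.m) :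
    ∀ l ∈ (boxBody U L r).writes, l.kind = 1 ∨ l.kind ∈ Set.Icc 20 25 ∨ l.kind ∈ Set.Icc 41 45 := by
  intro l hl
  simp only [boxBody, Prog.writes, Set.mem_union] at hl
  rcases hl with h | h | h | h | h | h
  · exact .inr (.inl (countQuery_kind _ _ _ l h))
  · exact h.elim
  · obtain ⟨a, rfl⟩ := loadRep_writes l h; simp
  · have := minDist_kind _ _ l h; simp at this ⊢; omega
  · have := findCore_kind l h; simp at this ⊢; omega
  · exact .inl (addCore_kind l h)

/-- The invariant of the main phase, when the join results in `Z` have been processed. -/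
def MainInv (D : Instance q) (X : List (Pt U)) (δ σ : ℝ) (cell : Fin q.d → ℝ → ℕ)
    (Z : Finset (Fin q.d → ℝ)) (s : Store U) : Prop :=
  Static D X δ σ cell s ∧
    Represents D {x | x ∈ X} δ σ cell Z (s.nvar .numC) (ptAt s .corePt) (s.rarr .coreWt)

open scoped Classical in
-- The scan of the current coreset costs time in its size. The packing bound `Cmax` is therefore
-- required for every intermediate state and not only for the final one.
theorem boxBody_runs {L r} (hE : Elim q Finset.univ L r) (U : Finset (Fin q.d)) :
    ∃ c, ∀ (f : List (Pt U × ℝ) → List (Pt U)) (T : ℕ → ℕ) (D : Instance q) (N : ℕ),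
      (∀ j, (D.rows j).length ≤ N) → ∀ (X : List (Pt U)) (δ σ : ℝ) (cell : Fin q.d → ℝ → ℕ)
      (Cmax : ℕ), X ≠ [] → 0 ≤ δ → 0 ≤ σ →
      (∀ Z n pt wt, Represents D {x | x ∈ X} δ σ cell Z n pt wt → n ≤ Cmax) →
      ∀ (Z : Finset (Fin q.d → ℝ)) (s : Store U), MainInv D X δ σ cell Z s →
      (∀ t ∈ Z, ∃ a ∈ U, cell a (t a) ≠ s.nvar (vBox a)) →
      Runs f T (boxBody U L r) s (c * (N + X.length + Cmax + 1))
        (MainInv D X δ σ cell (Z ∪ resultsWith D U fun a v => cell a v = s.nvar (vBox a))) := by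
  obtain ⟨c₁, h₁⟩ := countQuery_runs hE (boxTest U)
  obtain ⟨c₂, h₂⟩ := minDist_runs (q := q) (U := U) .center .numX (by simp)
  obtain ⟨c₃, h₃⟩ := findCore_runs U
  obtain ⟨c₄, h₄⟩ := addCore_runs U
  set c₅ := (Finset.univ : Finset {a // a ∈ U}).toList.length * 3 + 1 with hc₅
  refine ⟨c₁ + c₂ + c₃ + c₄ + c₅ + 4, ?_⟩
  rintro f T D N hN X δ σ cell Cmax hX hδ hσ hpack Z s ⟨hst, hrep⟩ hZ
  have hCmax := hpack _ _ _ _ hrep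
  set n := s.nvar .numC with hn
  set G := resultsWith D U fun a v => cell a v = s.nvar (vBox a) with hG
  refine Runs.mono (t := c₁ * (N + 1) + (3 + (c₅ + (c₂ * (X.length + 1) + (c₃ * (n + 1) + c₄))) + 1))
    ?_ ?_ fun _ _ h => h
  rotate_left
  · have : c₃ * (n + 1) ≤ c₃ * (Cmax + 1) := Nat.mul_le_mul le_rfl (by omega)
    nlinarith [Nat.zero_le (c₁ * X.length), Nat.zero_le (c₁ * Cmax), Nat.zero_le (c₂ * N),
      Nat.zero_le (c₂ * Cmax), Nat.zero_le (c₃ * N), Nat.zero_le (c₃ * X.length),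
      Nat.zero_le (c₄ * (N + X.length + Cmax)), Nat.zero_le (c₅ * (N + X.length + Cmax))]
  refine (h₁ f T D N hN s hst.tables hst.keyed U (fun a v => cell a v = s.nvar (vBox a))
    fun j s' ha hlt => ?_).seq fun s₁ ha₁ ⟨hcnt, hwit⟩ => ?_
  · rw [boxTest_holds]
    refine forall₃_congr fun a haU haj => ?_
    rw [ha.na _ (by simp), ha.nv (vBox a) (by simp), hst.idx j a haU haj _ hlt]
  have hk₁ := countQuery_kind (boxTest U) L r
  have hst₁ : Static D X δ σ cell s₁ := hst.agree ha₁ fun l hl => .inr (.inl (hk₁ l hl))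
  have hc₁ : s₁.nvar .numC = n := ha₁.nv _ fun hh => by have := hk₁ _ hh; simp at this
  have hp₁ : ptAt s₁ .corePt = ptAt s .corePt :=
    ptAt_agree ha₁ fun a hh => by have := hk₁ _ hh; simp at this
  have hw₁ : s₁.rarr .coreWt = s.rarr .coreWt := ha₁.ra _ fun hh => by
    have := hk₁ _ hh; simp at this
  refine Runs.cond (fun hc => ?_) (fun hc => ?_)
  · simp only [Test.holds, RExp.eval, Rat.cast_zero] at hc
    refine ⟨s₁, 1, .skip _, by omega, hst₁, ?_⟩
    have : G = ∅ := by
      rw [hcnt] at hc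
      have : G.card = 0 := by exact_mod_cast le_antisymm hc (Nat.cast_nonneg _)
      exact Finset.card_eq_zero.1 this
    rw [this, Finset.union_empty, hc₁, hp₁, hw₁]
    exact hrep
  simp only [Test.holds, RExp.eval, Rat.cast_zero, not_le] at hc
  obtain ⟨t₀, ht₀, hrow⟩ := hwit hc
  refine (loadRep_runs D s₁ hst₁.tables t₀ hrow).seq fun s₂ ha₂ hs₂ => ?_
  have hk₂ : ∀ l ∈ (loadRep U).writes, l.kind = 41 := by
    intro l hl
    obtain ⟨a, rfl⟩ := loadRep_writes l hl
    simp
  have hst₂ : Static D X δ σ cell s₂ := hst₁.agree ha₂ fun l hl => by simp [hk₂ l hl]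
  have hc₂ : s₂.nvar .numC = n := (ha₂.nv _ fun hh => by simpa using hk₂ _ hh).trans hc₁
  have hp₂ : ptAt s₂ .corePt = ptAt s .corePt :=
    (ptAt_agree ha₂ fun a hh => by simpa using hk₂ _ hh).trans hp₁
  have hw₂ : s₂.rarr .coreWt = s.rarr .coreWt :=
    (ha₂.ra _ fun hh => by simpa using hk₂ _ hh).trans hw₁
  have hn₂ : s₂.rvar rCnt = G.card := (ha₂.rv _ fun hh => by simpa using hk₂ _ hh).trans hcnt
  have hXlen : 0 < X.length := List.length_pos_iff.2 hX
  refine ((h₂ f T s₂ (by rw [hst₂.numX]; exact hXlen)).mono (by rw [hst₂.numX])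
    fun _ _ h => h).seq fun s₃ ha₃ hs₃ => ?_
  have hk₃ := minDist_kind (q := q) (U := U) .center .numX
  have hst₃ : Static D X δ σ cell s₃ := hst₂.agree ha₃ fun l hl => by
    have := hk₃ l hl; simp at this ⊢; omega
  have hc₃ : s₃.nvar .numC = n := (ha₃.nv _ fun hh => by have := hk₃ _ hh; simp at this).trans hc₂
  have hp₃ : ptAt s₃ .corePt = ptAt s .corePt :=
    (ptAt_agree ha₃ fun a hh => by have := hk₃ _ hh; simp at this).trans hp₂
  have hw₃ : s₃.rarr .coreWt = s.rarr .coreWt :=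
    (ha₃.ra _ fun hh => by have := hk₃ _ hh; simp at this).trans hw₂
  have hn₃ : s₃.rvar rCnt = G.card :=
    (ha₃.rv _ fun hh => by have := hk₃ _ hh; simp at this).trans hn₂
  have hcur : ∀ {s s' : Store U} {W : Set (Loc U)}, Agree W s s' → (∀ l ∈ W, l.kind ≠ 41) →
      curPt s' = curPt s := by
    intro s s' W ha hW
    unfold curPt
    congr 1; funext a
    exact ha.rv _ fun hh => by simpa using hW _ hh
  have hq₃ : curPt s₃ = proj U t₀ := (hcur ha₃ fun l hl => by
    have := hk₃ l hl; simp at this; omega).trans hs₂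
  have hmin : s₃.rvar rMin = Metric.infDist (proj U t₀) {x | x ∈ X} := by
    rw [hs₃, hs₂]
    congr 1
    ext x
    simp only [Set.mem_ofPred_eq, hst₂.numX, List.mem_iff_getElem]
    constructor
    · rintro ⟨i, hi, rfl⟩
      exact ⟨i, hi, (hst₂.center i hi).symm⟩
    · rintro ⟨i, hi, rfl⟩
      exact ⟨i, hi, (hst₂.center i hi).symm⟩
  have hfind := h₃ f T s₃
  rw [hst₃.delta, hst₃.scale, hmin, hq₃, hc₃, hp₃] at hfind
  refine hfind.seq fun s₄ ha₄ hs₄ => ?_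
  have hk₄ := findCore_kind (q := q) (U := U)
  have hst₄ : Static D X δ σ cell s₄ := hst₃.agree ha₄ fun l hl => by
    have := hk₄ l hl; simp at this ⊢; omega
  have hc₄ : s₄.nvar .numC = n := (ha₄.nv _ fun hh => by have := hk₄ _ hh; simp at this).trans hc₃
  have hp₄ : ptAt s₄ .corePt = ptAt s .corePt :=
    (ptAt_agree ha₄ fun a hh => by have := hk₄ _ hh; simp at this).trans hp₃
  have hw₄ : s₄.rarr .coreWt = s.rarr .coreWt :=
    (ha₄.ra _ fun hh => by have := hk₄ _ hh; simp at this).trans hw₃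
  have hn₄ : s₄.rvar rCnt = G.card :=
    (ha₄.rv _ fun hh => by have := hk₄ _ hh; simp at this).trans hn₃
  have hq₄ : curPt s₄ = proj U t₀ := (hcur ha₄ fun l hl => by
    have := hk₄ l hl; simp at this; omega).trans hq₃
  refine (h₄ f T s₄ (by rw [hc₄]; rcases hs₄ with h | h <;> omega)).mono le_rfl
    fun s₅ ha₅ ⟨e1, e2, e3, e4⟩ => ⟨hst₄.agree ha₅ fun l hl => .inl (addCore_kind l hl), ?_⟩
  rw [hc₄] at e1 e2 e3 e4
  rw [hp₄, hq₄] at e2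
  rw [hw₄] at e3 e4
  rw [hn₄] at e4
  rw [e1]
  refine hrep.extend ht₀ (fun t ht => ?_) ?_ hδ hσ hs₄ e2 e3 e4
  · rw [hG] at ht
    rw [mem_resultsWith] at ht ht₀
    exact ⟨ht.1, fun a ha => (ht.2 a ha).trans (ht₀.2 a ha).symm⟩
  · rw [Finset.disjoint_left]
    intro t ht htG
    obtain ⟨a, ha, hne⟩ := hZ t ht
    rw [hG, mem_resultsWith] at htG
    exact hne (htG.2 a ha)

/-- Run the body for all values of the box variables of the given attributes. -/
def boxLoop (body : Prog U) : List (Fin q.d) → Prog U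
  | [] => body
  | a :: as => forN (vBox a) vM (boxLoop body as)

theorem boxLoop_writes (body : Prog U) (as : List (Fin q.d)) :
    ∀ l ∈ (boxLoop body as).writes, l ∈ body.writes ∨ ∃ a ∈ as, l = .nv (vBox a) := by
  induction as with
  | nil => exact fun l hl => .inl hl
  | cons a as ih =>
    intro l hl
    simp only [boxLoop, forN_writes, Set.mem_insert_iff] at hl
    rcases hl with rfl | hl
    · exact .inr ⟨a, by simp, rfl⟩
    · rcases ih l hl with h | ⟨b, hb, rfl⟩
      · exact .inl h
      · exact .inr ⟨b, by simp [hb], rfl⟩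

open scoped Classical in
-- Induction on the coordinates still to be enumerated. By `hdis` each processed result differs from
-- the current box in a coordinate that is already fixed; so no result is ever counted twice,
-- whatever values the inner loops take.
theorem boxLoop_runs {body : Prog U} {D : Instance q} {cell : Fin q.d → ℝ → ℕ} {M c : ℕ}
    (hM : ∀ a v, cell a v < M) {Inv : Finset (Fin q.d → ℝ) → Store U → Prop}
    (hw : ∀ l ∈ body.writes, l.kind ≠ 40 ∧ l.kind ≠ 37)
    (hInv : ∀ Z s a v, Inv Z s → Inv Z (s.setN (vBox a) v))
    (hbody : ∀ Z s, Inv Z s → (∀ t ∈ Z, ∃ a ∈ U, cell a (t a) ≠ s.nvar (vBox a)) →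
      Runs f T body s c (Inv (Z ∪ resultsWith D U fun a v => cell a v = s.nvar (vBox a))))
    (as : List (Fin q.d)) (has : as.Nodup) (hasU : ∀ a ∈ as, a ∈ U) (s : Store U) (hsM : s.nvar vM = M)
    (Z : Finset (Fin q.d → ℝ)) (hZ : Inv Z s)
    (hdis : ∀ t ∈ Z, ∃ a ∈ U, a ∉ as ∧ cell a (t a) ≠ s.nvar (vBox a)) :
    Runs f T (boxLoop body as) s (M ^ as.length * (c + 16 * as.length))
      (Inv (Z ∪ resultsWith D U fun a v => a ∉ as → cell a v = s.nvar (vBox a))) := by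
  induction as generalizing s Z with
  | nil =>
    simpa [boxLoop] using hbody Z s hZ (by simpa using hdis)
  | cons a as ih =>
    have hM0 : 0 < M := lt_of_le_of_lt (Nat.zero_le _) (hM a 0)
    rw [List.nodup_cons] at has
    have hbox : ∀ b, b ≠ a → (Loc.nv (vBox b) : Loc U) ≠ .nv (vBox a) := by
      intro b hb
      simp only [ne_eq, Loc.nv.injEq, NVar.tmp.injEq, nm_inj, true_and, and_true]
      exact fun h => hb (Fin.ext h)
    have hinner : ∀ b, b ∉ as → (Loc.nv (vBox b) : Loc U) ∉ (boxLoop body as).writes := by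
      intro b hb hh
      rcases boxLoop_writes _ _ _ hh with h | ⟨b', hb', h⟩
      · exact (hw _ h).1 (by simp)
      · simp only [Loc.nv.injEq, NVar.tmp.injEq, nm_inj, true_and, and_true] at h
        exact hb (Fin.ext h ▸ hb')
    have hMw : (Loc.nv vM : Loc U) ∉ (boxLoop body as).writes := by
      intro hh
      rcases boxLoop_writes _ _ _ hh with h | ⟨b', hb', h⟩
      · exact (hw _ h).2 (by simp)
      · simp at h
    refine Runs.mono (t := M * (M ^ as.length * (c + 16 * as.length) + 9) + 7) ?_ ?_ fun _ _ h => h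
    rotate_left
    -- The overhead `9 * M + 7` of this loop is at most `16 * M ^ (as.length + 1)`, as `M` is
    -- positive.
    · have : 1 ≤ M ^ as.length := Nat.one_le_pow _ _ hM0
      simp only [List.length_cons, pow_succ]
      nlinarith [Nat.mul_le_mul_left (16 * M) this]
    have haU : a ∈ U := hasU a (by simp)
    -- With counter `i`, the results done are `Z` and those that agree with the outer coordinates
    -- and have a cell below `i` in direction `a`.
    refine runs_forN (fun i s' => Inv (Z ∪ resultsWith D U fun b v =>
      (b ∉ a :: as → cell b v = s.nvar (vBox b)) ∧ (b = a → cell b v < i)) s') M hsM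
      (by simp) (hinner a has.1) hMw ?_ (fun i s v h => hInv _ _ _ _ h) ?_ ?_
    · convert hZ using 1
      rw [Finset.union_eq_left]
      intro t ht
      rw [mem_resultsWith] at ht
      exact absurd ((ht.2 a haU).2 rfl) (Nat.not_lt_zero _)
    · intro i hi s' ha hsi hI
      have hbb : ∀ b, b ∉ a :: as → s'.nvar (vBox b) = s.nvar (vBox b) := by
        intro b hb
        simp only [List.mem_cons, not_or] at hb
        refine ha.nv _ ?_
        rw [Set.mem_insert_iff, not_or]
        exact ⟨hbox b hb.1, hinner b hb.2⟩
      have hsM' : s'.nvar vM = M := by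
        rw [ha.nv _ ?_, hsM]
        rw [Set.mem_insert_iff, not_or]
        exact ⟨by simp, hMw⟩
      refine (ih has.2 (fun b hb => hasU b (by simp [hb])) s' hsM' _ hI ?_).mono le_rfl
        fun s'' _ h => ?_
      · intro t ht
        rcases Finset.mem_union.1 ht with ht | ht
        · obtain ⟨b, hbU, hb, hne⟩ := hdis t ht
          refine ⟨b, hbU, fun h => hb (by simp [h]), ?_⟩
          rw [hbb b hb]; exact hne
        · rw [mem_resultsWith] at ht
          have := (ht.2 a haU).2 rfl
          exact ⟨a, haU, has.1, by omega⟩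
      · convert h using 1
        rw [Finset.union_assoc]
        congr 1
        ext t
        simp only [Finset.mem_union, mem_resultsWith]
        constructor
        · rintro ⟨ht, h1⟩
          by_cases hlt : cell a (t a) < i
          · refine .inl ⟨ht, fun b hb => ⟨(h1 b hb).1, ?_⟩⟩
            rintro rfl
            exact hlt
          · refine .inr ⟨ht, fun b hb hbas => ?_⟩
            by_cases hba : b = a
            · subst hba
              have := (h1 b hb).2 rfl
              omega
            · have hb' : b ∉ a :: as := by simp [hba, hbas]
              rw [hbb b hb']
              exact (h1 b hb).1 hb'
        · rintro (⟨ht, h1⟩ | ⟨ht, h1⟩)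
          · exact ⟨ht, fun b hb => ⟨(h1 b hb).1, fun hba => by have := (h1 b hb).2 hba; omega⟩⟩
          · refine ⟨ht, fun b hb => ⟨fun hb' => ?_, ?_⟩⟩
            · rw [← hbb b hb']
              exact h1 b hb fun h => hb' (by simp [h])
            · rintro rfl
              have := h1 b hb has.1
              omega
    · intro s' _ h
      convert h using 1
      congr 1
      ext t
      simp only [mem_resultsWith]
      refine and_congr_right fun _ => forall₂_congr fun b hb => ?_
      exact ⟨fun h => ⟨h, fun _ => hM _ _⟩, fun h => h.1⟩

end Boxes

/-! ### Clustering the coreset and evaluating the solution -/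

section Finish
variable {q : JoinQuery} {U : Finset (Fin q.d)}

abbrev vCore : NVar q := .tmp (nm 50 0 0)

noncomputable def loadCore (U : Finset (Fin q.d)) : Prog U :=
  seqAll (Finset.univ : Finset {a // a ∈ U}).toList fun a =>
    .setR (rPt a) (.arr (.corePt a) (.var vCore))

noncomputable def costStep (U : Finset (Fin q.d)) : Prog U :=
  .seq (loadCore U) <| .seq (minDist .sol .k)
    (.setR .ru (.plus (.var .ru) (.times (.arr .coreWt (.var vCore)) (.var rMin))))

/-- Cluster the coreset and bound the cost of the solution. -/
noncomputable def finish (U : Finset (Fin q.d)) : Prog U :=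
  .seq .cluster <| .cond (.nle (.var .numC) (.var .k)) (.setR .ru (.const 0)) <|
    .seq (.setR .ru (.const 0)) <| .seq (forN vCore .numC (costStep U))
      (.setR .ru (.over (.var .ru) (.minus (.const 1) (.over (.var .eps) (.const 8)))))

theorem loadCore_writes : ∀ l ∈ (loadCore U).writes, ∃ a : {a // a ∈ U}, l = .rv (rPt a) := by
  intro l hl
  obtain ⟨a, -, ha⟩ := mem_seqAll_writes.1 hl
  exact ⟨a, ha⟩

theorem costStep_writes : ∀ l ∈ (costStep U).writes, l.kind ∈ Set.Icc 41 43 ∨ l = .rv .ru := by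
  intro l hl
  rcases hl with h | h | h
  · obtain ⟨a, rfl⟩ := loadCore_writes l h
    simp
  · have := minDist_kind _ _ l h
    simp at this ⊢; omega
  · exact .inr h

/-- The weighted points `0, ..., n - 1` as a list. -/
def weightedList {E : Type*} (n : ℕ) (pt : ℕ → E) (wt : ℕ → ℝ) : List (E × ℝ) :=
  (List.range n).map fun i => (pt i, wt i)

theorem coreset_eq (s : Store U) :
    s.coreset = weightedList (s.nvar .numC) (ptAt s .corePt) (s.rarr .coreWt) := rfl

theorem cost_weightedList {E : Type*} [PseudoMetricSpace E] (n : ℕ) (pt : ℕ → E) (wt : ℕ → ℝ)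
    (Y : Set E) : cost (weightedList n pt wt : Multiset (E × ℝ)) Y =
      ∑ i ∈ Finset.range n, wt i * Metric.infDist (pt i) Y := by
  simp only [cost, weightedList, Multiset.map_coe, List.map_map, Function.comp_def]
  rfl

/-- Evaluating the cost takes about `numC * k` steps, and `k` may be arbitrarily large. For `numC ≤
k` the value 0 is returned without evaluation; otherwise `k < numC`, and the time is quadratic in
the size of the coreset. -/
theorem finish_runs (U : Finset (Fin q.d)) :
    ∃ c, ∀ (f : List (Pt U × ℝ) → List (Pt U)) (T : ℕ → ℕ) (s : Store U), 1 ≤ s.nvar .k →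
      (f s.coreset).length = s.nvar .k →
      Runs f T (finish U) s (T (s.nvar .numC) + c * ((s.nvar .numC + 1) * (s.nvar .numC + 1)))
        fun s' => s'.coreset = s.coreset ∧ s'.solution (s.nvar .k) = {p | p ∈ f s.coreset} ∧
          s'.rvar .ru = if s.nvar .numC ≤ s.nvar .k then 0 else
            cost (s.coreset : Multiset (Pt U × ℝ)) {p | p ∈ f s.coreset} /
              (1 - s.rvar .eps / 8) := by
  obtain ⟨c₁, h₁⟩ := minDist_runs (q := q) (U := U) .sol .k (by simp)
  set c₂ := (Finset.univ : Finset {a // a ∈ U}).toList.length * 3 + 1 with hc₂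
  refine ⟨c₁ + c₂ + 50, fun f T s hk hlen => ?_⟩
  set n := s.nvar .numC with hn
  set k := s.nvar .k with hk'
  set S := f s.coreset with hS
  refine Runs.mono (t := T n + 1 + (3 + (2 + (n * ((c₂ + (c₁ * (n + 1) + 7)) + 9) + 7 + 8)) + 1))
    ?_ ?_ fun _ _ h => h
  rotate_left
  · nlinarith [Nat.zero_le (c₁ * n), Nat.zero_le (c₂ * n), Nat.zero_le (c₂ * (n * n)),
      Nat.zero_le (n * n)]
  refine Runs.seq (R := fun s' => s' = s.putSolution S) ⟨_, _, .cluster s, le_rfl, rfl⟩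
    fun s₁ ha₁ hs₁ => ?_
  have hN₁ : s₁.nvar = s.nvar := by rw [hs₁]; rfl
  have hR₁ : s₁.rvar = s.rvar := by rw [hs₁]; rfl
  have hP₁ : ptAt s₁ .corePt = ptAt s .corePt := ptAt_agree ha₁ fun a => by simp
  have hW₁ : s₁.rarr .coreWt = s.rarr .coreWt := ha₁.ra _ (by simp)
  have hsol₁ : {x | ∃ i < k, x = ptAt s₁ .sol i} = {p | p ∈ S} := by
    have hpt : ∀ i (h : i < S.length), ptAt s₁ .sol i = S[i] := by
      intro i hi
      rw [hs₁]
      ext a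
      simp [ptAt, Store.putSolution, hi]
    ext x
    simp only [Set.mem_ofPred_eq, List.mem_iff_getElem]
    constructor
    · rintro ⟨i, hi, rfl⟩
      exact ⟨i, by omega, (hpt i (by omega)).symm⟩
    · rintro ⟨i, hi, rfl⟩
      exact ⟨i, by omega, (hpt i hi).symm⟩
  have hfin : ∀ {s' : Store U} {W : Set (Loc U)}, Agree W s₁ s' →
      (∀ l ∈ W, l.kind ∈ Set.Icc 41 50 ∨ l = .rv .ru) →
      s'.coreset = s.coreset ∧ s'.solution k = {p | p ∈ S} := by
    intro s' W ha hW
    have hnot : ∀ l : Loc U, l.kind ∈ ({0, 1} : Set ℕ) → l ∉ W := by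
      intro l hl hlW
      rcases hW l hlW with h | rfl
      · simp at hl h; omega
      · simp at hl
    have hnot' : ∀ a, (Loc.ra (.sol a) : Loc U) ∉ W := by
      intro a hlW
      rcases hW _ hlW with h | h <;> simp at h
    refine ⟨?_, ?_⟩
    · rw [coreset_eq, coreset_eq, ptAt_agree ha fun a => hnot _ (by simp),
        ha.nv _ (hnot _ (by simp)), ha.ra _ (hnot _ (by simp)), hP₁, hW₁, hN₁]
    · rw [← hsol₁, ← ptAt_agree (b := .sol) ha hnot']
      rfl
  refine Runs.cond (fun hc => ?_) (fun hc => ?_)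
  · simp only [Test.holds, NExp.eval, hN₁] at hc
    refine ⟨_, _, .setR _ _ _, by simp [RExp.steps], ?_⟩
    obtain ⟨h1, h2⟩ := hfin (agree_setR s₁ .ru ((RExp.const 0 : RExp U).eval s₁)) (by simp)
    refine ⟨h1, h2, ?_⟩
    rw [if_pos hc]
    simp [RExp.eval]
  · simp only [Test.holds, NExp.eval, hN₁] at hc
    refine Runs.seq (R := fun s' => s' = s₁.setR .ru 0) ⟨_, _, .setR _ _ _, by simp [RExp.steps],
      by simp [RExp.eval]⟩ fun s₂ ha₂ hs₂ => ?_
    have hN₂ : s₂.nvar = s.nvar := by rw [hs₂]; exact hN₁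
    have hk₂ : ∀ l ∈ insert (Loc.nv vCore) (costStep U).writes,
        l.kind ∈ Set.Icc 41 50 ∨ l = .rv .ru := by
      rintro l (rfl | hl)
      · simp
      · rcases costStep_writes l hl with h | h
        · left; simp at h ⊢; omega
        · exact .inr h
    have hnot₂ : ∀ l : Loc U, l.kind = 0 ∨ l.kind = 1 ∨ (∃ a, l = .ra (.sol a)) →
        l ∉ insert (Loc.nv vCore) (costStep U).writes := by
      intro l hl hlW
      rcases hk₂ l hlW with h | rfl
      · rcases hl with hl | hl | ⟨a, rfl⟩
        · simp [hl] at h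
        · simp [hl] at h
        · simp at h
      · simp at hl
    refine Runs.seq (R := fun s' => s'.rvar .ru = ∑ i ∈ Finset.range n, s.rarr .coreWt i *
      Metric.infDist (ptAt s .corePt i) {p | p ∈ S}) ?_ fun s₃ ha₃ hs₃ => ?_
    · refine runs_forN (fun o s' => s'.rvar .ru = ∑ i ∈ Finset.range o, s.rarr .coreWt i *
        Metric.infDist (ptAt s .corePt i) {p | p ∈ S}) n (by rw [hN₂]) (by simp)
        (fun h => by rcases costStep_writes _ h with h | h <;> simp at h)
        (fun h => by rcases costStep_writes _ h with h | h <;> simp at h)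
        (by simp [hs₂]) (fun _ _ _ h => h) ?_ (fun _ _ h => h)
      intro o ho s₄ ha₄ hso hI
      have ha₄' : Agree (insert (Loc.rv .ru) (insert (Loc.nv vCore) (costStep U).writes)) s₁ s₄ := by
        refine Agree.trans (s₂ := s₂) ?_ (ha₄.mono (Set.subset_insert _ _))
        rw [hs₂]
        exact (agree_setR _ _ _).mono (by simp)
      have hnot₄ : ∀ l : Loc U, l.kind = 0 ∨ l.kind = 1 ∨ (∃ a, l = .ra (.sol a)) →
          l ∉ insert (Loc.rv .ru) (insert (Loc.nv vCore) (costStep U).writes) := by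
        intro l hl hlW
        rcases hlW with rfl | hlW
        · simp at hl
        · exact hnot₂ l hl hlW
      have hload : Runs f T (loadCore U) s₄ c₂ fun s' => curPt s' = ptAt s .corePt o := by
        refine runs_seqAll (fun l s' => ∀ a ∈ l, s'.rvar (rPt a) = s₄.rarr (.corePt a) o)
          (by simp) ?_ ?_
        · intro l₁ a l₂ hl s' ha hI
          have hnot : ∀ l : Loc U, (∀ a : {a // a ∈ U}, l ≠ .rv (rPt a)) →
              l ∉ (loadCore U).writes := by
            intro l h hl
            obtain ⟨a, ha⟩ := loadCore_writes l hl
            exact h a ha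
          have e1 : s'.nvar vCore = o := (ha.nv _ (hnot _ (by simp))).trans hso
          have e2 : s'.rarr (.corePt a) = s₄.rarr (.corePt a) := ha.ra _ (hnot _ (by simp))
          refine ⟨_, _, .setR _ _ _, by simp [NExp.steps, RExp.steps], fun b hb => ?_⟩
          by_cases hba : b = a
          · subst hba
            simp [RExp.eval, NExp.eval, e1, e2]
          · have hne : rPt b ≠ rPt a := by
              simp only [ne_eq, RVar.tmp.injEq, nm_inj, true_and, and_true]
              intro h; exact hba (Subtype.ext (Fin.ext h))
            rw [setR_rvar_ne _ _ _ _ hne]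
            exact hI b (by simpa [hba] using hb)
        · intro s' _ hI
          rw [← hP₁, ← ptAt_agree (b := .corePt) ha₄' fun a => hnot₄ _ (by simp)]
          unfold curPt ptAt
          congr 1; funext a
          exact hI a (by simp)
      refine hload.seq fun s₅ ha₅ hs₅ => ?_
      have hnot₅ : ∀ l : Loc U, l.kind = 0 ∨ l.kind = 1 ∨ l.kind = 2 ∨ l.kind = 50 →
          l ∉ (loadCore U).writes := by
        intro l h hl
        obtain ⟨a, rfl⟩ := loadCore_writes l hl
        simp at h
      have hk₅ : s₅.nvar .k = k := by
        rw [ha₅.nv _ (hnot₅ _ (by simp)), ha₄'.nv _ (hnot₄ _ (by simp)), hN₁]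
      have hsol₅ : ptAt s₅ .sol = ptAt s₁ .sol :=
        (ptAt_agree ha₅ fun a => hnot₅ _ (by simp)).trans
          (ptAt_agree ha₄' fun a => hnot₄ _ (.inr (.inr ⟨a, rfl⟩)))
      have hmin := h₁ f T s₅ (by omega)
      rw [hk₅, hs₅, hsol₅, hsol₁] at hmin
      -- This branch has `k < n`, so the distance to the `k` centers is found in time linear in `n`.
      refine (hmin.mono (Nat.mul_le_mul le_rfl (by omega)) fun _ _ h => h).seq
        fun s₆ ha₆ hs₆ => ?_
      have hnot₆ : ∀ l : Loc U, l.kind = 0 ∨ l.kind = 1 ∨ l.kind = 2 ∨ l.kind = 50 →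
          l ∉ (minDist (q := q) (U := U) .sol .k).writes := by
        intro l h hl
        have := minDist_kind _ _ l hl
        simp at this; omega
      refine ⟨_, _, .setR _ _ _, by simp [RExp.steps, NExp.steps], ?_⟩
      have e1 : s₆.rvar .ru = s₄.rvar .ru := (ha₆.rv _ (hnot₆ _ (by simp))).trans
        (ha₅.rv _ (hnot₅ _ (by simp)))
      have e2 : s₆.nvar vCore = o := ((ha₆.nv _ (hnot₆ _ (by simp))).trans
        (ha₅.nv _ (hnot₅ _ (by simp)))).trans hso
      have e3 : s₆.rarr .coreWt = s.rarr .coreWt := ((ha₆.ra _ (hnot₆ _ (by simp))).trans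
        (ha₅.ra _ (hnot₅ _ (by simp)))).trans ((ha₄'.ra _ (hnot₄ _ (by simp))).trans hW₁)
      beta_reduce
      rw [Finset.sum_range_succ, setR_rvar]
      simp only [RExp.eval, NExp.eval, e1, e2, e3, hs₆, hI]
    · refine ⟨_, _, .setR _ _ _, by simp [RExp.steps], ?_⟩
      have ha₃' : Agree (insert (Loc.rv .ru) (insert (Loc.nv vCore) (costStep U).writes)) s₁
          (s₃.setR .ru ((RExp.over (.var .ru) (.minus (.const 1) (.over (.var .eps) (.const 8))) :
            RExp U).eval s₃)) := by
        refine Agree.trans (s₂ := s₂) ?_ (Agree.trans (s₂ := s₃) ?_ ?_)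
        · rw [hs₂]
          exact (agree_setR _ _ _).mono (by simp)
        · rw [forN_writes] at ha₃
          exact ha₃.mono (Set.subset_insert _ _)
        · exact (agree_setR _ _ _).mono (by simp)
      obtain ⟨h1, h2⟩ := hfin ha₃' (by
        rintro l (rfl | hl)
        · exact .inr rfl
        · exact hk₂ l hl)
      refine ⟨h1, h2, ?_⟩
      have e1 : s₃.rvar .eps = s.rvar .eps := by
        rw [ha₃.rv _ (by rw [forN_writes]; exact hnot₂ _ (by simp)), hs₂]
        simp [hR₁]
      rw [if_neg hc, setR_rvar, coreset_eq, cost_weightedList]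
      simp [RExp.eval, e1, hs₃, ← hn]

end Finish

/-! ### Weighted sets and sets of exactly k centers -/

section WeightedSets
variable {E : Type*} {C : List (E × ℝ)} {k : ℕ}

/-- Sets of centers need exactly `k` elements. An infinite space leaves room to fill up a smaller
set, even while avoiding finitely many points. -/
theorem exists_superset_encard [Infinite E] {S : Set E} {V : Set E} (hV : V.Finite)
    (hSV : Disjoint S V) (hS : S.encard ≤ k) : ∃ Y, S ⊆ Y ∧ Disjoint Y V ∧ Y.encard = k := by
  have hinf : (Vᶜ).encard = ⊤ := Set.encard_eq_top_iff.2 hV.infinite_compl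
  obtain ⟨Y, h1, h2, h3⟩ := Set.exists_superset_subset_encard_eq
    (Set.subset_compl_iff_disjoint_right.2 hSV) hS (hinf ▸ le_top)
  exact ⟨Y, h1, Set.subset_compl_iff_disjoint_right.1 h2, h3⟩

theorem IsWeightedSet.nonneg (hC : IsWeightedSet C) :
    ∀ p ∈ (C : Multiset (E × ℝ)), 0 ≤ p.2 := fun p hp => (hC.2 p (by simpa using hp)).le

theorem IsWeightedSet.encard (hC : IsWeightedSet C) :
    {x | x ∈ C.map Prod.fst}.encard = C.length := by
  classical
  have h := List.toFinset_card_of_nodup hC.1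
  have h2 : {x | x ∈ C.map Prod.fst} = ((C.map Prod.fst).toFinset : Set E) := by ext x; simp
  rw [h2, Set.encard_coe_eq_coe_finsetCard, h, List.length_map]

theorem encard_setOf_mem_list {l : List E} (h : l.Nodup) : {x | x ∈ l}.encard = l.length := by
  classical
  have h2 : {x | x ∈ l} = (l.toFinset : Set E) := by ext x; simp
  rw [h2, Set.encard_coe_eq_coe_finsetCard, List.toFinset_card_of_nodup h]

end WeightedSets

/-! ### Guarantees that pass from a coreset to the point set -/

section Approximation
variable {E : Type*} [MetricSpace E] {P : Multiset (E × ℝ)} {C : List (E × ℝ)} {k : ℕ}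

theorem cost_nonneg (hP : ∀ p ∈ P, 0 ≤ p.2) (Y : Set E) : 0 ≤ cost P Y := by
  refine Multiset.sum_nonneg fun x hx => ?_
  obtain ⟨p, hp, rfl⟩ := Multiset.mem_map.1 hx
  exact mul_nonneg (hP p hp) Metric.infDist_nonneg

theorem cost_le_mul {Y Y' : Set E} {c : ℝ} (hP : ∀ p ∈ P, 0 ≤ p.2)
    (h : ∀ p ∈ P, Metric.infDist p.1 Y ≤ c * Metric.infDist p.1 Y') :
    cost P Y ≤ c * cost P Y' := by
  rw [cost, cost, ← Multiset.sum_map_mul_left]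
  refine Multiset.sum_map_le_sum_map _ _ fun p hp => ?_
  calc p.2 * Metric.infDist p.1 Y ≤ p.2 * (c * Metric.infDist p.1 Y') :=
        mul_le_mul_of_nonneg_left (h p hp) (hP p hp)
    _ = c * (p.2 * Metric.infDist p.1 Y') := by ring

theorem cost_eq_zero {Y : Set E} (h : ∀ p ∈ P, p.1 ∈ Y) : cost P Y = 0 := by
  refine Multiset.sum_eq_zero fun x hx => ?_
  obtain ⟨p, hp, rfl⟩ := Multiset.mem_map.1 hx
  rw [Metric.infDist_zero_of_mem (h p hp), mul_zero]

theorem mul_infDist_le_cost (hP : ∀ p ∈ P, 0 ≤ p.2) {p : E × ℝ} (hp : p ∈ P) (Y : Set E) :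
    p.2 * Metric.infDist p.1 Y ≤ cost P Y := by
  refine Multiset.single_le_sum (fun x hx => ?_) _ (Multiset.mem_map_of_mem _ hp)
  obtain ⟨p, hp, rfl⟩ := Multiset.mem_map.1 hx
  exact mul_nonneg (hP p hp) Metric.infDist_nonneg

theorem opt_le (hP : ∀ p ∈ P, 0 ≤ p.2) {Y : Set E} (hY : Y.encard = k) : opt k P ≤ cost P Y :=
  ciInf_le (f := fun Y : {Y : Set E // Y.encard = k} => cost P Y)
    ⟨0, by rintro _ ⟨Y, rfl⟩; exact cost_nonneg hP _⟩ ⟨Y, hY⟩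

theorem optDisc_le (hP : ∀ p ∈ P, 0 ≤ p.2) {Y : Set E} (hY : Y.encard = k)
    (hYP : ∀ y ∈ Y, ∃ p ∈ P, p.1 = y) : optDisc k P ≤ cost P Y :=
  ciInf_le (f := fun Y : {Y : Set E // Y.encard = k ∧ ∀ y ∈ Y, ∃ p ∈ P, p.1 = y} => cost P Y)
    ⟨0, by rintro _ ⟨Y, rfl⟩; exact cost_nonneg hP _⟩ ⟨Y, hY, hYP⟩

theorem opt_nonneg (hP : ∀ p ∈ P, 0 ≤ p.2) : 0 ≤ opt k P :=
  Real.iInf_nonneg fun _ => cost_nonneg hP _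

theorem optDisc_nonneg (hP : ∀ p ∈ P, 0 ≤ p.2) : 0 ≤ optDisc k P :=
  Real.iInf_nonneg fun _ => cost_nonneg hP _

theorem IsCoreset.opt_le [Infinite E] {ε : ℝ} (hε : 0 ≤ ε) (hC : IsWeightedSet C)
    (h : IsCoreset k ε C P) : opt k (C : Multiset (E × ℝ)) ≤ (1 + ε) * opt k P := by
  obtain ⟨Y₀, -, -, hY₀⟩ := exists_superset_encard (E := E) (k := k) (S := ∅) Set.finite_empty
    (Set.disjoint_empty _) (by simp)
  have : Nonempty {Y : Set E // Y.encard = k} := ⟨⟨Y₀, hY₀⟩⟩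
  rw [← div_le_iff₀' (by linarith)]
  refine le_ciInf fun ⟨Y, hY⟩ => ?_
  rw [div_le_iff₀' (by linarith)]
  exact (RelCluster.opt_le hC.nonneg hY).trans (h Y hY).2

/-- With fewer than `k` coreset points, some `k` centers contain all of them and still miss some
point of `P`. Their cost is zero on the coreset but positive on `P`. Hence the discrete black box
may be called on the coreset. -/
theorem IsCoreset.length_ge [Infinite E] {ε : ℝ} (hε : ε < 1) (hk : 1 ≤ k)
    (hP : ∀ p ∈ P, 0 < p.2) (hC : IsWeightedSet C) (h : IsCoreset k ε C P)
    (hex : ∃ Y : Set E, Y.encard = k ∧ ∀ y ∈ Y, ∃ p ∈ P, p.1 = y) : k ≤ C.length := by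
  by_contra! hlt
  obtain ⟨Y₀, hY₀, hYP⟩ := hex
  set S := {x | x ∈ C.map Prod.fst} with hS
  have hSk : S.encard < Y₀.encard := by rw [hC.encard, hY₀]; exact_mod_cast hlt
  obtain ⟨y, hy, hyS⟩ : ∃ y ∈ Y₀, y ∉ S := by
    by_contra! hsub
    exact absurd (Set.encard_le_encard hsub) (not_le.2 hSk)
  obtain ⟨p, hp, rfl⟩ := hYP y hy
  obtain ⟨Y, hSY, hYd, hYk⟩ := exists_superset_encard (Set.finite_singleton p.1)
    (Set.disjoint_singleton_right.2 hyS) (hY₀ ▸ hSk.le)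
  have h0 : cost (C : Multiset (E × ℝ)) Y = 0 :=
    cost_eq_zero fun p hp => hSY (List.mem_map_of_mem (by simpa using hp))
  have hYfin : Y.Finite := Set.finite_of_encard_eq_coe hYk
  have hYne : Y.Nonempty := by
    rw [← Set.encard_ne_zero, hYk]
    exact_mod_cast (by omega : k ≠ 0)
  have hpos : 0 < Metric.infDist p.1 Y := by
    rw [← hYfin.isClosed.notMem_iff_infDist_pos hYne]
    exact Set.disjoint_singleton_right.1 hYd
  have h1 := mul_infDist_le_cost (fun p hp => (hP p hp).le) hp Y
  have h2 := (h Y hYk).1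
  rw [h0] at h2
  nlinarith [mul_pos (hP p hp) hpos]

/-- Each center is moved to its nearest coreset point. For a coreset point `p` served by `y`, this
moves `y` by at most its distance to `p`, and the triangle inequality gives the factor 2. Images may
collide, so the set is filled up to `k` points. -/
theorem optDisc_le_two_mul_cost (hC : IsWeightedSet C) (hk : 1 ≤ k) (hlen : k ≤ C.length)
    {Y : Set E} (hY : Y.encard = k) :
    optDisc k (C : Multiset (E × ℝ)) ≤ 2 * cost (C : Multiset (E × ℝ)) Y := by
  classical
  set S := {x | x ∈ C.map Prod.fst} with hS
  have hSfin : S.Finite := List.finite_toSet _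
  have hSne : S.Nonempty := by
    rw [← Set.encard_ne_zero, hC.encard]
    exact_mod_cast (by omega : C.length ≠ 0)
  have hYfin : Y.Finite := Set.finite_of_encard_eq_coe hY
  have hYne : Y.Nonempty := by
    rw [← Set.encard_ne_zero, hY]
    exact_mod_cast (by omega : k ≠ 0)
  choose g hgS hg using fun y : E => hSfin.isCompact.exists_infDist_eq_dist hSne y
  obtain ⟨Y', h1, h2, h3⟩ := Set.exists_superset_subset_encard_eq (s := g '' Y) (t := S) (k := k)
    (Set.image_subset_iff.2 fun y _ => hgS y) ((Set.encard_image_le g Y).trans hY.le)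
    (by rw [hC.encard]; exact_mod_cast hlen)
  refine (optDisc_le hC.nonneg h3 fun y hy => ?_).trans (cost_le_mul hC.nonneg fun p hp => ?_)
  · simpa [hS] using h2 hy
  · obtain ⟨y, hy, hpy⟩ := hYfin.isCompact.exists_infDist_eq_dist hYne p.1
    have h4 : dist y (g y) ≤ dist y p.1 := by
      rw [← hg y]
      exact Metric.infDist_le_dist_of_mem (List.mem_map_of_mem (by simpa using hp))
    calc Metric.infDist p.1 Y' ≤ dist p.1 (g y) :=
          Metric.infDist_le_dist_of_mem (h1 (Set.mem_image_of_mem _ hy))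
      _ ≤ dist p.1 y + dist y (g y) := dist_triangle _ _ _
      _ ≤ 2 * Metric.infDist p.1 Y := by rw [hpy, dist_comm y p.1] at *; linarith

/-- Centers allowed for `P` may be missing from the coreset, so they are compared with the discrete
optimum of the coreset through `optDisc_le_two_mul_cost`. -/
theorem IsCoreset.optDisc_le {ε : ℝ} (hε : 0 ≤ ε) (hC : IsWeightedSet C) (hk : 1 ≤ k)
    (hlen : k ≤ C.length) (h : IsCoreset k ε C P)
    (hex : ∃ Y : Set E, Y.encard = k ∧ ∀ y ∈ Y, ∃ p ∈ P, p.1 = y) :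
    optDisc k (C : Multiset (E × ℝ)) ≤ 2 * (1 + ε) * optDisc k P := by
  obtain ⟨Y₀, hY₀, hYP₀⟩ := hex
  have : Nonempty {Y : Set E // Y.encard = k ∧ ∀ y ∈ Y, ∃ p ∈ P, p.1 = y} := ⟨⟨Y₀, hY₀, hYP₀⟩⟩
  rw [← div_le_iff₀' (by linarith)]
  refine le_ciInf fun ⟨Y, hY, hYP⟩ => ?_
  rw [div_le_iff₀' (by linarith)]
  have := optDisc_le_two_mul_cost hC hk hlen hY
  have := (h Y hY).2
  linarith

/-- The bound for the cost of the centers `S` that is computed from a coreset. -/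
noncomputable def costBound (k : ℕ) (ε : ℝ) (C : List (E × ℝ)) (S : Set E) : ℝ :=
  if C.length ≤ k then 0 else cost (C : Multiset (E × ℝ)) S / (1 - ε / 8)

/-- Dividing the coreset cost by `1 - ε / 8` turns the lower coreset inequality into an upper bound
for the true cost. The parameter `c` is 1 in the geometric and 2 in the discrete case. -/
theorem costBound_spec {ε ω c γ : ℝ} (hε : 0 < ε) (hε1 : ε < 1) (hγ : 1 ≤ γ) (hω : 0 ≤ ω)
    (hc : 1 ≤ c) (hc2 : c ≤ 2) (h : IsCoreset k (ε / 8) C P) {S : Set E} (hS : S.encard = k)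
    (hle : cost (C : Multiset (E × ℝ)) S ≤ γ * (c * (1 + ε / 8) * ω))
    (h0 : C.length ≤ k → cost (C : Multiset (E × ℝ)) S ≤ 0) :
    cost P S ≤ costBound k ε C S ∧ costBound k ε C S ≤ (c + ε) * γ * ω := by
  have h1 := (h S hS).1
  have hpos : 0 < 1 - ε / 8 := by linarith
  have hγω : 0 ≤ γ * ω := mul_nonneg (by linarith) hω
  unfold costBound
  split_ifs with hlen
  · have := h0 hlen
    refine ⟨?_, by have : 0 ≤ (c + ε) * (γ * ω) := mul_nonneg (by linarith) hγω
                   linarith⟩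
    by_contra! hlt
    nlinarith
  · refine ⟨by rw [le_div_iff₀' hpos]; exact h1, ?_⟩
    rw [div_le_iff₀ hpos]
    refine hle.trans ?_
    -- The difference of the sides is ε(1 - c/4 - ε/8), which is positive for c ≤ 2 and ε < 1. This
    -- is why precision ε/8 is enough.
    have h2 : c * (1 + ε / 8) ≤ (c + ε) * (1 - ε / 8) := by
      nlinarith [mul_le_mul_of_nonneg_right hc2 hε.le]
    nlinarith [mul_le_mul_of_nonneg_right h2 hγω]

theorem geometric_guarantee [Infinite E] {ε γ : ℝ} {f : List (E × ℝ) → List E} (hε : 0 < ε)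
    (hε1 : ε < 1) (hγ : 1 ≤ γ) (hP : ∀ p ∈ P, 0 < p.2) (hC : IsWeightedSet C)
    (h : IsCoreset k (ε / 8) C P) (hf : IsGeomApprox k γ f) :
    (f C).length = k ∧ {p | p ∈ f C}.encard = k ∧
      cost P {p | p ∈ f C} ≤ costBound k ε C {p | p ∈ f C} ∧
      costBound k ε C {p | p ∈ f C} ≤ (1 + ε) * γ * opt k P := by
  obtain ⟨h1, h2, h3⟩ := hf C hC
  have hS : {p | p ∈ f C}.encard = k := by rw [encard_setOf_mem_list h1, h2]
  refine ⟨h2, hS, costBound_spec hε hε1 hγ (opt_nonneg fun p hp => (hP p hp).le) le_rfl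
    one_le_two h hS ?_ ?_⟩
  · have := mul_le_mul_of_nonneg_left (h.opt_le (by linarith) hC) (by linarith : (0 : ℝ) ≤ γ)
    linarith
  -- At most `k` coreset points can all be centers, so the optimum of the coreset is 0, and with it
  -- the cost of the approximate solution.
  · intro hlen
    obtain ⟨Y, hY1, -, hY2⟩ := exists_superset_encard (k := k) (S := {x | x ∈ C.map Prod.fst})
      Set.finite_empty (Set.disjoint_empty _) (by rw [hC.encard]; exact_mod_cast hlen)
    have h4 := RelCluster.opt_le hC.nonneg hY2
    rw [cost_eq_zero fun p hp => hY1 (List.mem_map_of_mem (by simpa using hp))] at h4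
    nlinarith

theorem discrete_guarantee [Infinite E] {ε γ : ℝ} {f : List (E × ℝ) → List E} (hε : 0 < ε)
    (hε1 : ε < 1) (hγ : 1 ≤ γ) (hk : 1 ≤ k) (hP : ∀ p ∈ P, 0 < p.2) (hC : IsWeightedSet C)
    (h : IsCoreset k (ε / 8) C P) (hf : IsDiscApprox k γ f)
    (hex : ∃ Y : Set E, Y.encard = k ∧ ∀ y ∈ Y, ∃ p ∈ P, p.1 = y) :
    (f C).length = k ∧ {p | p ∈ f C}.encard = k ∧ (∀ y ∈ f C, y ∈ C.map Prod.fst) ∧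
      cost P {p | p ∈ f C} ≤ costBound k ε C {p | p ∈ f C} ∧
      costBound k ε C {p | p ∈ f C} ≤ (2 + ε) * γ * optDisc k P := by
  have hlen := h.length_ge (by linarith) hk hP hC hex
  obtain ⟨h1, h2, h5, h3⟩ := hf C hC hlen
  have hS : {p | p ∈ f C}.encard = k := by rw [encard_setOf_mem_list h1, h2]
  refine ⟨h2, hS, h5, costBound_spec hε hε1 hγ (optDisc_nonneg fun p hp => (hP p hp).le)
    one_le_two le_rfl h hS ?_ ?_⟩
  · have := mul_le_mul_of_nonneg_left (h.optDisc_le (by linarith) hC hk hlen hex)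
      (by linarith : (0 : ℝ) ≤ γ)
    linarith
  · intro hlen'
    have h4 := RelCluster.optDisc_le (k := k) hC.nonneg
      (Y := {x | x ∈ C.map Prod.fst}) (by rw [hC.encard, le_antisymm hlen' hlen])
      fun y hy => by simpa using hy
    rw [cost_eq_zero fun p hp => List.mem_map_of_mem (by simpa using hp)] at h4
    nlinarith

end Approximation

/-! ### Geometry of the cells -/

section Cells

/-- Both values lie between the same two consecutive cuts around `c`, and the gap between these cuts
is small compared with the distance to `c`, up to the additive σ. -/
theorem abs_sub_le_of_same_cuts {y : ℕ → ℝ} {J : ℕ} {δ σ r c v v' : ℝ} (hδ : 0 ≤ δ) (hσ : 0 ≤ σ)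
    (hy0 : y 0 = 0) (hy : ∀ l ≤ J, y (l + 1) = δ * σ * (1 + δ) ^ l) (hyr : r ≤ y (J + 1))
    (hv : |v - c| ≤ r)
    (hcut : ∀ l < J + 2, (c - y l ≤ v ↔ c - y l ≤ v') ∧ (c + y l < v ↔ c + y l < v')) :
    |v - v'| ≤ δ * (|v - c| + σ) := by
  -- The first gap is `δ * σ`. Every later gap is δ times its lower end, hence at most `δ * u`.
  have hlevel : ∀ u, 0 < u → u ≤ r → ∃ l ≤ J, y l < u ∧ u ≤ y (l + 1) ∧
      y (l + 1) - y l ≤ δ * (u + σ) := by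
    intro u hu hur
    have hex : ∃ l, u ≤ y l := ⟨J + 1, hur.trans hyr⟩
    classical
    have h1 := Nat.find_spec hex
    have h2 : Nat.find hex ≤ J + 1 := Nat.find_min' hex (hur.trans hyr)
    have h3 : ∀ l < Nat.find hex, y l < u := fun l hl => not_le.1 (Nat.find_min hex hl)
    obtain ⟨l, hl⟩ : ∃ l, Nat.find hex = l + 1 := by
      refine Nat.exists_eq_succ_of_ne_zero fun h => ?_
      rw [h, hy0] at h1
      linarith
    rw [hl] at h1 h2 h3
    have hlt := h3 l (by omega)
    refine ⟨l, by omega, hlt, h1, ?_⟩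
    rcases l with _ | l
    · rw [hy 0 (by omega), hy0]
      nlinarith [mul_nonneg hδ hu.le]
    · rw [hy (l + 1) (by omega)] at *
      rw [hy l (by omega)] at *
      rw [pow_succ]
      nlinarith [mul_le_mul_of_nonneg_left hlt.le hδ, mul_nonneg hδ hσ]
  rcases lt_trichotomy v c with h | h | h
  · rw [abs_of_neg (sub_neg.2 h)] at hv ⊢
    obtain ⟨l, hl, h1, h2, h3⟩ := hlevel _ (by linarith : 0 < -(v - c)) hv
    have h4 := (hcut (l + 1) (by omega)).1.1 (by linarith)
    have h5 := mt (hcut l (by omega)).1.2 (by linarith)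
    rw [abs_le]
    constructor <;> linarith
  -- Level 0 cuts on both sides of `c` itself, so a value equal to `c` forms a cell of its own.
  · obtain ⟨h1, h2⟩ := hcut 0 (by omega)
    rw [hy0] at h1 h2
    have h4 := h1.1 (by linarith)
    have h5 := mt h2.2 (by linarith)
    have h6 : v' = v := by linarith
    rw [h6, sub_self, abs_zero]
    exact mul_nonneg hδ (add_nonneg (abs_nonneg _) hσ)
  · rw [abs_of_pos (sub_pos.2 h)] at hv ⊢
    obtain ⟨l, hl, h1, h2, h3⟩ := hlevel _ (by linarith : 0 < v - c) hv
    have h4 := (hcut l (by omega)).2.1 (by linarith)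
    have h5 := mt (hcut (l + 1) (by omega)).2.2 (by linarith)
    rw [abs_le]
    constructor <;> linarith

variable {q : JoinQuery} {U : Finset (Fin q.d)}

/-- The square root of the dimension is replaced by the dimension; only constants suffer. -/
theorem dist_le_card_mul {x y : Pt U} {b : ℝ} (h : ∀ a, |x a - y a| ≤ b) :
    dist x y ≤ U.card * b := by
  rw [EuclideanSpace.dist_eq]
  refine (Real.sqrt_le_sqrt (Finset.sum_le_sum fun a _ => ?_ :
    _ ≤ ∑ _a : {a // a ∈ U}, b ^ 2)).trans ?_
  · rw [Real.dist_eq]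
    exact pow_le_pow_left₀ (abs_nonneg _) (h a) 2
  · rw [Finset.sum_const, Finset.card_univ, Fintype.card_coe, nsmul_eq_mul]
    rcases U.eq_empty_or_nonempty with rfl | ⟨a, ha⟩
    · simp
    · have hb : 0 ≤ b := (abs_nonneg _).trans (h ⟨a, ha⟩)
      have h1 : (1 : ℝ) ≤ U.card := by exact_mod_cast Finset.card_pos.2 ⟨a, ha⟩
      rw [Real.sqrt_le_left (by positivity)]
      nlinarith [sq_nonneg b, mul_nonneg (sq_nonneg b) (by linarith : (0 : ℝ) ≤ U.card)]

theorem abs_sub_le_dist (x y : Pt U) (a : {a // a ∈ U}) : |x a - y a| ≤ dist x y := by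
  rw [dist_eq_norm, ← Real.norm_eq_abs]
  exact PiLp.norm_apply_le (x - y) a

theorem exists_center {X : List (Pt U)} (hX : X ≠ []) (p : Pt U) :
    ∃ i, ∃ h : i < X.length, Metric.infDist p {x | x ∈ X} = dist p X[i] := by
  obtain ⟨x, hx, h⟩ := (List.finite_toSet X).isCompact.exists_infDist_eq_dist
    (List.exists_mem_of_ne_nil X hX) p
  obtain ⟨i, hi, rfl⟩ := List.mem_iff_getElem.1 hx
  exact ⟨i, hi, h⟩

/-- The cells of the values of the attributes are determined by the given centers and by
distances that begin with `0` and then form a geometric progression up to `r`. -/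
structure CutCells (X : List (Pt U)) (δ σ r : ℝ) (cell : Fin q.d → ℝ → ℕ) : Prop where
  cuts : ∃ (y : ℕ → ℝ) (J : ℕ), y 0 = 0 ∧ (∀ l ≤ J, y (l + 1) = δ * σ * (1 + δ) ^ l) ∧
    r ≤ y (J + 1) ∧ ∀ a : {a // a ∈ U}, ∀ v v', cell a v = cell a v' →
      ∀ i (h : i < X.length), ∀ l < J + 2,
        (X[i] a - y l ≤ v ↔ X[i] a - y l ≤ v') ∧ (X[i] a + y l < v ↔ X[i] a + y l < v')

/-- The cuts of the center nearest to `t` suffice: in each coordinate the offset from it is at most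
the distance of `t` to `X`. -/
theorem CutCells.dist_le {X : List (Pt U)} {δ σ r : ℝ} {cell : Fin q.d → ℝ → ℕ}
    (h : CutCells X δ σ r cell) (hδ : 0 ≤ δ) (hσ : 0 ≤ σ) (hX : X ≠ []) {t t' : Fin q.d → ℝ}
    (hr : Metric.infDist (proj U t) {x | x ∈ X} ≤ r)
    (hcell : ∀ a ∈ U, cell a (t' a) = cell a (t a)) :
    dist (proj U t) (proj U t') ≤
      U.card * (δ * (Metric.infDist (proj U t) {x | x ∈ X} + σ)) := by
  obtain ⟨y, J, hy0, hy, hyr, hcut⟩ := h.cuts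
  obtain ⟨i, hi, hdist⟩ := exists_center hX (proj U t)
  refine dist_le_card_mul fun a => ?_
  have h1 : |t a - X[i] a| ≤ Metric.infDist (proj U t) {x | x ∈ X} := by
    rw [hdist]; exact abs_sub_le_dist (proj U t) X[i] a
  have h2 := abs_sub_le_of_same_cuts hδ hσ hy0 hy hyr (h1.trans hr)
    (hcut a _ _ (hcell a a.2).symm i hi)
  exact h2.trans (mul_le_mul_of_nonneg_left (by linarith) hδ)

end Cells

/-! ### The error of the coreset -/

section Coreset
variable {q : JoinQuery} {U : Finset (Fin q.d)}

theorem cost_joinProj (D : Instance q) (Y : Set (Pt U)) :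
    cost (unweighted (joinProj D U)) Y =
      ∑ t ∈ (joinSet_finite D).toFinset, Metric.infDist (proj U t) Y := by
  simp only [cost, unweighted, joinProj, Multiset.map_map, Function.comp_def, one_mul]
  rfl

theorem unweighted_pos {E : Type*} (P : Multiset E) : ∀ p ∈ unweighted P, 0 < p.2 := by
  intro p hp
  obtain ⟨x, -, rfl⟩ := Multiset.mem_map.1 hp
  exact one_pos

theorem mem_joinProj {D : Instance q} {p : Pt U} : p ∈ joinProj D U ↔ ∃ t ∈ joinSet D, p = proj U t := by
  simp [joinProj, eq_comm]

theorem infDist_le_of_cost_le {D : Instance q} {X : Set (Pt U)} {r : ℝ}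
    (hr : cost (unweighted (joinProj D U)) X ≤ r) {t : Fin q.d → ℝ} (ht : t ∈ joinSet D) :
    Metric.infDist (proj U t) X ≤ r := by
  refine le_trans ?_ hr
  rw [cost_joinProj]
  exact Finset.single_le_sum (f := fun t => Metric.infDist (proj U t) X)
    (fun _ _ => Metric.infDist_nonneg) (by simpa using ht)

theorem Represents.isWeightedSet {D : Instance q} {X : Set (Pt U)} {δ σ : ℝ}
    {cell : Fin q.d → ℝ → ℕ} {Z : Finset (Fin q.d → ℝ)} {n : ℕ} {pt : ℕ → Pt U} {wt : ℕ → ℝ}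
    (h : Represents D X δ σ cell Z n pt wt) (hδ : 0 ≤ δ) (hσ : 0 ≤ σ) :
    IsWeightedSet (weightedList n pt wt) := by
  obtain ⟨φ, -, h2, h3, -, h5⟩ := h
  have hne : ∀ i j, i < j → j < n → pt j ≠ pt i := by
    intro i j hij hj heq
    have := h5 i j hij hj
    rw [heq, dist_self] at this
    exact absurd this (not_lt.2 (mul_nonneg hδ (add_nonneg Metric.infDist_nonneg hσ)))
  constructor
  · simp only [weightedList, List.map_map]
    refine List.Nodup.map_on ?_ List.nodup_range
    intro i hi j hj hij
    simp only [List.mem_range, Function.comp] at hi hj hij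
    rcases lt_trichotomy i j with h | h | h
    · exact absurd hij.symm (hne i j h hj)
    · exact h
    · exact absurd hij (hne j i h hi)
  · intro p hp
    obtain ⟨i, hi, rfl⟩ := List.mem_map.1 hp
    rw [List.mem_range] at hi
    obtain ⟨t, ht, hti⟩ := h3 i hi
    simp only [h2 i hi]
    exact_mod_cast Finset.card_pos.2 ⟨t, Finset.mem_filter.2 ⟨ht, hti⟩⟩

theorem Represents.mem_joinProj {D : Instance q} {X : Set (Pt U)} {δ σ : ℝ}
    {cell : Fin q.d → ℝ → ℕ} {Z : Finset (Fin q.d → ℝ)} {n : ℕ} {pt : ℕ → Pt U} {wt : ℕ → ℝ}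
    (h : Represents D X δ σ cell Z n pt wt) : ∀ p ∈ weightedList n pt wt, p.1 ∈ joinProj D U := by
  obtain ⟨φ, -, -, -, h4, -⟩ := h
  intro p hp
  obtain ⟨i, hi, rfl⟩ := List.mem_map.1 hp
  exact RelCluster.mem_joinProj.2 (h4 i (List.mem_range.1 hi))

/-- Each result is moved to its coreset point, which is at distance at most (2d+1)δ(ρ+σ): once
through its box to the representative, once from there to the coreset point. Summing ρ+σ over all
results gives at most 2r. -/
theorem Represents.abs_cost_sub_le {D : Instance q} {X : List (Pt U)} {δ σ r : ℝ}
    {cell : Fin q.d → ℝ → ℕ} {n : ℕ} {pt : ℕ → Pt U} {wt : ℕ → ℝ}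
    (h : Represents D {x | x ∈ X} δ σ cell (joinSet_finite D).toFinset n pt wt) (hX : X ≠ [])
    (hcell : CutCells X δ σ r cell) (hδ : 0 ≤ δ) (hδ1 : δ ≤ 1) (hσ : 0 ≤ σ)
    (hr : cost (unweighted (joinProj D U)) {x | x ∈ X} ≤ r)
    (hσr : (joinSet_finite D).toFinset.card * σ ≤ r) (Y : Set (Pt U)) :
    |cost (weightedList n pt wt : Multiset (Pt U × ℝ)) Y -
      cost (unweighted (joinProj D U)) Y| ≤ (2 * U.card + 1) * δ * (2 * r) := by
  obtain ⟨φ, h1, h2, -, -, -⟩ := h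
  set Z := (joinSet_finite D).toFinset with hZ
  set d : ℝ := (U.card : ℝ) with hd
  have hd0 : 0 ≤ d := Nat.cast_nonneg _
  -- Weights are fiber sizes, so the weighted cost is a sum over join results, comparable term by
  -- term with the true cost.
  have hcost : cost (weightedList n pt wt : Multiset (Pt U × ℝ)) Y =
      ∑ t ∈ Z, Metric.infDist (pt (φ t)) Y := by
    rw [cost_weightedList, ← Finset.sum_fiberwise_of_maps_to (s := Z) (t := Finset.range n) (g := φ)
      fun t ht => Finset.mem_range.2 (h1 t ht).1]
    refine Finset.sum_congr rfl fun i hi => ?_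
    rw [h2 i (Finset.mem_range.1 hi), Finset.sum_congr rfl (g := fun _ => Metric.infDist (pt i) Y),
      Finset.sum_const, nsmul_eq_mul]
    intro t ht
    rw [(Finset.mem_filter.1 ht).2]
  rw [hcost, cost_joinProj, ← Finset.sum_sub_distrib]
  refine (Finset.abs_sum_le_sum_abs _ _).trans ?_
  have hpt : ∀ t ∈ Z, |Metric.infDist (pt (φ t)) Y - Metric.infDist (proj U t) Y| ≤
      (2 * d + 1) * δ * (Metric.infDist (proj U t) {x | x ∈ X} + σ) := by
    intro t ht
    obtain ⟨-, t', -, hc, hdist⟩ := h1 t ht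
    have htr := infDist_le_of_cost_le hr (show t ∈ joinSet D by simpa [hZ] using ht)
    have h3 := hcell.dist_le hδ hσ hX htr hc
    set ρ := Metric.infDist (proj U t) {x | x ∈ X} with hρ
    have hρ0 : 0 ≤ ρ := Metric.infDist_nonneg
    have h4 : Metric.infDist (proj U t') {x | x ∈ X} ≤ ρ + dist (proj U t) (proj U t') := by
      rw [dist_comm]; exact Metric.infDist_le_infDist_add_dist
    have h5 : dist (proj U t) (pt (φ t)) ≤ (2 * d + 1) * δ * (ρ + σ) := by
      have h6 := dist_triangle (proj U t) (proj U t') (pt (φ t))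
      have h7 := mul_le_mul_of_nonneg_left h4 hδ
      have h8 := mul_le_mul_of_nonneg_left h3 hδ
      have h9 : δ * (d * (δ * (ρ + σ))) ≤ d * (δ * (ρ + σ)) :=
        mul_le_of_le_one_left (by positivity) hδ1
      nlinarith
    have h6 : Metric.infDist (pt (φ t)) Y ≤ Metric.infDist (proj U t) Y +
        dist (pt (φ t)) (proj U t) := Metric.infDist_le_infDist_add_dist
    have h7 : Metric.infDist (proj U t) Y ≤ Metric.infDist (pt (φ t)) Y +
        dist (proj U t) (pt (φ t)) := Metric.infDist_le_infDist_add_dist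
    rw [dist_comm] at h6
    rw [abs_le]
    constructor <;> linarith
  refine (Finset.sum_le_sum hpt).trans ?_
  rw [← Finset.mul_sum, Finset.sum_add_distrib, ← cost_joinProj, Finset.sum_const, nsmul_eq_mul]
  refine mul_le_mul_of_nonneg_left ?_ (by positivity)
  linarith

/-- The error is at most (2d+1)δ·2α times the optimum, and δ is chosen to make this factor at most
ε/8. The optimum is at most the cost of any `k` centers, which makes the error relative to that
cost. -/
theorem Represents.isCoreset {D : Instance q} {X : List (Pt U)} {ε α σ r : ℝ} {k : ℕ}
    {cell : Fin q.d → ℝ → ℕ} {n : ℕ} {pt : ℕ → Pt U} {wt : ℕ → ℝ}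
    (h : Represents D {x | x ∈ X} (precision U.card ε α) σ cell (joinSet_finite D).toFinset n pt wt)
    (hX : X ≠ []) (hcell : CutCells X (precision U.card ε α) σ r cell)
    (hε : 0 < ε) (hε1 : ε < 1) (hσ : 0 ≤ σ)
    (hr : cost (unweighted (joinProj D U)) {x | x ∈ X} ≤ r)
    (hrα : r ≤ α * opt k (unweighted (joinProj D U)))
    (hσr : (joinSet_finite D).toFinset.card * σ ≤ r) :
    IsCoreset k (ε / 8) (weightedList n pt wt) (unweighted (joinProj D U)) := by
  set P := unweighted (joinProj D U) with hP
  set δ := precision U.card ε α with hδdef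
  set d : ℝ := (U.card : ℝ) with hd
  have hd0 : 0 ≤ d := Nat.cast_nonneg _
  have hden : 0 < 32 * (d + 2) * (1 + α * α) := by nlinarith [mul_self_nonneg α]
  have hδ : 0 < δ := div_pos hε hden
  have hδ1 : δ ≤ 1 := by
    rw [hδdef, precision, div_le_one hden]
    nlinarith [mul_self_nonneg α, mul_nonneg hd0 (mul_self_nonneg α)]
  have hP0 : ∀ p ∈ P, 0 ≤ p.2 := fun p hp => (unweighted_pos _ p hp).le
  have hopt : 0 ≤ opt k P := opt_nonneg hP0
  have hδα : (2 * d + 1) * δ * (2 * α) ≤ ε / 8 := by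
    rw [hδdef, precision]
    rw [show (2 * d + 1) * (ε / (32 * (d + 2) * (1 + α * α))) * (2 * α) =
      ((2 * d + 1) * ε * (2 * α)) / (32 * (d + 2) * (1 + α * α)) by ring, div_le_iff₀ hden]
    -- This holds for every real α and explains the factor `1 + α * α` in `precision`: it is
    -- positive whatever α is, and it dominates `2 * α`.
    have h1 : 2 * α ≤ 1 + α * α := by nlinarith [sq_nonneg (α - 1)]
    have h2 : (2 * d + 1) * ε * (2 * α) ≤ (2 * d + 1) * ε * (1 + α * α) :=
      mul_le_mul_of_nonneg_left h1 (by positivity)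
    have h3 : 0 ≤ ε * (1 + α * α) := mul_nonneg hε.le (by nlinarith [mul_self_nonneg α])
    nlinarith [mul_nonneg hd0 h3]
  intro Y hY
  have h1 := h.abs_cost_sub_le hX hcell hδ.le hδ1 hσ hr hσr Y
  have h2 : (2 * d + 1) * δ * (2 * r) ≤ ε / 8 * cost P Y := by
    calc (2 * d + 1) * δ * (2 * r) ≤ (2 * d + 1) * δ * (2 * (α * opt k P)) :=
          mul_le_mul_of_nonneg_left (by linarith) (by positivity)
      _ = ((2 * d + 1) * δ * (2 * α)) * opt k P := by ring
      _ ≤ ε / 8 * opt k P := mul_le_mul_of_nonneg_right hδα hopt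
      _ ≤ ε / 8 * cost P Y := mul_le_mul_of_nonneg_left (opt_le hP0 hY) (by linarith)
  rw [abs_le] at h1
  constructor <;> linarith

end Coreset

/-! ### Packing bound for the size of the coreset -/

section Packing
variable {q : JoinQuery} {U : Finset (Fin q.d)}

/-- Points with the same nearest center, the same dyadic level of ρ+σ and the same grid cell of the
offset from the center are closer than the separation permits. So these data determine the point,
and the bound counts them. -/
theorem Represents.le_packing {D : Instance q} {X : List (Pt U)} {δ σ r : ℝ}
    {cell : Fin q.d → ℝ → ℕ} {Z : Finset (Fin q.d → ℝ)} {n : ℕ} {pt : ℕ → Pt U} {wt : ℕ → ℝ}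
    (h : Represents D {x | x ∈ X} δ σ cell Z n pt wt) (hX : X ≠ []) (hU : U.Nonempty)
    (hδ : 0 < δ) (hσ : 0 ≤ σ) (hr : cost (unweighted (joinProj D U)) {x | x ∈ X} ≤ r)
    (hσr : r ≤ (joinSet_finite D).toFinset.card * σ) {L Q : ℕ}
    (hL : (joinSet_finite D).toFinset.card + 1 < 2 ^ L) (hQ : 2 * U.card / δ ≤ Q) :
    n ≤ X.length * (L * (2 * Q + 1) ^ U.card) := by
  classical
  obtain ⟨-, -, -, -, h4, h5⟩ := h
  set m := (joinSet_finite D).toFinset.card with hm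
  have hd : (0 : ℝ) < U.card := by exact_mod_cast hU.card_pos
  choose g hg hgd using fun i => exists_center hX (pt i)
  set ρ : ℕ → ℝ := fun i => Metric.infDist (pt i) {x | x ∈ X} with hρ
  have hρ0 : ∀ i, 0 ≤ ρ i := fun i => Metric.infDist_nonneg
  have hρr : ∀ i < n, ρ i ≤ m * σ := by
    intro i hi
    obtain ⟨t, ht, hpt⟩ := h4 i hi
    simp only [hρ, hpt]
    exact (infDist_le_of_cost_le hr ht).trans hσr
  -- The ratio (ρ+σ)/σ lies between 1 and the number of results plus one, because ρ ≤ r; this leaves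
  -- at most `L` dyadic levels.
  set lv : ℕ → ℕ := fun i => Nat.log 2 ⌊(ρ i + σ) / σ⌋₊ with hlv
  have hlow : ∀ i, 0 < σ → σ * 2 ^ lv i ≤ ρ i + σ := by
    intro i hpos
    rw [← le_div_iff₀' hpos]
    have h1 : 1 ≤ (ρ i + σ) / σ := by rw [le_div_iff₀ hpos]; linarith [hρ0 i]
    have h2 : ⌊(ρ i + σ) / σ⌋₊ ≠ 0 := by
      rw [← Nat.pos_iff_ne_zero, Nat.floor_pos]; exact h1
    exact le_trans (by exact_mod_cast Nat.pow_log_le_self 2 h2) (Nat.floor_le (by linarith))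
  have hupp : ∀ i, 0 < σ → ρ i + σ < σ * 2 ^ (lv i + 1) := by
    intro i hpos
    rw [← div_lt_iff₀' hpos]
    have h2 : ⌊(ρ i + σ) / σ⌋₊ + 1 ≤ 2 ^ (lv i + 1) :=
      Nat.lt_pow_succ_log_self (by norm_num) _
    exact (Nat.lt_floor_add_one _).trans_le (by exact_mod_cast h2)
  -- With this width, `U.card * w i` equals δσ times the power of two of the level, hence is at most
  -- the separation radius δ(ρ+σ). Offsets are below 2σ times that power, which is at most `Q`
  -- widths.
  set w : ℕ → ℝ := fun i => δ * σ * 2 ^ lv i / U.card with hw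
  set z : ℕ → {a // a ∈ U} → ℤ := fun i a =>
    ⌊(pt i a - (X[g i]'(hg i)) a) / w i⌋ with hz
  set tgt := Finset.range X.length ×ˢ Finset.range L ×ˢ
    Fintype.piFinset (fun _ : {a // a ∈ U} => Finset.Icc (-(Q : ℤ)) Q) with htgt
  have hcard : tgt.card = X.length * (L * (2 * Q + 1) ^ U.card) := by
    rw [htgt, Finset.card_product, Finset.card_product, Fintype.card_piFinset,
      Finset.prod_const, Finset.card_range, Finset.card_range, Int.card_Icc, Finset.card_univ,
      Fintype.card_coe]
    congr 3
    omega
  rw [← hcard]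
  conv_lhs => rw [← Finset.card_range n]
  refine Finset.card_le_card_of_injOn (fun i => (g i, lv i, z i)) ?_ ?_
  · intro i hi
    have hi' : i < n := by simpa using hi
    simp only [htgt, Finset.coe_product, Set.mem_prod, Finset.mem_coe, Finset.mem_range,
      Fintype.mem_piFinset, Finset.mem_Icc]
    refine ⟨hg i, ?_, fun a => ?_⟩
    · refine Nat.log_lt_of_lt_pow' ?_ ?_
      · rintro rfl
        simp at hL
      · refine lt_of_le_of_lt ?_ hL
        refine Nat.floor_le_of_le ?_
        rcases hσ.eq_or_lt with h0 | hpos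
        · rw [← h0, div_zero]; positivity
        · rw [div_le_iff₀ hpos]
          push_cast
          linarith [hρr i hi']
    · have habs : |(pt i a - (X[g i]'(hg i)) a) / w i| ≤ Q := by
        rcases hσ.eq_or_lt with h0 | hpos
        · simp [hw, ← h0]
        · have hwpos : 0 < w i := by simp only [hw]; positivity
          rw [abs_div, abs_of_pos hwpos, div_le_iff₀ hwpos]
          have h1 : |pt i a - (X[g i]'(hg i)) a| ≤ ρ i := by
            simp only [hρ]; rw [hgd i]; exact abs_sub_le_dist _ _ a
          have h2 : 2 * σ * 2 ^ lv i = (2 * U.card / δ) * w i := by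
            simp only [hw]; field_simp
          have h3 := mul_le_mul_of_nonneg_right hQ hwpos.le
          have h4 := hupp i hpos
          rw [pow_succ] at h4
          linarith
      rw [abs_le] at habs
      constructor
      · rw [hz, Int.le_floor]; push_cast; exact habs.1
      · have : (z i a : ℝ) ≤ Q := (Int.floor_le _).trans habs.2
        exact_mod_cast this
  · have key : ∀ i j, i < j → j < n → (g i, lv i, z i) ≠ (g j, lv j, z j) := by
      intro i j hij hj heq
      simp only [Prod.mk.injEq] at heq
      obtain ⟨e1, e2, e3⟩ := heq
      have hsep := h5 i j hij hj
      rcases hσ.eq_or_lt with h0 | hpos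
      -- For σ = 0 all points have ρ = 0 and are centers themselves, so the nearest center already
      -- identifies them.
      · have hzero : ∀ l < n, pt l = X[g l]'(hg l) := by
          intro l hl
          have := hρr l hl
          rw [← h0, mul_zero] at this
          refine dist_le_zero.1 ?_
          rw [← hgd l]; exact this
        have : pt j = pt i := by
          rw [hzero i (hij.trans hj), hzero j hj]
          congr 1
          exact e1.symm
        rw [this, dist_self] at hsep
        exact absurd hsep (not_lt.2 (mul_nonneg hδ.le (add_nonneg Metric.infDist_nonneg hσ)))
      · have hwpos : 0 < w j := by simp only [hw]; positivity
        have hwij : w i = w j := by simp only [hw, e2]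
        have hclose : dist (pt j) (pt i) ≤ U.card * w j := by
          refine dist_le_card_mul fun a => ?_
          have e4 := congrFun e3 a
          simp only [hz, hwij] at e4
          have hXa : (X[g i]'(hg i)) = X[g j]'(hg j) := by congr 1
          rw [hXa] at e4
          have := Int.abs_sub_lt_one_of_floor_eq_floor e4.symm
          rw [← sub_div, abs_div, abs_of_pos hwpos, div_lt_one hwpos] at this
          rw [sub_sub_sub_cancel_right] at this
          exact this.le
        have h6 : U.card * w j = δ * (σ * 2 ^ lv j) := by simp only [hw]; field_simp
        have h7 := mul_le_mul_of_nonneg_left (hlow j hpos) hδ.le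
        rw [h6] at hclose
        exact absurd hsep (not_lt.2 (hclose.trans h7))
    intro i hi j hj heq
    have hi' : i < n := by simpa using hi
    have hj' : j < n := by simpa using hj
    rcases lt_trichotomy i j with hij | hij | hij
    · exact absurd heq (key i j hij hj')
    · exact hij
    · exact absurd heq.symm (key j i hij hi')

end Packing

/-! ### Logarithmic bounds for the number of results and levels -/

section Counting
variable {q : JoinQuery}

theorem card_joinSet_le (D : Instance q) {N : ℕ} (hN : ∀ j, (D.rows j).length ≤ N) :
    (joinSet_finite D).toFinset.card ≤ N ^ q.m := by
  classical
  have h := card_families (D := D) ∅ fun _ _ => True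
  simp only [Finset.notMem_empty, implies_true, if_true, Finset.prod_const_one,
    Finset.sum_const, nsmul_eq_mul, mul_one, Finset.filter_true] at h
  have h' : (families D Finset.univ).card = (joinSet_finite D).toFinset.card := by exact_mod_cast h
  rw [← h', families]
  refine (Finset.card_filter_le _ _).trans ?_
  rw [Fintype.card_piFinset]
  refine (Finset.prod_le_prod' fun j _ => ?_ : _ ≤ ∏ _j : Fin q.m, N).trans (by simp)
  simpa using hN j

/-- As the rounded logarithm is at least 1, the rounding is absorbed by doubling it. -/
theorem pow_le_two_pow_log {N m : ℕ} (hN : 2 ≤ N) : N ^ m ≤ 2 ^ (2 * m * Nat.log 2 N) := by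
  have h1 : 1 ≤ Nat.log 2 N := Nat.log_pos (by norm_num) hN
  have h2 : N ≤ 2 ^ (2 * Nat.log 2 N) :=
    (Nat.lt_pow_succ_log_self (by norm_num) N).le.trans
      (Nat.pow_le_pow_right (by norm_num) (by omega))
  calc N ^ m ≤ (2 ^ (2 * Nat.log 2 N)) ^ m := Nat.pow_le_pow_left h2 m
    _ = 2 ^ (2 * m * Nat.log 2 N) := by rw [← pow_mul]; congr 1; ring

/-- Enough steps of the geometric progression. -/
theorem exists_levels (m : ℕ) {δ : ℝ} (hδ : 0 < δ) :
    ∃ b : ℕ, ∀ N n : ℕ, 2 ≤ N → n ≤ N ^ m → ∀ σ : ℝ, 0 ≤ σ →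
      n * σ ≤ δ * σ * (1 + δ) ^ (b * Nat.log 2 N) := by
  obtain ⟨b₀, h₀⟩ := pow_unbounded_of_one_lt 2 (by linarith : 1 < 1 + δ)
  obtain ⟨b₁, h₁⟩ := pow_unbounded_of_one_lt (1 / δ) (by linarith : 1 < 1 + δ)
  refine ⟨b₁ + 2 * m * b₀, fun N n hN hn σ hσ => ?_⟩
  have hlog : 1 ≤ Nat.log 2 N := Nat.log_pos (by norm_num) hN
  set ℓ := Nat.log 2 N with hℓ
  have h2 : (n : ℝ) ≤ (1 + δ) ^ (2 * m * b₀ * ℓ) := by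
    calc (n : ℝ) ≤ (2 : ℝ) ^ (2 * m * ℓ) := by exact_mod_cast hn.trans (pow_le_two_pow_log hN)
      _ ≤ ((1 + δ) ^ b₀) ^ (2 * m * ℓ) := pow_le_pow_left₀ (by norm_num) h₀.le _
      _ = (1 + δ) ^ (2 * m * b₀ * ℓ) := by rw [← pow_mul]; congr 1; ring
  have h3 : 1 ≤ δ * (1 + δ) ^ (b₁ * ℓ) := by
    have : 1 / δ ≤ (1 + δ) ^ (b₁ * ℓ) :=
      h₁.le.trans (pow_le_pow_right₀ (by linarith) (Nat.le_mul_of_pos_right _ hlog))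
    rwa [div_le_iff₀' hδ] at this
  have h4 : (0 : ℝ) ≤ (1 + δ) ^ (2 * m * b₀ * ℓ) := by positivity
  rw [add_mul, pow_add]
  calc n * σ ≤ (1 + δ) ^ (2 * m * b₀ * ℓ) * σ := mul_le_mul_of_nonneg_right h2 hσ
    _ ≤ (δ * (1 + δ) ^ (b₁ * ℓ)) * ((1 + δ) ^ (2 * m * b₀ * ℓ) * σ) :=
        le_mul_of_one_le_left (mul_nonneg h4 hσ) h3
    _ = _ := by ring

end Counting

/-! ### Assembly and running time -/

section Main
variable {q : JoinQuery} {U : Finset (Fin q.d)}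

/-- The algorithm: number the values of the attributes, count the join results, cut the space into
cells, find a coreset by going through the boxes of cells, and cluster the coreset. -/
noncomputable def mainProg (U : Finset (Fin q.d)) (L : List (Fin q.m × Fin q.m)) (r : Fin q.m) :
    Prog U :=
  .seq (makeKeys U) <| .seq (countQuery (fun _ => .all []) L r) <| .seq (makeLevels U) <|
    .seq (makeCells U) <| .seq (boxLoop (boxBody U L r) U.toList) (finish U)

/-- Here `x` is |X|, `ℓ` the rounded logarithm of `N`, `u` the dimension, `vJ` the number of levels
and `C` the size of the coreset. The dominant term is `M ^ u` boxes of cost `N + x + C` each, with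
`M` of order `x * ℓ`; it leaves a factor `ℓ` to spare. -/
theorem time_bound (d m u b c₂ c₅ c₆ g N x ℓ vJ M C h : ℕ) (hu : 1 ≤ u) (hN : 1 ≤ N) (hx : 1 ≤ x)
    (hℓ : 1 ≤ ℓ) (hvJ : vJ ≤ b * ℓ + 2) (hM : M = x * (vJ + vJ) + 1) (hC : C ≤ g * (x * ℓ))
    (hh : h = m + 2 * ℓ) :
    (d * (300 * (h + 1) * ((m + 1) * (N + 1))) + 3) + (c₂ * (N + 1) + (40 * (b * ℓ + 1) +
      (60 * (m * u + 1) * ((N + 1) * (x + 1) * (vJ + 1)) +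
        (M ^ u * (c₅ * (N + x + C + 1) + 16 * u) + c₆ * ((C + 1) * (C + 1)))))) ≤
    (d * (300 * (m + 3) * ((m + 1) * 2)) + 3 + c₂ * 2 + 40 * (b + 1) +
      60 * (m * u + 1) * (2 * 2 * (b + 3)) + (2 * b + 5) ^ u * (c₅ * (g + 3) + 16 * u) +
        c₆ * ((g + 1) * (g + 1))) * (x ^ (u + 1) * N * ℓ ^ (u + 2)) := by
  set V := x ^ (u + 1) * N * ℓ ^ (u + 2) with hV
  have hxu : x ≤ x ^ (u + 1) := Nat.le_self_pow (by omega) x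
  have hxu2 : x * x ≤ x ^ (u + 1) := by
    rw [← sq]; exact Nat.pow_le_pow_right hx (by omega)
  have hℓu : ℓ ≤ ℓ ^ (u + 2) := Nat.le_self_pow (by omega) ℓ
  have hℓu2 : ℓ * ℓ ≤ ℓ ^ (u + 2) := by
    rw [← sq]; exact Nat.pow_le_pow_right hℓ (by omega)
  have hxNℓ : x * N * ℓ ≤ V := Nat.mul_le_mul (Nat.mul_le_mul_right N hxu) hℓu
  have hNℓ : N * ℓ ≤ V := le_trans (Nat.mul_le_mul_right _ (Nat.le_mul_of_pos_left _ hx)) hxNℓ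
  have hNV : N ≤ V := (Nat.le_mul_of_pos_right _ hℓ).trans hNℓ
  have hℓV : ℓ ≤ V := (Nat.le_mul_of_pos_left _ hN).trans hNℓ
  have h1V : 1 ≤ V := hN.trans hNV
  have hxℓ2 : (x * ℓ) * (x * ℓ) ≤ V := by
    calc (x * ℓ) * (x * ℓ) = (x * x) * 1 * (ℓ * ℓ) := by ring
      _ ≤ V := Nat.mul_le_mul (Nat.mul_le_mul hxu2 hN) hℓu2
  have hxℓ1 : 1 ≤ x * ℓ := Nat.mul_pos hx hℓ
  have hvJ' : vJ ≤ (b + 2) * ℓ := by rw [add_mul]; omega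
  have t1 : d * (300 * (h + 1) * ((m + 1) * (N + 1))) ≤
      d * (300 * (m + 3) * ((m + 1) * 2)) * V := by
    have e1 : h + 1 ≤ (m + 3) * ℓ := by
      have := Nat.le_mul_of_pos_right m hℓ
      rw [add_mul]; omega
    have e2 : N + 1 ≤ 2 * N := by omega
    calc d * (300 * (h + 1) * ((m + 1) * (N + 1)))
        ≤ d * (300 * ((m + 3) * ℓ) * ((m + 1) * (2 * N))) := by gcongr
      _ = d * (300 * (m + 3) * ((m + 1) * 2)) * (N * ℓ) := by ring
      _ ≤ _ := Nat.mul_le_mul_left _ hNℓ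
  have t2 : c₂ * (N + 1) ≤ c₂ * 2 * V := by
    rw [mul_assoc]; exact Nat.mul_le_mul_left _ (by omega)
  have t3 : 40 * (b * ℓ + 1) ≤ 40 * (b + 1) * V := by
    have := Nat.mul_le_mul_left b hℓV
    rw [mul_assoc, add_mul]; omega
  have t4 : 60 * (m * u + 1) * ((N + 1) * (x + 1) * (vJ + 1)) ≤
      60 * (m * u + 1) * (2 * 2 * (b + 3)) * V := by
    have e1 : vJ + 1 ≤ (b + 3) * ℓ := by rw [add_mul]; omega
    calc 60 * (m * u + 1) * ((N + 1) * (x + 1) * (vJ + 1))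
        ≤ 60 * (m * u + 1) * ((2 * N) * (2 * x) * ((b + 3) * ℓ)) := by gcongr <;> omega
      _ = 60 * (m * u + 1) * (2 * 2 * (b + 3)) * (x * N * ℓ) := by ring
      _ ≤ _ := Nat.mul_le_mul_left _ hxNℓ
  have t5 : M ^ u * (c₅ * (N + x + C + 1) + 16 * u) ≤
      (2 * b + 5) ^ u * (c₅ * (g + 3) + 16 * u) * V := by
    have e1 : M ≤ (2 * b + 5) * (x * ℓ) := by
      calc M ≤ x * ((b + 2) * ℓ + (b + 2) * ℓ) + x * ℓ := by rw [hM]; gcongr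
        _ = _ := by ring
    have e2 : N + x + C + 1 ≤ (g + 3) * (x * N * ℓ) := by
      have a1 : x * ℓ ≤ x * N * ℓ := Nat.mul_le_mul_right _ (Nat.le_mul_of_pos_right _ hN)
      have a2 : N ≤ x * N * ℓ := by
        calc N = 1 * N * 1 := by ring
          _ ≤ _ := by gcongr
      have a3 : x ≤ x * ℓ := Nat.le_mul_of_pos_right _ hℓ
      have a4 := Nat.mul_le_mul_left g a1
      rw [add_mul]; omega
    have e3 : 16 * u ≤ 16 * u * (x * N * ℓ) := Nat.le_mul_of_pos_right _ (by positivity)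
    calc M ^ u * (c₅ * (N + x + C + 1) + 16 * u)
        ≤ ((2 * b + 5) * (x * ℓ)) ^ u * (c₅ * ((g + 3) * (x * N * ℓ)) + 16 * u * (x * N * ℓ)) := by
          gcongr
      _ = (2 * b + 5) ^ u * (c₅ * (g + 3) + 16 * u) * (x ^ (u + 1) * N * ℓ ^ (u + 1)) := by
          rw [mul_pow, mul_pow]; ring
      _ ≤ _ := by
          refine Nat.mul_le_mul_left _ (Nat.mul_le_mul_left _ ?_)
          exact Nat.pow_le_pow_right hℓ (by omega)
  have t6 : c₆ * ((C + 1) * (C + 1)) ≤ c₆ * ((g + 1) * (g + 1)) * V := by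
    have e1 : C + 1 ≤ (g + 1) * (x * ℓ) := by linarith
    calc c₆ * ((C + 1) * (C + 1)) ≤ c₆ * (((g + 1) * (x * ℓ)) * ((g + 1) * (x * ℓ))) := by gcongr
      _ = c₆ * ((g + 1) * (g + 1)) * ((x * ℓ) * (x * ℓ)) := by ring
      _ ≤ _ := Nat.mul_le_mul_left _ hxℓ2
  linarith

/-- The black box is needed only to return `k` centers on ε/8-coresets, so that one analysis serves
the geometric and the discrete version. -/
theorem mainProg_runs {L r₀} (hE : Elim q Finset.univ L r₀) (hU : U.Nonempty) {ε : ℝ} (hε : 0 < ε)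
    (hε1 : ε < 1) (α : ℝ) :
    ∃ c : ℕ, ∀ (D : Instance q) (N : ℕ) (X : List (Pt U)) (k : ℕ) (r : ℝ)
      (f : List (Pt U × ℝ) → List (Pt U)) (T : ℕ → ℕ),
      2 ≤ N → (∀ j, (D.rows j).length ≤ N) → X ≠ [] → 1 ≤ k →
      cost (unweighted (joinProj D U)) {x | x ∈ X} ≤ r →
      r ≤ α * opt k (unweighted (joinProj D U)) → Monotone T →
      (∀ C, IsWeightedSet C → IsCoreset k (ε / 8) C (unweighted (joinProj D U)) →
        (f C).length = k) →
      Runs f T (mainProg U L r₀) (input D X k ε α r)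
        (c * (X.length ^ (U.card + 1) * N * Nat.log 2 N ^ (U.card + 2)) +
          T (c * (X.length * Nat.log 2 N)))
        fun s => IsWeightedSet s.coreset ∧ (∀ p ∈ s.coreset, p.1 ∈ joinProj D U) ∧
          s.coreset.length ≤ c * (X.length * Nat.log 2 N) ∧
          IsCoreset k (ε / 8) s.coreset (unweighted (joinProj D U)) ∧
          s.solution k = {p | p ∈ f s.coreset} ∧
          s.rvar .ru = costBound k ε s.coreset {p | p ∈ f s.coreset} := by
  obtain ⟨c₂, h₂⟩ := countQuery_runs (U := U) hE fun _ => .all []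
  obtain ⟨c₅, h₅⟩ := boxBody_runs hE U
  obtain ⟨c₆, h₆⟩ := finish_runs U
  set δ := precision U.card ε α with hδdef
  have hδ : 0 < δ := div_pos hε (by nlinarith [mul_self_nonneg α, Nat.cast_nonneg (α := ℝ) U.card])
  obtain ⟨b, hb⟩ := exists_levels q.m hδ
  obtain ⟨Q, hQ⟩ := exists_nat_ge (2 * U.card / δ)
  set g := (2 * q.m + 2) * (2 * Q + 1) ^ U.card with hg
  set c₀ := q.d * (300 * (q.m + 3) * ((q.m + 1) * 2)) + 3 + c₂ * 2 + 40 * (b + 1) +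
      60 * (q.m * U.card + 1) * (2 * 2 * (b + 3)) +
        (2 * b + 5) ^ U.card * (c₅ * (g + 3) + 16 * U.card) + c₆ * ((g + 1) * (g + 1)) with hc₀
  refine ⟨c₀ + g, fun D N X k r f T hN hrows hX hk hr hrα hT hf => ?_⟩
  set ℓ := Nat.log 2 N with hℓ
  have hℓ1 : 1 ≤ ℓ := Nat.log_pos (by norm_num) hN
  have hx1 : 1 ≤ X.length := List.length_pos_iff.2 hX
  set P := unweighted (joinProj D U) with hP
  set n := (joinSet_finite D).toFinset.card with hn
  set σ := r / n with hσdef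
  have hr0 : 0 ≤ r := (cost_nonneg (fun p hp => (unweighted_pos _ p hp).le) _).trans hr
  have hσ : 0 ≤ σ := div_nonneg hr0 (Nat.cast_nonneg n)
  have hnσ : n * σ = r := by
    -- For an empty join the optimum is 0, which forces `r = 0`; the convention for division by zero
    -- then gives σ = 0 and the identity persists.
    rcases Nat.eq_zero_or_pos n with h0 | hpos
    · have hj : joinProj D U = 0 := by
        rw [hn, Finset.card_eq_zero] at h0
        simp [joinProj, h0]
      have hopt : opt k P ≤ 0 := Real.iInf_nonpos fun Y => by simp [hP, hj, cost, unweighted]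
      have hopt0 : 0 ≤ opt k P := opt_nonneg fun p hp => (unweighted_pos _ p hp).le
      rw [le_antisymm hopt hopt0, mul_zero] at hrα
      rw [le_antisymm hrα hr0] at *
      simp [h0]
    · rw [hσdef]
      field_simp
  have hnm := card_joinSet_le D hrows
  have hB : r ≤ δ * σ * (1 + δ) ^ (b * ℓ) := hnσ ▸ hb N n hN hnm σ hσ
  set Lv := 2 * q.m * ℓ + 2 with hLv
  have hLvn : n + 1 < 2 ^ Lv := by
    have h1 : n ≤ 2 ^ (2 * q.m * ℓ) := hnm.trans (pow_le_two_pow_log hN)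
    have h2 : 1 ≤ 2 ^ (2 * q.m * ℓ) := Nat.one_le_two_pow
    calc n + 1 ≤ 2 ^ (2 * q.m * ℓ) * 2 := by linarith
      _ < 2 ^ (2 * q.m * ℓ) * 2 ^ 2 := by linarith
      _ = 2 ^ Lv := by rw [hLv, pow_add]
  set Cmax := g * (X.length * ℓ) with hCmax
  -- The bound does not depend on the set `Z` of processed results, hence applies throughout the
  -- sweep.
  have hpack : ∀ cell Z n' pt wt, Represents D {x | x ∈ X} δ σ cell Z n' pt wt → n' ≤ Cmax := by
    intro cell Z n' pt wt h
    refine (h.le_packing hX hU hδ hσ hr hnσ.ge hLvn hQ).trans ?_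
    calc X.length * (Lv * (2 * Q + 1) ^ U.card)
        ≤ X.length * (((2 * q.m + 2) * ℓ) * (2 * Q + 1) ^ U.card) := by
          gcongr
          nlinarith
      _ = Cmax := by rw [hCmax, hg]; ring
  set s₀ := input D X k ε α r with hs₀
  have hT₀ : HasTables D s₀ := by
    refine ⟨fun j => rfl, fun j a h i hi => ?_⟩
    simp [hs₀, input, Instance.val, hi, h]
  set h := q.m + 2 * ℓ with hh
  have hhN : q.m * N ≤ 2 ^ h := by
    rw [hh, pow_add]
    refine Nat.mul_le_mul (Nat.lt_two_pow_self).le ?_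
    have := pow_le_two_pow_log (m := 1) hN
    simpa using this
  set M₀ := X.length * ((b * ℓ + 2) + (b * ℓ + 2)) + 1 with hM₀
  have hlen : U.toList.length = U.card := Finset.length_toList U
  refine Runs.mono (t := (q.d * (300 * (h + 1) * ((q.m + 1) * (N + 1))) + 3) + (c₂ * (N + 1) +
    (40 * (b * ℓ + 1) + (60 * (q.m * U.card + 1) * ((N + 1) * (X.length + 1) * ((b * ℓ + 2) + 1)) +
      (M₀ ^ U.card * (c₅ * (N + X.length + Cmax + 1) + 16 * U.card) +
        (T Cmax + c₆ * ((Cmax + 1) * (Cmax + 1)))))))) ?_ ?_ fun _ _ h => h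
  rotate_left
  · have h1 := time_bound q.d q.m U.card b c₂ c₅ c₆ g N X.length ℓ (b * ℓ + 2) M₀ Cmax h
      hU.card_pos (by omega) hx1 hℓ1 le_rfl hM₀ le_rfl hh
    rw [← hc₀] at h1
    have h2 : T Cmax ≤ T ((c₀ + g) * (X.length * ℓ)) :=
      hT (by rw [hCmax]; exact Nat.mul_le_mul_right _ (by omega))
    have aux : ∀ {t₁ t₂ t₃ t₄ t₅ t₆ V : ℕ} (t : ℕ), t₁ + (t₂ + (t₃ + (t₄ + (t₅ + t₆)))) ≤ V →
        t₁ + (t₂ + (t₃ + (t₄ + (t₅ + (t + t₆))))) ≤ V + t := by intros; omega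
    exact (aux (T Cmax) h1).trans
      (Nat.add_le_add (Nat.mul_le_mul_right _ (Nat.le_add_right _ _)) h2)
  refine (makeKeys_runs D hrows hhN s₀ hT₀).seq fun s₁ ha₁ hK₁ => ?_
  have hT₁ : HasTables D s₁ := hT₀.agree ha₁ fun l hl => by
    have := makeKeys_kind l hl; simp at this; omega
  refine (h₂ f T D N hrows s₁ hT₁ hK₁ ∅ (fun _ _ => True) (by simp [Test.holds_all])).seq
    fun s₂ ha₂ hs₂ => ?_
  have hk₂ := countQuery_kind (U := U) (fun _ => .all []) L r₀
  have hT₂ : HasTables D s₂ := hT₁.agree ha₂ fun l hl => by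
    have := hk₂ l hl; simp at this; omega
  have hK₂ : Keyed D Finset.univ s₂ := hK₁.agree ha₂ fun l hl => by
    have := hk₂ l hl; simp at this ⊢; omega
  have hcnt : s₂.rvar rCnt = n := by
    rw [hs₂.1]
    simp [resultsWith, hn]
  have hnot₁ : ∀ l : Loc U, l.kind = 0 ∨ l.kind = 1 → l ∉ (makeKeys U).writes := by
    intro l hl hlW
    have := makeKeys_kind l hlW; simp at this; omega
  have hnot₂ : ∀ l : Loc U, l.kind = 0 ∨ l.kind = 1 →
      l ∉ (countQuery (U := U) (fun _ => .all []) L r₀).writes := by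
    intro l hl hlW
    have := hk₂ l hlW; simp at this; omega
  have hr₂ : s₂.rvar .r = r :=
    (ha₂.rv _ (hnot₂ _ (by simp))).trans (ha₁.rv _ (hnot₁ _ (by simp)))
  have he₂ : s₂.rvar .eps = ε :=
    (ha₂.rv _ (hnot₂ _ (by simp))).trans (ha₁.rv _ (hnot₁ _ (by simp)))
  have hα₂ : s₂.rvar .alpha = α :=
    (ha₂.rv _ (hnot₂ _ (by simp))).trans (ha₁.rv _ (hnot₁ _ (by simp)))
  refine (makeLevels_runs s₂ (δ := δ) (sc := σ) (by rw [he₂, hα₂]) (by rw [hr₂, hcnt])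
    (B := b * ℓ) (by rw [hr₂]; exact hB)).seq fun s₃ ha₃ hs₃ => ?_
  obtain ⟨hδ₃, hσ₃, hJ₃, hy0, J, hJ, hyr, hy⟩ := hs₃
  rw [hr₂] at hyr
  have hnot₃ : ∀ l : Loc U, l.kind = 0 ∨ l.kind = 1 → l ∉ (makeLevels U).writes := by
    intro l hl hlW
    have := makeLevels_kind l hlW; simp at this; omega
  have hT₃ : HasTables D s₃ := hT₂.agree ha₃ fun l hl => by
    have := makeLevels_kind l hl; simp at this; omega
  have hK₃ : Keyed D Finset.univ s₃ := hK₂.agree ha₃ fun l hl => by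
    have := makeLevels_kind l hl; simp at this ⊢; omega
  have hX₃ : s₃.nvar .numX = X.length := (ha₃.nv _ (hnot₃ _ (by simp))).trans
    ((ha₂.nv _ (hnot₂ _ (by simp))).trans (ha₁.nv _ (hnot₁ _ (by simp))))
  have hctr₃ : ∀ a, s₃.rarr (.center a) = s₀.rarr (.center a) := fun a =>
    (ha₃.ra _ (hnot₃ _ (by simp))).trans
      ((ha₂.ra _ (hnot₂ _ (by simp))).trans (ha₁.ra _ (hnot₁ _ (by simp))))
  have hctr₀ : ∀ i (hi : i < X.length) a, s₀.rarr (.center a) i = X[i] a := by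
    intro i hi a
    simp [hs₀, input, hi]
  have hC₃ : s₃.nvar .numC = 0 := (ha₃.nv _ (hnot₃ _ (by simp))).trans
    ((ha₂.nv _ (hnot₂ _ (by simp))).trans (ha₁.nv _ (hnot₁ _ (by simp))))
  have hk₃ : s₃.nvar .k = k := (ha₃.nv _ (hnot₃ _ (by simp))).trans
    ((ha₂.nv _ (hnot₂ _ (by simp))).trans (ha₁.nv _ (hnot₁ _ (by simp))))
  have he₃ : s₃.rvar .eps = ε := (ha₃.rv _ (hnot₃ _ (by simp))).trans he₂
  refine ((makeCells_runs D hrows s₃ hT₃).mono (by rw [hX₃]; gcongr) fun _ _ h => h).seq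
    fun s₄ ha₄ ⟨hM₄, hidx⟩ => ?_
  set y := s₃.rarr (aY U) with hydef
  set cell : Fin q.d → ℝ → ℕ := fun a v => if h : a ∈ U then
    cellIdx (s₀.rarr (.center ⟨a, h⟩)) y X.length (J + 2) v else 0 with hcelldef
  have hcellU : ∀ a : {a // a ∈ U}, cell a = cellIdx (s₀.rarr (.center a)) y X.length (J + 2) := by
    intro a
    funext v
    simp [hcelldef]
  have hcut : CutCells X δ σ r cell := by
    refine ⟨y, J, hy0, hy, hyr, fun a v v' hvv i hi l hl => ?_⟩
    rw [hcellU] at hvv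
    have := cellIdx_eq hvv hi hl
    rwa [hctr₀ i hi] at this
  set M := X.length * ((J + 2) + (J + 2)) + 1 with hM
  have hMle : M ≤ M₀ := by
    rw [hM, hM₀]
    gcongr <;> omega
  have hcellM : ∀ a v, cell a v < M := by
    intro a v
    rw [hM, Nat.lt_succ_iff]
    simp only [hcelldef]
    split_ifs with h
    · exact cellIdx_le _ _ _ _ _
    · exact Nat.zero_le _
  have hnot₄ : ∀ l : Loc U, l.kind = 0 ∨ l.kind = 1 ∨ l.kind = 30 ∨ l.kind = 31 →
      l ∉ (makeCells U).writes := by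
    intro l hl hlW
    have := makeCells_kind l hlW; simp at this; omega
  have hX₄ : s₄.nvar .numX = X.length := (ha₄.nv _ (hnot₄ _ (by simp))).trans hX₃
  have hst₄ : Static D X δ σ cell s₄ := by
    refine ⟨hT₃.agree ha₄ fun l hl => ?_, hK₃.agree ha₄ fun l hl => ?_, hX₄, fun i hi => ?_,
      (ha₄.rv _ (hnot₄ _ (by simp))).trans hδ₃, (ha₄.rv _ (hnot₄ _ (by simp))).trans hσ₃, ?_⟩
    · have := makeCells_kind l hl; simp at this; omega
    · have := makeCells_kind l hl; simp at this ⊢; omega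
    · ext a
      simp only [ptAt]
      rw [ha₄.ra _ (hnot₄ _ (by simp)), hctr₃, hctr₀ i hi]
    · intro j a ha haj i hi
      rw [hidx j ⟨a, ha⟩ haj i hi, hcellU ⟨a, ha⟩, hctr₃, hX₃, hJ]
  have hC₄ : s₄.nvar .numC = 0 := (ha₄.nv _ (hnot₄ _ (by simp))).trans hC₃
  have hM₄' : s₄.nvar vM = M := by rw [hM₄, hX₃, hJ]
  have hInv₄ : MainInv D X δ σ cell ∅ s₄ := by
    refine ⟨hst₄, fun _ => 0, by simp, ?_, ?_, ?_, ?_⟩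
    all_goals rw [hC₄]
    all_goals intros
    all_goals omega
  have hkB := boxBody_kind (U := U) L r₀
  have hloop := boxLoop_runs (f := f) (T := T) (D := D) (body := boxBody U L r₀) hcellM
    (Inv := MainInv D X δ σ cell)
    (fun l hl => by have := hkB l hl; simp at this; omega)
    (fun Z s a v ⟨h1, h2⟩ => by
      have ha := agree_setN s (vBox a) v
      refine ⟨h1.agree ha (by simp), ?_⟩
      rw [ptAt_agree ha fun a => by simp, ha.nv .numC (by simp), ha.ra .coreWt (by simp)]
      exact h2)
    (h₅ f T D N hrows X δ σ cell Cmax hX hδ.le hσ (hpack cell))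
    U.toList (Finset.nodup_toList U) (fun a ha => Finset.mem_toList.1 ha) s₄ hM₄' ∅ hInv₄
    (fun t ht => absurd ht (Finset.notMem_empty t))
  rw [hlen] at hloop
  refine (hloop.mono (Nat.mul_le_mul_right _ (Nat.pow_le_pow_left hMle _)) fun _ _ h => h).seq
    fun s₅ ha₅ ⟨_, hrep⟩ => ?_
  -- After the complete sweep no coordinate is constrained, so the processed results are all of
  -- them.
  have hZ : (∅ ∪ resultsWith D U fun a v => a ∉ U.toList → cell a v = s₄.nvar (vBox a)) =
      (joinSet_finite D).toFinset := by
    ext t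
    simp only [Finset.empty_union, mem_resultsWith, Set.Finite.mem_toFinset, and_iff_left_iff_imp]
    intro _ a ha h
    exact absurd (Finset.mem_toList.2 ha) h
  rw [hZ] at hrep
  have hnot₅ : ∀ l : Loc U, l.kind = 0 → l ∉ (boxLoop (boxBody U L r₀) U.toList).writes := by
    intro l hl hlW
    rcases boxLoop_writes _ _ l hlW with h | ⟨a, -, rfl⟩
    · have := hkB l h; simp at this; omega
    · simp at hl
  have hk₅ : s₅.nvar .k = k := (ha₅.nv _ (hnot₅ _ (by simp))).trans
    ((ha₄.nv _ (hnot₄ _ (by simp))).trans hk₃)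
  have he₅ : s₅.rvar .eps = ε := (ha₅.rv _ (hnot₅ _ (by simp))).trans
    ((ha₄.rv _ (hnot₄ _ (by simp))).trans he₃)
  have hCle := hpack _ _ _ _ _ hrep
  have hws : IsWeightedSet s₅.coreset := hrep.isWeightedSet hδ.le hσ
  have hcs : IsCoreset k (ε / 8) s₅.coreset P :=
    hrep.isCoreset hX hcut hε hε1 hσ hr hrα hnσ.le
  have hClen : s₅.coreset.length = s₅.nvar .numC := by simp [Store.coreset]
  refine (h₆ f T s₅ (hk₅ ▸ hk) (hk₅ ▸ hf _ hws hcs)).mono ?_ fun s₆ _ ⟨h1, h2, h3⟩ => ?_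
  · gcongr
    exact hT hCle
  · rw [h1]
    refine ⟨hws, hrep.mem_joinProj, ?_, hcs, hk₅ ▸ h2, ?_⟩
    · rw [hClen]
      refine hCle.trans ?_
      rw [hCmax]
      exact Nat.mul_le_mul_right _ (by omega)
    · rw [h3, hk₅, he₅, costBound, hClen]

end Main

theorem IsCoreset.mono {E : Type*} [PseudoMetricSpace E] {k : ℕ} {ε ε' : ℝ} {C : List (E × ℝ)}
    {P : Multiset (E × ℝ)} (h : IsCoreset k ε C P) (hε : ε ≤ ε')
    (hP : ∀ Y : Set E, 0 ≤ cost P Y) : IsCoreset k ε' C P := by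
  intro Y hY
  have h1 := mul_le_mul_of_nonneg_right hε (hP Y)
  obtain ⟨h2, h3⟩ := h Y hY
  constructor <;> linarith

theorem log_le_logb {N : ℕ} : (Nat.log 2 N : ℝ) ≤ Real.logb 2 N := by
  have := Real.natLog_le_logb N 2
  exact_mod_cast this

theorem steps_le_of_monotone {c x N d t : ℕ} {T : ℕ → ℕ} (hT : Monotone T)
    (ht : t ≤ c * (x ^ (d + 1) * N * Nat.log 2 N ^ (d + 2)) + T (c * (x * Nat.log 2 N))) :
    (t : ℝ) ≤ c * ((x : ℝ) ^ (d + 1) * N * Real.logb 2 N ^ (d + 2)) +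
      T ⌊c * (x * Real.logb 2 N)⌋₊ := by
  have h1 : T (c * (x * Nat.log 2 N)) ≤ T ⌊c * (x * Real.logb 2 N)⌋₊ := by
    refine hT (Nat.le_floor ?_)
    push_cast
    gcongr
    exact log_le_logb
  calc (t : ℝ) ≤ c * ((x : ℝ) ^ (d + 1) * N * (Nat.log 2 N : ℝ) ^ (d + 2)) +
        T (c * (x * Nat.log 2 N)) := by exact_mod_cast ht
    _ ≤ _ := by
        gcongr
        exact log_le_logb

/-- As c ≤ 2^c, doubling the argument `c` times absorbs the constant `c` at the price of `B ^ c`. -/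
theorem steps_le_of_doubling {c x N d t B : ℕ} {T : ℕ → ℕ} (hT : Monotone T)
    (hB : ∀ x, T (2 * x) ≤ B * T x)
    (ht : t ≤ c * (x ^ (d + 1) * N * Nat.log 2 N ^ (d + 2)) + T (c * (x * Nat.log 2 N))) :
    (t : ℝ) ≤ (c + B ^ c : ℕ) * ((x : ℝ) ^ (d + 1) * N * Real.logb 2 N ^ (d + 2) +
      T ⌈x * Real.logb 2 N⌉₊) := by
  have hpow : ∀ i y, T (2 ^ i * y) ≤ B ^ i * T y := by
    intro i y
    induction i with
    | zero => simp
    | succ i ih =>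
      calc T (2 ^ (i + 1) * y) = T (2 * (2 ^ i * y)) := by congr 1; ring
        _ ≤ B * T (2 ^ i * y) := hB _
        _ ≤ B * (B ^ i * T y) := Nat.mul_le_mul_left _ ih
        _ = B ^ (i + 1) * T y := by ring
  have h1 : T (c * (x * Nat.log 2 N)) ≤ B ^ c * T ⌈x * Real.logb 2 N⌉₊ := by
    refine (hT (Nat.mul_le_mul Nat.lt_two_pow_self.le ?_)).trans (hpow c _)
    have h2 : ((x * Nat.log 2 N : ℕ) : ℝ) ≤ x * Real.logb 2 N := by
      push_cast
      gcongr
      exact log_le_logb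
    exact_mod_cast h2.trans (Nat.le_ceil _)
  have h3 : (0 : ℝ) ≤ Real.logb 2 N := le_trans (Nat.cast_nonneg _) log_le_logb
  calc (t : ℝ) ≤ c * ((x : ℝ) ^ (d + 1) * N * (Nat.log 2 N : ℝ) ^ (d + 2)) +
        T (c * (x * Nat.log 2 N)) := by exact_mod_cast ht
    _ ≤ c * ((x : ℝ) ^ (d + 1) * N * Real.logb 2 N ^ (d + 2)) +
        (B ^ c : ℕ) * T ⌈x * Real.logb 2 N⌉₊ := by
        gcongr
        · exact log_le_logb
        · exact_mod_cast h1
    _ ≤ _ := by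
        push_cast
        have h4 : 0 ≤ (x : ℝ) ^ (d + 1) * N * Real.logb 2 N ^ (d + 2) := by positivity
        have h5 : (0 : ℝ) ≤ (B : ℝ) ^ c := by positivity
        have h6 : (0 : ℝ) ≤ c := Nat.cast_nonneg c
        have h7 : (0 : ℝ) ≤ T ⌈x * Real.logb 2 N⌉₊ := Nat.cast_nonneg _
        nlinarith [mul_nonneg h5 h4, mul_nonneg h6 h7]

theorem infinite_pt {q : JoinQuery} {U : Finset (Fin q.d)} (hU : U.Nonempty) :
    Infinite (Pt U) := by
  obtain ⟨a, ha⟩ := hU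
  have : Nonempty {a // a ∈ U} := ⟨⟨a, ha⟩⟩
  exact Module.Free.infinite ℝ (Pt U)

end RelCluster

theorem mainTheorem5 (q : JoinQuery) (hq : q.Acyclic) (U : Finset (Fin q.d)) (hU : U.Nonempty) :
    -- geometric version
    (∃ prog : Prog U, ∀ ε α : ℝ, 0 < ε → ε < 1 → ∃ K : ℕ, ∀ B : ℕ, ∃ K' : ℕ,
      ∀ (D : Instance q) (N : ℕ) (X : List (Pt U)) (k : ℕ) (r γ : ℝ)
        (f : List (Pt U × ℝ) → List (Pt U)) (T : ℕ → ℕ),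
        2 ≤ N → (∀ j, (D.rows j).length ≤ N) → X.Nodup → X ≠ [] → 1 ≤ k →
        cost (unweighted (joinProj D U)) {x | x ∈ X} ≤ r →
        r ≤ α * opt k (unweighted (joinProj D U)) →
        1 ≤ γ → IsGeomApprox k γ f → Monotone T →
        ∃ (s : Store U) (t : ℕ), Exec f T prog (input D X k ε α r) s t ∧
          (t : ℝ) ≤ K * ((X.length : ℝ) ^ (U.card + 1) * N * Real.logb 2 N ^ (U.card + 2))
            + T ⌊K * (X.length * Real.logb 2 N)⌋₊ ∧
          ((∀ x, T (2 * x) ≤ B * T x) →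
            (t : ℝ) ≤ K' * ((X.length : ℝ) ^ (U.card + 1) * N * Real.logb 2 N ^ (U.card + 2)
              + T ⌈X.length * Real.logb 2 N⌉₊)) ∧
          IsWeightedSet s.coreset ∧ (∀ p ∈ s.coreset, p.1 ∈ joinProj D U) ∧
          (s.coreset.length : ℝ) ≤ K * (X.length * Real.logb 2 N) ∧
          IsCoreset k ε s.coreset (unweighted (joinProj D U)) ∧
          (s.solution k).encard = k ∧
          cost (unweighted (joinProj D U)) (s.solution k) ≤ s.rvar .ru ∧
          s.rvar .ru ≤ (1 + ε) * γ * opt k (unweighted (joinProj D U))) ∧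
    -- discrete version
    (∃ prog : Prog U, ∀ ε α : ℝ, 0 < ε → ε < 1 → ∃ K : ℕ, ∀ B : ℕ, ∃ K' : ℕ,
      ∀ (D : Instance q) (N : ℕ) (X : List (Pt U)) (k : ℕ) (r γ : ℝ)
        (f : List (Pt U × ℝ) → List (Pt U)) (T : ℕ → ℕ),
        2 ≤ N → (∀ j, (D.rows j).length ≤ N) → X.Nodup → X ≠ [] → 1 ≤ k →
        (∃ Y : Set (Pt U), Y.encard = k ∧ ∀ y ∈ Y, y ∈ joinProj D U) →
        cost (unweighted (joinProj D U)) {x | x ∈ X} ≤ r →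
        r ≤ α * opt k (unweighted (joinProj D U)) →
        1 ≤ γ → IsDiscApprox k γ f → Monotone T →
        ∃ (s : Store U) (t : ℕ), Exec f T prog (input D X k ε α r) s t ∧
          (t : ℝ) ≤ K * ((X.length : ℝ) ^ (U.card + 1) * N * Real.logb 2 N ^ (U.card + 2))
            + T ⌊K * (X.length * Real.logb 2 N)⌋₊ ∧
          ((∀ x, T (2 * x) ≤ B * T x) →
            (t : ℝ) ≤ K' * ((X.length : ℝ) ^ (U.card + 1) * N * Real.logb 2 N ^ (U.card + 2)
              + T ⌈X.length * Real.logb 2 N⌉₊)) ∧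
          IsWeightedSet s.coreset ∧ (∀ p ∈ s.coreset, p.1 ∈ joinProj D U) ∧
          (s.coreset.length : ℝ) ≤ K * (X.length * Real.logb 2 N) ∧
          IsCoreset k ε s.coreset (unweighted (joinProj D U)) ∧
          (s.solution k).encard = k ∧ (∀ y ∈ s.solution k, y ∈ joinProj D U) ∧
          cost (unweighted (joinProj D U)) (s.solution k) ≤ s.rvar .ru ∧
          s.rvar .ru ≤ (2 + ε) * γ * optDisc k (unweighted (joinProj D U))) := by

  have := infinite_pt hU
  obtain ⟨L, r₀, hE⟩ := hq.exists_elim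
  have hpos : ∀ D : Instance q, ∀ p ∈ unweighted (joinProj D U), 0 < p.2 :=
    fun D => unweighted_pos _
  have hcost : ∀ (D : Instance q) (Y : Set (Pt U)), 0 ≤ cost (unweighted (joinProj D U)) Y :=
    fun D => cost_nonneg fun p hp => (hpos D p hp).le
  have hlen : ∀ {N c x n : ℕ}, n ≤ c * (x * Nat.log 2 N) → (n : ℝ) ≤ c * (x * Real.logb 2 N) := by
    intro N c x n h
    refine le_trans (b := (c * (x * Nat.log 2 N) : ℝ)) (by exact_mod_cast h) ?_
    gcongr
    exact log_le_logb
  -- The same program serves both versions; only the black box behind `cluster` and the transfer of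
  -- its guarantee differ.
  refine ⟨⟨mainProg U L r₀, fun ε α hε hε1 => ?_⟩, ⟨mainProg U L r₀, fun ε α hε hε1 => ?_⟩⟩
  · obtain ⟨c, h⟩ := mainProg_runs hE hU hε hε1 α
    refine ⟨c, fun B => ⟨c + B ^ c, ?_⟩⟩
    intro D N X k r γ f T hN hrows _ hX hk hr hrα hγ hf hT
    obtain ⟨s, t, hexec, ht, h1, h2, h3, h4, h5, h6⟩ := h D N X k r f T hN hrows hX hk hr hrα hT
      fun C hC hcs => (geometric_guarantee hε hε1 hγ (hpos D) hC hcs hf).1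
    obtain ⟨-, h7, h8, h9⟩ := geometric_guarantee hε hε1 hγ (hpos D) h1 h4 hf
    rw [← h5] at h7
    rw [← h5] at h8 h9
    rw [← h5] at h6
    rw [← h6] at h8 h9
    exact ⟨s, t, hexec, steps_le_of_monotone hT ht, fun hB => steps_le_of_doubling hT hB ht, h1, h2,
      hlen h3, h4.mono (by linarith) (hcost D), h7, h8, h9⟩
  · obtain ⟨c, h⟩ := mainProg_runs hE hU hε hε1 α
    refine ⟨c, fun B => ⟨c + B ^ c, ?_⟩⟩
    intro D N X k r γ f T hN hrows _ hX hk hex hr hrα hγ hf hT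
    have hex' : ∃ Y : Set (Pt U), Y.encard = k ∧
        ∀ y ∈ Y, ∃ p ∈ unweighted (joinProj D U), p.1 = y := by
      obtain ⟨Y, hY, hYP⟩ := hex
      exact ⟨Y, hY, fun y hy => ⟨(y, 1), Multiset.mem_map_of_mem _ (hYP y hy), rfl⟩⟩
    obtain ⟨s, t, hexec, ht, h1, h2, h3, h4, h5, h6⟩ := h D N X k r f T hN hrows hX hk hr hrα hT
      fun C hC hcs => (discrete_guarantee hε hε1 hγ hk (hpos D) hC hcs hf hex').1
    obtain ⟨-, h7, h10, h8, h9⟩ := discrete_guarantee hε hε1 hγ hk (hpos D) h1 h4 hf hex'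
    have h11 : ∀ y ∈ s.solution k, y ∈ joinProj D U := by
      intro y hy
      rw [h5] at hy
      obtain ⟨p, hp, rfl⟩ := List.mem_map.1 (h10 y hy)
      exact h2 p hp
    rw [← h5] at h7
    rw [← h5] at h8 h9
    rw [← h5] at h6
    rw [← h6] at h8 h9
    exact ⟨s, t, hexec, steps_le_of_monotone hT ht, fun hB => steps_le_of_doubling hT hB ht, h1, h2,
      hlen h3, h4.mono (by linarith) (hcost D), h7, h11, h8, h9⟩
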